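/- **Theorem 3.1.** Let $d\in\{2,3\}$ and consider one of the following two settings. (N) $\Omega\subset\mathbb R^d$ is a bounded (connected) domain with Lipschitz boundary, with homogeneous Neumann conditions; put $H^1=H^1(\Omega)$. (P) $\Omega=\prod_i(0,L_i)$, $L_i>0$, with periodic boundary conditions; let $H^1$ be the space of periodic $H^1$ functions. Write $(\cdot,\cdot)$ for the $L^2(\Omega)$ inner product and $H^1_0$ for the subspace $\{u\in H^1:\int_\Omega u=0\}$ (mean zero). Let $\alpha,\beta\ge0$, $\varepsilon,\delta t>0$. Let $F$ be the double well potential $F(s)=s^2(s-1)^2$, or the regularized Flory–Huggins potential with parameters $\theta>0$, $0<\sigma<\tfrac12$: $$F(s)=\begin{cases} s\ln s+\frac{(1-s)^2}{2\sigma}+(1-s)\ln\sigma-\frac\sigma2+\theta s(1-s), & s\ge 1-\sigma,\\ s\ln s+(1-s)\ln(1-s)+\theta s(1-s), & \sigma\le s\le 1-\sigma,\\ (1-s)\ln(1-s)+\frac{s^2}{2\sigma}+s\ln\sigma-\frac\sigma2+\theta s(1-s), & s\le\sigma.\end{cases}$$ Let $B$ be a constant with $F(s)+B>0$ for all $s\in\mathbb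 R$, and $H=F'/\sqrt{F+B}$. *The scheme.* With $\phi^{-1}=\phi^0$, $\psi^0=0$, $U^0=\sqrt{F(\phi^0)+B}$, $\phi^*=\frac32\phi^n-\frac12\phi^{n-1}$ and $H^*=H(\phi^*)$, one step of the Crank–Nicolson scheme is, for $n\ge0$, $$\alpha\tfrac{\psi^{n+1}-\psi^n}{\delta t}+\tfrac{\psi^{n+1}+\psi^n}2=\Delta\mu^{n+1},\qquad \mu^{n+1}=-\varepsilon^2\Delta\tfrac{\phi^{n+1}+\phi^n}2+\tfrac{U^{n+1}+U^n}2H^*+\beta\tfrac{\phi^{n+1}-\phi^n}{\delta t},$$ $$U^{n+1}-U^n=\tfrac12H^*(\phi^{n+1}-\phi^n),\qquad \tfrac{\psi^{n+1}+\psi^n}2=\tfrac{\phi^{n+1}-\phi^n}{\delta t}.$$ Eliminating $U^{n+1}$ and $\psi^{n+1}$ gives the linear system for $(\phi^{n+1},\mu^{n+1})$ $$\widehat\alpha\,\phi^{n+1}=\Delta\mu^{n+1}+g_3\quad(3.21),\qquad \mu^{n+1}=P_1(\phi^{n+1})+g_4\quad(3.22),$$ where $\widehat\alpha=(\frac\alpha{\delta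 t}+\frac12)\frac2{\delta t}$, $P_1(\phi)=-\frac{\varepsilon^2}2\Delta\phi+\frac14H^*H^*\phi+\frac\beta{\delta t}\phi$, $g_1=U^n-\frac{H^*}2\phi^n$, $g_2=-\frac2{\delta t}\phi^n-\psi^n$, $g_3=-(\frac\alpha{\delta t}+\frac12)g_2+(\frac\alpha{\delta t}-\frac12)\psi^n$, $g_4=-\frac{\varepsilon^2}2\Delta\phi^n+\frac12H^*(g_1+U^n)-\frac\beta{\delta t}\phi^n$. All equations containing $\Delta$ are understood weakly, tested with all $v\in H^1$, where $\Delta u$ pairs with $v$ to $-(\nabla u,\nabla v)$. For $u\in L^2(\Omega)$ with $\int_\Omega u=0$, let $\Delta^{-1}u$ be the $v\in H^1_0$ with $(\nabla v,\nabla w)=-(u,w)$ for all $w\in H^1$. *Claim.* $\Delta^{-1}u$ exists and is unique for every such $u$. Moreover, for all $\phi^{n-1},\phi^n\in H^1$ and $\psi^n,U^n\in L^2(\Omega)$: 1. $H^*v\in L^2(\Omega)$ for all $v\in H^1$ (so all integrals in the weak formulation converge), and the linear system (3.21)–(3.22) has a unique solution $(\phi^{n+1},\mu^{n+1})\in H^1\times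 H^1$. 2. The operator $\mathbb A=-\widehat\alpha\Delta^{-1}+P_1$, in the form sense $(\mathbb A\phi,v)=-\widehat\alpha(\Delta^{-1}\phi,v)+\frac{\varepsilon^2}2(\nabla\phi,\nabla v)+\frac14(H^*\phi,H^*v)+\frac\beta{\delta t}(\phi,v)$ for $\phi,v\in H^1_0$, is a bounded linear operator from $H^1_0$ to its dual; it is symmetric, $(\mathbb A\phi,v)=(\phi,\mathbb Av)$, and positive definite, $(\mathbb A\phi,\phi)\ge0$ with equality only for $\phi=0$, and even coercive, $(\mathbb A\phi,\phi)\ge c\|\phi\|_{H^1}^2$ with some $c>0$. 3. Suppose $\int_\Omega\psi^n=0$, and let $V_\phi=\frac1{|\Omega|}\int_\Omega\phi^n$, $f=g_3-\widehat\alpha V_\phi$ and $g=g_4+\frac14H^*H^*V_\phi+\frac\beta{\delta t}V_\phi$. Then $\int_\Omega f=0$, and the reduced equation $$-\widehat\alpha\Delta^{-1}\widehat\phi+P_1(\widehat\phi)-V_\mu=-\Delta^{-1}f-g$$ has a unique solution $(\widehat\phi,V_\mu)\in H^1_0\times\mathbb R$; if $(\phi^{n+1},\mu^{n+1})$ solves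 (3.21)–(3.22), then this solution is $\widehat\phi=\phi^{n+1}-V_\phi$, $V_\mu=\frac1{|\Omega|}\int_\Omega\mu^{n+1}$. Consequently, for every $\phi^0\in H^1$ there is exactly one sequence of iterates $\phi^n,\mu^{n+1}\in H^1$, $\psi^n,U^n\in L^2(\Omega)$, $n\ge0$, of the scheme; each $(\phi^{n+1},\mu^{n+1})$ solves (3.21)–(3.22), and $\int_\Omega\psi^n=0$, $\int_\Omega\phi^n=\int_\Omega\phi^0$ for all $n$. -/

import Mathlib

open MeasureTheory Set
open scoped ContDiff

noncomputable section

namespace VCH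

/-- Euclidean space `ℝ^d`. -/
abbrev E (d : ℕ) : Type := EuclideanSpace ℝ (Fin d)

/-- `Ω` has a Lipschitz boundary: near each boundary point, for a suitable unit vector `e`, the set
is the strict epigraph, in direction `e`, of a Lipschitz function of the component orthogonal
to `e`. -/
def HasLipschitzBoundary {d : ℕ} (Ω : Set (E d)) : Prop :=
  ∀ x₀ ∈ frontier Ω, ∃ (e : E d) (γ : E d → ℝ) (K : NNReal) (r : ℝ),
    ‖e‖ = 1 ∧ LipschitzWith K γ ∧ 0 < r ∧
      ∀ x ∈ Metric.ball x₀ r, x ∈ Ω ↔ γ (x - inner ℝ e x • e) < inner ℝ e x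

/-- The open box `∏ (0, L i)`. -/
def openBox {d : ℕ} (L : Fin d → ℝ) : Set (E d) := {x | ∀ i, x i ∈ Ioo 0 (L i)}

/-- The domain together with the boundary conditions: either homogeneous Neumann conditions on a
bounded Lipschitz domain, or periodic conditions on a box with side lengths `L i`. -/
inductive Setting (d : ℕ) : Type
  | neumann (Ω : Set (E d)) (isOpen : IsOpen Ω) (isBounded : Bornology.IsBounded Ω)
      (isConnected : IsConnected Ω) (lipschitz : HasLipschitzBoundary Ω) : Setting d
  | periodic (L : Fin d → ℝ) (pos : ∀ i, 0 < L i) : Setting d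

namespace Setting

variable {d : ℕ}

/-- The domain `Ω`. -/
def dom : Setting d → Set (E d)
  | neumann Ω _ _ _ _ => Ω
  | periodic L _ => openBox L

/-- The smooth functions against which weak gradients are tested: `C_c^∞(Ω)` in the Neumann case
(so that the Sobolev space below is `H¹(Ω)`), and smooth periodic functions on `ℝ^d` in the
periodic case (so that the Sobolev space below is the space of periodic `H¹` functions). -/
def IsTest : Setting d → (E d → ℝ) → Prop
  | neumann Ω _ _ _ _, η => ContDiff ℝ ∞ η ∧ HasCompactSupport η ∧ tsupport η ⊆ Ω
  | periodic L _, η => ContDiff ℝ ∞ η ∧ ∀ x i, η (x + EuclideanSpace.single i (L i)) = η x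

/-- Lebesgue measure on the domain. -/
abbrev vol (D : Setting d) : Measure (E d) := volume.restrict D.dom

theorem isBounded_dom (D : Setting d) : Bornology.IsBounded D.dom := by
  cases D with
  | neumann Ω _ hb _ _ => exact hb
  | periodic L hL =>
    refine (Metric.isBounded_closedBall (x := (0 : E d)) (r := ∑ i, L i)).subset ?_
    intro x hx
    rw [mem_closedBall_zero_iff, EuclideanSpace.norm_eq]
    refine Real.sqrt_le_iff.2 ⟨Finset.sum_nonneg fun i _ => (hL i).le, ?_⟩
    refine le_trans (Finset.sum_le_sum (g := fun i => L i ^ 2) fun i _ => ?_)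
      (Finset.sum_sq_le_sq_sum_of_nonneg fun i _ => (hL i).le)
    have h := hx i
    rw [Real.norm_eq_abs, sq_abs]
    nlinarith [h.1, h.2]

instance (D : Setting d) : IsFiniteMeasure D.vol :=
  ⟨by
    rw [Measure.restrict_apply_univ]
    exact D.isBounded_dom.measure_lt_top⟩

theorem IsTest.contDiff {D : Setting d} {η : E d → ℝ} (h : D.IsTest η) : ContDiff ℝ ∞ η := by
  cases D <;> exact h.1

/-- The space `L²(Ω)`. -/
abbrev L2 (D : Setting d) : Type := Lp ℝ 2 D.vol

/-- The space `L²(Ω; ℝ^d)`. -/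
abbrev L2v (D : Setting d) : Type := Lp (E d) 2 D.vol

/-- `g` is the weak gradient of `u` (with the boundary conditions encoded by the class of test
functions). -/
def IsWeakGrad (D : Setting d) (u : D.L2) (g : D.L2v) : Prop :=
  ∀ η : E d → ℝ, D.IsTest η → ∀ e : E d,
    ∫ x in D.dom, u x * fderiv ℝ η x e = -∫ x in D.dom, inner ℝ (g x) e * η x

theorem integrable_mul_continuous (D : Setting d) {u η : E d → ℝ} (hu : MemLp u 2 D.vol)
    (hη : Continuous η) : Integrable (fun x => u x * η x) D.vol := by
  obtain ⟨C, hC⟩ :=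
    (D.isBounded_dom.isCompact_closure).exists_bound_of_continuousOn hη.continuousOn
  have h1 : Integrable u D.vol := hu.integrable (by norm_num)
  refine h1.mul_bdd (c := C) hη.aestronglyMeasurable ?_
  have hmem : ∀ᵐ x ∂D.vol, x ∈ closure D.dom :=
    ae_restrict_of_ae_restrict_of_subset subset_closure (ae_restrict_mem isClosed_closure.measurableSet)
  filter_upwards [hmem] with x hx using hC x hx

/-- The Sobolev space `H¹(Ω)` (Neumann case), respectively the space of periodic `H¹` functions:
the pairs `(u, ∇u)` of a square integrable function and its square integrable weak gradient. The
norm is `(‖u‖² + ‖∇u‖²)^(1/2)`. -/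
def H1 (D : Setting d) : Submodule ℝ (WithLp 2 (D.L2 × D.L2v)) where
  carrier := {p | D.IsWeakGrad p.fst p.snd}
  zero_mem' := by
    intro η hη e
    have h1 := Lp.coeFn_zero ℝ 2 D.vol
    have h2 := Lp.coeFn_zero (E d) 2 D.vol
    rw [integral_eq_zero_of_ae, integral_eq_zero_of_ae, neg_zero]
    · filter_upwards [h2] with x hx
      rw [WithLp.zero_snd, hx]
      simp
    · filter_upwards [h1] with x hx
      rw [WithLp.zero_fst, hx]
      simp
  add_mem' := by
    intro p q hp hq η hη e
    have hd : Continuous fun x => fderiv ℝ η x e :=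
      (hη.contDiff.continuous_fderiv (by simp)).clm_apply continuous_const
    have hc : Continuous η := hη.contDiff.continuous
    have i1 := D.integrable_mul_continuous (Lp.memLp p.fst) hd
    have i2 := D.integrable_mul_continuous (Lp.memLp q.fst) hd
    have i3 := D.integrable_mul_continuous ((Lp.memLp p.snd).inner_const (𝕜 := ℝ) e) hc
    have i4 := D.integrable_mul_continuous ((Lp.memLp q.snd).inner_const (𝕜 := ℝ) e) hc
    have e1 : ∫ x in D.dom, (p + q).fst x * fderiv ℝ η x e
        = ∫ x in D.dom, (p.fst x * fderiv ℝ η x e + q.fst x * fderiv ℝ η x e) := by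
      refine integral_congr_ae ?_
      filter_upwards [Lp.coeFn_add p.fst q.fst] with x hx
      rw [WithLp.add_fst, hx, Pi.add_apply, add_mul]
    have e2 : ∫ x in D.dom, inner ℝ ((p + q).snd x) e * η x
        = ∫ x in D.dom, (inner ℝ (p.snd x) e * η x + inner ℝ (q.snd x) e * η x) := by
      refine integral_congr_ae ?_
      filter_upwards [Lp.coeFn_add p.snd q.snd] with x hx
      rw [WithLp.add_snd, hx, Pi.add_apply, inner_add_left, add_mul]
    rw [e1, e2, integral_add i1 i2, integral_add i3 i4, hp η hη e, hq η hη e, neg_add]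
  smul_mem' := by
    intro c p hp η hη e
    have e1 : ∫ x in D.dom, (c • p).fst x * fderiv ℝ η x e
        = ∫ x in D.dom, c * (p.fst x * fderiv ℝ η x e) := by
      refine integral_congr_ae ?_
      filter_upwards [Lp.coeFn_smul c p.fst] with x hx
      rw [WithLp.smul_fst, hx, Pi.smul_apply, smul_eq_mul, mul_assoc]
    have e2 : ∫ x in D.dom, inner ℝ ((c • p).snd x) e * η x
        = ∫ x in D.dom, c * (inner ℝ (p.snd x) e * η x) := by
      refine integral_congr_ae ?_
      filter_upwards [Lp.coeFn_smul c p.snd] with x hx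
      rw [WithLp.smul_snd, hx, Pi.smul_apply, real_inner_smul_left, mul_assoc]
    rw [e1, e2, integral_const_mul, integral_const_mul, hp η hη e, mul_neg]

instance (D : Setting d) : NormedAddCommGroup D.H1 := Submodule.normedAddCommGroup _

instance (D : Setting d) : InnerProductSpace ℝ D.H1 := Submodule.innerProductSpace _

variable {D : Setting d}

/-- The function underlying an element of `H¹`. -/
def fn (u : D.H1) : D.L2 := u.1.fst

/-- The weak gradient of an element of `H¹`. -/
def grad (u : D.H1) : D.L2v := u.1.snd

theorem integral_smul_add (c : ℝ) (u v : D.L2) :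
    ∫ x in D.dom, (c • u + v) x = c * (∫ x in D.dom, u x) + ∫ x in D.dom, v x := by
  have iu : Integrable u D.vol := (Lp.memLp u).integrable (by norm_num)
  have iv : Integrable v D.vol := (Lp.memLp v).integrable (by norm_num)
  have e : ∫ x in D.dom, (c • u + v) x = ∫ x in D.dom, (c * u x + v x) := by
    refine integral_congr_ae ?_
    filter_upwards [Lp.coeFn_add (c • u) v, Lp.coeFn_smul c u] with x h1 h2
    rw [h1, Pi.add_apply, h2, Pi.smul_apply, smul_eq_mul]
  rw [e, integral_add (iu.const_mul c) iv, integral_const_mul]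

/-- The subspace of `H¹` of functions with mean zero. -/
def H1zero (D : Setting d) : Submodule ℝ D.H1 where
  carrier := {u | ∫ x in D.dom, fn u x = 0}
  zero_mem' := by
    refine integral_eq_zero_of_ae ?_
    exact Lp.coeFn_zero ℝ 2 D.vol
  add_mem' := by
    intro u v hu hv
    have h := integral_smul_add 1 (fn u) (fn v)
    rw [one_smul] at h
    have hu' : ∫ x in D.dom, fn u x = 0 := hu
    have hv' : ∫ x in D.dom, fn v x = 0 := hv
    exact h.trans (by rw [hu', hv']; simp)
  smul_mem' := by
    intro c u hu
    have h := integral_smul_add c (fn u) 0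
    rw [add_zero] at h
    refine h.trans ?_
    have hu' : ∫ x in D.dom, fn u x = 0 := hu
    rw [hu', integral_eq_zero_of_ae (Lp.coeFn_zero ℝ 2 D.vol)]
    simp

/-- `v = Δ⁻¹ u`: `u` and `v` have mean zero, and `v` is the weak solution of `Δ v = u` with the
boundary conditions of the setting. -/
def IsInvLaplacian (u : D.L2) (v : D.H1) : Prop :=
  ∫ x in D.dom, u x = 0 ∧ ∫ x in D.dom, fn v x = 0 ∧
    ∀ w : D.H1, inner ℝ (grad v) (grad w) = -inner ℝ u (fn w)

/-- The inverse Laplace operator `Δ⁻¹`; meaningful on functions with mean zero only. -/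
def invLaplacian (u : D.L2) : D.H1 := Classical.epsilon (IsInvLaplacian u)

end Setting

/-- The bulk potentials: the double well potential, and the Flory–Huggins potential regularized
with a small parameter `σ`. -/
inductive Potential : Type
  | doubleWell : Potential
  | floryHuggins (θ σ : ℝ) (hθ : 0 < θ) (hσ : 0 < σ) (hσ' : σ < 1 / 2) : Potential

/-- The bulk potential as a function on `ℝ`. -/
def Potential.F : Potential → ℝ → ℝ
  | .doubleWell, s => s ^ 2 * (s - 1) ^ 2
  | .floryHuggins θ σ _ _ _, s =>
    if 1 - σ ≤ s then
      s * Real.log s + (1 - s) ^ 2 / (2 * σ) + (1 - s) * Real.log σ - σ / 2 + θ * s * (1 - s)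
    else if σ ≤ s then
      s * Real.log s + (1 - s) * Real.log (1 - s) + θ * s * (1 - s)
    else
      (1 - s) * Real.log (1 - s) + s ^ 2 / (2 * σ) + s * Real.log σ - σ / 2 + θ * s * (1 - s)

/-- The parameters of the model and of the scheme: relaxation `α`, viscosity `β`, interfacial
width `ε`, time step `δt`, the bulk potential, and the constant `B` added to it. -/
structure Params where
  α : ℝ
  β : ℝ
  ε : ℝ
  δt : ℝ
  pot : Potential
  B : ℝ

namespace Params

/-- The standing assumptions on the parameters. -/
structure Admissible (P : Params) : Prop where
  α_nonneg : 0 ≤ P.α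
  β_nonneg : 0 ≤ P.β
  ε_pos : 0 < P.ε
  δt_pos : 0 < P.δt
  F_add_B_pos : ∀ s, 0 < P.pot.F s + P.B

/-- `H(s) = F'(s) / √(F(s) + B)`. -/
def H (P : Params) (s : ℝ) : ℝ := deriv P.pot.F s / Real.sqrt (P.pot.F s + P.B)

/-- `α̂ = (α/δt + 1/2) (2/δt)`. -/
def αhat (P : Params) : ℝ := (P.α / P.δt + 1 / 2) * (2 / P.δt)

end Params

open Setting

variable {d : ℕ} {D : Setting d}

/-- What the scheme needs to know in order to advance by one step: `φⁿ⁻¹`, `φⁿ`, `ψⁿ`, `Uⁿ`. -/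
structure Data (D : Setting d) where
  φprev : D.H1
  φ : D.H1
  ψ : D.L2
  U : D.L2

/-- `H* = H(φ*)` with `φ* = (3/2) φⁿ - (1/2) φⁿ⁻¹`. -/
def Hstar (P : Params) (s : Data D) (x : E d) : ℝ :=
  P.H (3 / 2 * fn s.φ x - 1 / 2 * fn s.φprev x)

/-- The pairing `(P₁(φ), v)`, where `P₁(φ) = -(ε²/2) Δφ + (1/4) H* H* φ + (β/δt) φ`. -/
def P1 (P : Params) (s : Data D) (φ v : D.H1) : ℝ :=
  P.ε ^ 2 / 2 * inner ℝ (grad φ) (grad v)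
    + 1 / 4 * (∫ x in D.dom, (Hstar P s x * fn φ x) * (Hstar P s x * fn v x))
    + P.β / P.δt * inner ℝ (fn φ) (fn v)

/-- `g₁ = Uⁿ - (H*/2) φⁿ`. -/
def g1 (P : Params) (s : Data D) (x : E d) : ℝ := s.U x - Hstar P s x / 2 * fn s.φ x

/-- `g₂ = -(2/δt) φⁿ - ψⁿ`. -/
def g2 (P : Params) (s : Data D) : D.L2 := -((2 / P.δt) • fn s.φ) - s.ψ

/-- `g₃ = -(α/δt + 1/2) g₂ + (α/δt - 1/2) ψⁿ`. -/
def g3 (P : Params) (s : Data D) : D.L2 :=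
  -((P.α / P.δt + 1 / 2) • g2 P s) + (P.α / P.δt - 1 / 2) • s.ψ

/-- The pairing `(g₄, v)`, where `g₄ = -(ε²/2) Δφⁿ + (1/2) H* (g₁ + Uⁿ) - (β/δt) φⁿ`. -/
def g4 (P : Params) (s : Data D) (v : D.H1) : ℝ :=
  P.ε ^ 2 / 2 * inner ℝ (grad s.φ) (grad v)
    + 1 / 2 * (∫ x in D.dom, Hstar P s x * (g1 P s x + s.U x) * fn v x)
    - P.β / P.δt * inner ℝ (fn s.φ) (fn v)

/-- The linear system of one step, for the unknowns `φ = φⁿ⁺¹` and `μ = μⁿ⁺¹`: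
`α̂ φ = Δμ + g₃`, `μ = P₁(φ) + g₄`, with the boundary conditions, in weak form. -/
def LinearSystem (P : Params) (s : Data D) (φ μ : D.H1) : Prop :=
  (∀ v : D.H1, P.αhat * inner ℝ (fn φ) (fn v)
      = -inner ℝ (grad μ) (grad v) + inner ℝ (g3 P s) (fn v)) ∧
  (∀ v : D.H1, inner ℝ (fn μ) (fn v) = P1 P s φ v + g4 P s v)

/-- The pairing `(𝔸φ, v)` of the operator `𝔸 = -α̂ Δ⁻¹ + P₁`. -/
def opA (P : Params) (s : Data D) (φ v : D.H1) : ℝ :=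
  -P.αhat * inner ℝ (fn (invLaplacian (fn φ))) (fn v) + P1 P s φ v

/-- `V_φ`, the mean value of `φⁿ`. -/
def Vφ (s : Data D) : ℝ := ⨍ x in D.dom, fn s.φ x

/-- `f = g₃ - α̂ V_φ`. -/
def redF (P : Params) (s : Data D) : D.L2 := g3 P s - Lp.const 2 D.vol (P.αhat * Vφ s)

/-- The pairing `(g, v)`, where `g = g₄ + (1/4) H* H* V_φ + (β/δt) V_φ`. -/
def redG (P : Params) (s : Data D) (v : D.H1) : ℝ :=
  g4 P s v + 1 / 4 * (∫ x in D.dom, (Hstar P s x * Vφ s) * (Hstar P s x * fn v x))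
    + P.β / P.δt * Vφ s * ∫ x in D.dom, fn v x

/-- The reduced equation `-α̂ Δ⁻¹ φ + P₁(φ) - V_μ = -Δ⁻¹ f - g`, in weak form, for a function `φ`
with mean zero and a real number `V_μ`. -/
def ReducedEquation (P : Params) (s : Data D) (φ : D.H1zero) (Vμ : ℝ) : Prop :=
  ∀ v : D.H1, opA P s φ v - Vμ * (∫ x in D.dom, fn v x)
    = -inner ℝ (fn (invLaplacian (redF P s))) (fn v) - redG P s v

/-- One step of the Crank–Nicolson scheme, in weak form: from the data `s` to
`φ = φⁿ⁺¹`, `μ = μⁿ⁺¹`, `ψ = ψⁿ⁺¹`, `U = Uⁿ⁺¹`. -/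
structure SchemeStep (P : Params) (s : Data D) (φ μ : D.H1) (ψ U : D.L2) : Prop where
  balance : ∀ v : D.H1,
    P.α / P.δt * inner ℝ (ψ - s.ψ) (fn v) + 1 / 2 * inner ℝ (ψ + s.ψ) (fn v)
      = -inner ℝ (grad μ) (grad v)
  potential : ∀ v : D.H1, inner ℝ (fn μ) (fn v)
    = P.ε ^ 2 / 2 * inner ℝ (grad φ + grad s.φ) (grad v)
      + (∫ x in D.dom, (U x + s.U x) / 2 * Hstar P s x * fn v x)
      + P.β / P.δt * inner ℝ (fn φ - fn s.φ) (fn v)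
  auxiliary : ∀ᵐ x ∂D.vol, U x - s.U x = 1 / 2 * Hstar P s x * (fn φ x - fn s.φ x)
  velocity : (1 / 2 : ℝ) • (ψ + s.ψ) = (1 / P.δt) • (fn φ - fn s.φ)

/-- A sequence of iterates of the scheme: `φ n = φⁿ`, `ψ n = ψⁿ`, `U n = Uⁿ`, but
`μ n = μⁿ⁺¹`, since `μ⁰` plays no role. -/
structure Iterates (D : Setting d) where
  φ : ℕ → D.H1
  μ : ℕ → D.H1
  ψ : ℕ → D.L2
  U : ℕ → D.L2

/-- The data available at time `n`. For `n = 0` the truncated subtraction gives the convention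
`φ⁻¹ = φ⁰` of the scheme. -/
def Iterates.data (R : Iterates D) (n : ℕ) : Data D := ⟨R.φ (n - 1), R.φ n, R.ψ n, R.U n⟩

/-- The sequence `R` is generated by the scheme from the initial value `φ⁰`, with `ψ⁰ = 0` and
`U⁰ = √(F(φ⁰) + B)`. -/
structure Iterates.IsRun (R : Iterates D) (P : Params) (φ₀ : D.H1) : Prop where
  φ_zero : R.φ 0 = φ₀
  ψ_zero : R.ψ 0 = 0
  U_zero : ∀ᵐ x ∂D.vol, R.U 0 x = Real.sqrt (P.pot.F (fn φ₀ x) + P.B)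
  step : ∀ n, SchemeStep P (R.data n) (R.φ (n + 1)) (R.μ n) (R.ψ (n + 1)) (R.U (n + 1))

end VCH

end

/-! The analytic input consists of two inequalities on `H¹`, valid in both settings in dimension at
most three: the Poincaré inequality for functions with mean zero, and the embedding into `L⁴`. Both
follow from one estimate, the `L⁴` norm of `u - c` by the `L²` norm of `∇u` for a suitable constant
`c` (`exists_lintegral_sub_pow_four_le`). Locally, `u y - u x` is the integral of `∇u` along the
segment from `x` to `y`. Averaging over `y` in an open set `B` visible from every `x` and applying
Hölder in the segment parameter bounds the deviation of `u` from its mean over `B`. A box and a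
Lipschitz domain are star-shaped in this sense near every point of the closure, and the local
constants are compared on overlaps, using connectedness of `Ω` and compactness of its closure.

The nonlinearity enters only through growth. `H` grows at most linearly
(`Params.Admissible.exists_abs_H_le`), so `H*` is in `L⁴` and multiplication by `H*` is bounded from
`H¹` to `L²`. Hence `P₁` is a bounded form that dominates `(ε²/2)‖∇φ‖²`. The nonlocal term `-(Δ⁻¹φ,
v)` equals `(∇Δ⁻¹φ, ∇Δ⁻¹v)`, a symmetric nonnegative form, so `𝔸` is bounded and symmetric, and the
Poincaré inequality makes it coercive on functions with mean zero.

Lax–Milgram solves the reduced equation for test functions with mean zero; the residual on all of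
`H¹` is then a multiple of the integral, and that multiple is `V_μ` (`existsUnique_reduced`).
Setting `μ = α̂ Δ⁻¹φ - Δ⁻¹f + V_μ` and adding the prescribed mean to `φ` gives a solution of the
linear system (`exists_linearSystem_of_reduced`). Uniqueness for that system is an energy argument
(`LinearSystem.unique`), which also identifies its solution with the reduced one. A step of the
scheme is the linear system together with explicit formulas for `ψ` and `U` (`schemeStep_iff`), so
the scheme is iteration of a single-valued map. Testing with constants shows that the means are
conserved. -/

namespace VCH

/-! ### Increments of weakly differentiable functions along segments. -/

section DifferenceFormula

variable {X : Type*} [NormedAddCommGroup X] [InnerProductSpace ℝ X] [FiniteDimensional ℝ X]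
  [MeasurableSpace X] [BorelSpace X]

/-- `g` is the distributional gradient of `u` in the open set `Ω`. Both functions are defined on
the whole space, but only their values in `Ω` matter. -/
def IsDistribGrad (Ω : Set X) (u : X → ℝ) (g : X → X) : Prop :=
  ∀ η : X → ℝ, ContDiff ℝ ∞ η → HasCompactSupport η → tsupport η ⊆ Ω → ∀ e : X,
    ∫ x, u x * fderiv ℝ η x e = -∫ x, inner ℝ (g x) e * η x

theorem isOpen_setOf_forall_add_smul_mem {X : Type*} [NormedAddCommGroup X] [NormedSpace ℝ X] {Ω : Set X} (hΩ : IsOpen Ω) (h : X) :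
    IsOpen {x : X | ∀ t ∈ Icc (0 : ℝ) 1, x + t • h ∈ Ω} := by
  rw [isOpen_iff_mem_nhds]
  intro x hx
  refine isCompact_Icc.eventually_forall_of_forall_eventually fun t ht => ?_
  have hc : Continuous fun p : X × ℝ => p.1 + p.2 • h := by fun_prop
  exact hc.continuousAt.eventually (hΩ.mem_nhds (hx t ht))

theorem integrable_prod_inner_add_smul {g : X → X} (hg : Integrable g) (hgm : StronglyMeasurable g)
    (h : X) :
    Integrable (fun p : X × ℝ => inner ℝ (g (p.1 + p.2 • h)) h)
      (volume.prod (volume.restrict (Ioc (0 : ℝ) 1))) := by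
  have hm : StronglyMeasurable fun p : X × ℝ => inner ℝ (g (p.1 + p.2 • h)) h :=
    (hgm.comp_measurable (by fun_prop)).inner stronglyMeasurable_const
  rw [integrable_prod_iff' hm.aestronglyMeasurable]
  refine ⟨Filter.Eventually.of_forall fun t => (hg.comp_add_right (t • h)).inner_const h, ?_⟩
  have : (fun t : ℝ => ∫ x, ‖(inner ℝ (g (x + t • h)) h : ℝ)‖)
      = fun _ => ∫ x, ‖(inner ℝ (g x) h : ℝ)‖ := by
    funext t
    exact integral_add_right_eq_self (fun x => ‖(inner ℝ (g x) h : ℝ)‖) (t • h)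
  simp only [this]
  exact integrable_const _

/-- Along almost every segment contained in `Ω` that is parallel to `h`, the increment of a function
is the integral of its distributional derivative. -/
theorem IsDistribGrad.ae_sub_eq_integral {Ω : Set X} (hΩ : IsOpen Ω) {u : X → ℝ} {g : X → X}
    (hu : Integrable u) (hg : Integrable g) (hgm : StronglyMeasurable g)
    (H : IsDistribGrad Ω u g) (h : X) :
    ∀ᵐ x : X, (∀ t ∈ Icc (0 : ℝ) 1, x + t • h ∈ Ω) →
      u (x + h) - u x = ∫ t in Ioc (0 : ℝ) 1, inner ℝ (g (x + t • h)) h := by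
  have hprod := integrable_prod_inner_add_smul hg hgm h
  have i1 : Integrable fun x => u (x + h) := hu.comp_add_right h
  have i2 : Integrable fun x => ∫ t in Ioc (0 : ℝ) 1, (inner ℝ (g (x + t • h)) h : ℝ) :=
    hprod.integral_prod_left
  -- It suffices to test with smooth `ψ` supported in the open set of admissible starting points.
  -- This choice of support puts every translate `ψ(· - t h)`, `t ∈ [0, 1]`, inside `Ω`, so that `H`
  -- applies to each of them.
  have key := IsOpen.ae_eq_zero_of_integral_contDiff_smul_eq_zero (μ := (volume : Measure X))
    (f := fun x => u (x + h) - u x - ∫ t in Ioc (0 : ℝ) 1, inner ℝ (g (x + t • h)) h)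
    (isOpen_setOf_forall_add_smul_mem hΩ h)
    (((i1.sub hu).sub i2).locallyIntegrable.locallyIntegrableOn _) ?_
  · filter_upwards [key] with x hx hxU
    linarith [hx hxU]
  intro ψ hψ hψc hψU
  simp only [smul_eq_mul]
  have hψcont : Continuous ψ := hψ.continuous
  obtain ⟨C, hC⟩ := hψc.exists_bound_of_continuous hψcont
  have hdcont : Continuous (fderiv ℝ ψ) := hψ.continuous_fderiv (by simp)
  obtain ⟨C', hC'⟩ := (hψc.fderiv ℝ).exists_bound_of_continuous hdcont
  have j1 : Integrable fun x => ψ x * u (x + h) :=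
    i1.bdd_mul hψcont.aestronglyMeasurable (Filter.Eventually.of_forall hC)
  have j2 : Integrable fun x => ψ x * u x :=
    hu.bdd_mul hψcont.aestronglyMeasurable (Filter.Eventually.of_forall hC)
  have j3 : Integrable fun x => ψ x * ∫ t in Ioc (0 : ℝ) 1, (inner ℝ (g (x + t • h)) h : ℝ) :=
    i2.bdd_mul hψcont.aestronglyMeasurable (Filter.Eventually.of_forall hC)
  have j4 : Integrable fun x => u x * ψ (x - h) :=
    hu.mul_bdd (hψcont.comp (continuous_sub_right h)).aestronglyMeasurable
      (Filter.Eventually.of_forall fun x => hC _)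
  have j5 : Integrable fun x => u x * ψ x :=
    hu.mul_bdd hψcont.aestronglyMeasurable (Filter.Eventually.of_forall hC)
  have e1 : ∫ x, ψ x * u (x + h) = ∫ x, u x * ψ (x - h) := by
    rw [← integral_add_right_eq_self (fun x => u x * ψ (x - h)) h]
    simp [mul_comm]
  have e2 : ∫ x, ψ x * ∫ t in Ioc (0 : ℝ) 1, (inner ℝ (g (x + t • h)) h : ℝ)
      = ∫ t in Ioc (0 : ℝ) 1, ∫ x, ψ x * inner ℝ (g (x + t • h)) h := by
    simp_rw [← integral_const_mul]
    rw [integral_integral_swap]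
    exact hprod.bdd_mul (hψcont.comp continuous_fst).aestronglyMeasurable
      (Filter.Eventually.of_forall fun p => hC p.1)
  have e3 : ∀ t ∈ Ioc (0 : ℝ) 1, ∫ x, ψ x * inner ℝ (g (x + t • h)) h
      = ∫ x, u x * -(fderiv ℝ ψ (x - t • h) h) := by
    intro t ht
    have h1 : ∫ x, ψ x * inner ℝ (g (x + t • h)) h
        = ∫ x, inner ℝ (g x) h * ψ (x - t • h) := by
      rw [← integral_add_right_eq_self (fun x => inner ℝ (g x) h * ψ (x - t • h)) (t • h)]
      simp [mul_comm]
    have hsupp : tsupport (fun x => ψ (x - t • h)) ⊆ Ω := by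
      have : tsupport (fun x => ψ (x - t • h)) ⊆ (fun x => x - t • h) ⁻¹' tsupport ψ :=
        tsupport_comp_subset_preimage ψ (continuous_sub_right (t • h))
      intro x hx
      have h2 := hψU (this hx) t ⟨ht.1.le, ht.2⟩
      simpa using h2
    have h3 := H (fun x => ψ (x - t • h)) (hψ.comp (contDiff_id.sub contDiff_const))
      (hψc.comp_homeomorph (Homeomorph.subRight (t • h))) hsupp h
    rw [h1, ← neg_eq_iff_eq_neg.2 h3, ← integral_neg]
    refine integral_congr_ae (Filter.Eventually.of_forall fun x => ?_)
    simp only [fderiv_comp_sub]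
    ring
  -- After exchanging the integrals, the inner one is the fundamental theorem of calculus for `t ↦
  -- ψ(x - t h)`; no regularity of `u` is needed.
  have e4 : ∫ t in Ioc (0 : ℝ) 1, ∫ x, u x * -(fderiv ℝ ψ (x - t • h) h)
      = ∫ x, u x * (ψ (x - h) - ψ x) := by
    rw [integral_integral_swap]
    · refine integral_congr_ae (Filter.Eventually.of_forall fun x => ?_)
      simp only [integral_const_mul]
      congr 1
      have hder : ∀ t : ℝ, HasDerivAt (fun t : ℝ => ψ (x - t • h))
          (-(fderiv ℝ ψ (x - t • h) h)) t := by
        intro t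
        have h1 : HasDerivAt (fun t : ℝ => x - t • h) (-h) t := by
          simpa using ((hasDerivAt_id t).smul_const h).const_sub x
        have h2 := ((hψ.differentiable (by simp)) (x - t • h)).hasFDerivAt.comp_hasDerivAt t h1
        rw [← map_neg]
        exact h2
      rw [← intervalIntegral.integral_of_le zero_le_one,
        intervalIntegral.integral_eq_sub_of_hasDerivAt (fun t _ => hder t)]
      · simp
      · refine Continuous.intervalIntegrable ?_ _ _
        fun_prop
    · have hu' : Integrable (fun p : ℝ × X => u p.2)
          ((volume.restrict (Ioc (0 : ℝ) 1)).prod volume) := hu.comp_snd _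
      refine hu'.mul_bdd (c := C' * ‖h‖) ?_ (Filter.Eventually.of_forall fun p => ?_)
      · refine Continuous.aestronglyMeasurable ?_
        fun_prop
      · rw [norm_neg]
        exact ((fderiv ℝ ψ _).le_opNorm h).trans (by gcongr; exact hC' _)
  have e5 : ∫ x, ψ x * (u (x + h) - u x - ∫ t in Ioc (0 : ℝ) 1, (inner ℝ (g (x + t • h)) h : ℝ))
      = (∫ x, ψ x * u (x + h)) - (∫ x, ψ x * u x)
        - ∫ x, ψ x * ∫ t in Ioc (0 : ℝ) 1, (inner ℝ (g (x + t • h)) h : ℝ) := by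
    have j12 : Integrable fun x => ψ x * u (x + h) - ψ x * u x := j1.sub j2
    rw [← integral_sub j1 j2, ← integral_sub j12 j3]
    congr 1; funext x; ring
  rw [e5, e1, e2, setIntegral_congr_fun measurableSet_Ioc e3, e4]
  simp_rw [mul_sub]
  rw [integral_sub j4 j5]
  simp [mul_comm]

end DifferenceFormula
end VCH

namespace VCH

/-! ### The local `L⁴` estimate for the deviation from an average. -/

section LocalEstimate

open ENNReal

theorem sq_lintegral_le {α : Type*} [MeasurableSpace α] (μ : Measure α) {f : α → ℝ≥0∞}
    (hf : AEMeasurable f μ) : (∫⁻ x, f x ∂μ) ^ 2 ≤ μ univ * ∫⁻ x, f x ^ 2 ∂μ := by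
  have h := ENNReal.lintegral_mul_le_Lp_mul_Lq μ Real.HolderConjugate.two_two
    (f := fun _ => 1) aemeasurable_const hf
  simp only [Pi.mul_apply, one_mul, lintegral_const, ENNReal.rpow_two, one_pow] at h
  calc (∫⁻ x, f x ∂μ) ^ 2
      ≤ (μ univ ^ (1 / 2 : ℝ) * (∫⁻ x, f x ^ 2 ∂μ) ^ (1 / 2 : ℝ)) ^ 2 := by gcongr
    _ = μ univ * ∫⁻ x, f x ^ 2 ∂μ := by
        rw [mul_pow, ← ENNReal.rpow_natCast, ← ENNReal.rpow_natCast, ← ENNReal.rpow_mul,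
          ← ENNReal.rpow_mul]
        norm_num

theorem lintegral_Ioc_rpow_lt_top {r : ℝ} (hr : -1 < r) :
    ∫⁻ t in Ioc (0 : ℝ) 1, ENNReal.ofReal (t ^ r) < ⊤ := by
  have h : IntervalIntegrable (fun t : ℝ => t ^ r) volume 0 1 :=
    intervalIntegral.intervalIntegrable_rpow' hr
  rw [intervalIntegrable_iff_integrableOn_Ioc_of_le zero_le_one] at h
  exact h.lintegral_lt_top

/-- Hölder's inequality with a weight that is a power of the variable. -/
theorem pow_four_lintegral_Ioc_le {f : ℝ → ℝ≥0∞} (hf : Measurable f) :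
    (∫⁻ t in Ioc (0 : ℝ) 1, f t) ^ 4
      ≤ (∫⁻ t in Ioc (0 : ℝ) 1, ENNReal.ofReal (t ^ (-(5 / 6) : ℝ))) ^ 3
        * ∫⁻ t in Ioc (0 : ℝ) 1, ENNReal.ofReal (t ^ (5 / 2 : ℝ)) * f t ^ 4 := by
  have hpq : (4 / 3 : ℝ).HolderConjugate 4 := by
    rw [Real.holderConjugate_iff]; norm_num
  -- A splitting `f = t^(-a) · t^a f` needs `4a/3 < 1` for the first factor to be integrable, and
  -- `4a - 3 > -1` to absorb the later singularity `t^(-3)`. The value `a = 5/8` is the midpoint of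
  -- the admissible range `(1/2, 3/4)`.
  have h := ENNReal.lintegral_mul_le_Lp_mul_Lq (volume.restrict (Ioc (0 : ℝ) 1)) hpq
    (f := fun t => ENNReal.ofReal (t ^ (-(5 / 8) : ℝ)))
    (g := fun t => ENNReal.ofReal (t ^ (5 / 8 : ℝ)) * f t)
    (by fun_prop) (by fun_prop)
  have e1 : ∫⁻ t in Ioc (0 : ℝ) 1, f t = ∫⁻ t in Ioc (0 : ℝ) 1,
      ((fun t => ENNReal.ofReal (t ^ (-(5 / 8) : ℝ))) * fun t =>
        ENNReal.ofReal (t ^ (5 / 8 : ℝ)) * f t) t := by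
    refine setLIntegral_congr_fun measurableSet_Ioc fun t ht => ?_
    simp only [Pi.mul_apply]
    rw [← mul_assoc, ← ENNReal.ofReal_mul (Real.rpow_nonneg ht.1.le _), ← Real.rpow_add ht.1]
    simp
  have e2 : ∫⁻ t in Ioc (0 : ℝ) 1, ENNReal.ofReal (t ^ (-(5 / 8) : ℝ)) ^ (4 / 3 : ℝ)
      = ∫⁻ t in Ioc (0 : ℝ) 1, ENNReal.ofReal (t ^ (-(5 / 6) : ℝ)) := by
    refine setLIntegral_congr_fun measurableSet_Ioc fun t ht => ?_
    rw [ENNReal.ofReal_rpow_of_pos (Real.rpow_pos_of_pos ht.1 _), ← Real.rpow_mul ht.1.le]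
    norm_num
  have e3 : ∫⁻ t in Ioc (0 : ℝ) 1, (ENNReal.ofReal (t ^ (5 / 8 : ℝ)) * f t) ^ (4 : ℝ)
      = ∫⁻ t in Ioc (0 : ℝ) 1, ENNReal.ofReal (t ^ (5 / 2 : ℝ)) * f t ^ 4 := by
    refine setLIntegral_congr_fun measurableSet_Ioc fun t ht => ?_
    rw [ENNReal.mul_rpow_of_nonneg _ _ (by norm_num),
      ENNReal.ofReal_rpow_of_pos (Real.rpow_pos_of_pos ht.1 _), ← Real.rpow_mul ht.1.le]
    norm_num
  rw [← e1, e2, e3] at h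
  calc _ ≤ _ := pow_le_pow_left' h 4
    _ = _ := by
      rw [mul_pow, ← ENNReal.rpow_natCast, ← ENNReal.rpow_natCast, ← ENNReal.rpow_natCast,
        ← ENNReal.rpow_mul, ← ENNReal.rpow_mul]
      norm_num

variable {X : Type*} [NormedAddCommGroup X] [InnerProductSpace ℝ X] [FiniteDimensional ℝ X]
  [MeasurableSpace X] [BorelSpace X]

theorem lintegral_comp_add_smul (f : X → ℝ≥0∞) (a : X) {t : ℝ} (ht : 0 < t) :
    ∫⁻ y, f (a + t • y) = ENNReal.ofReal ((t ^ Module.finrank ℝ X)⁻¹) * ∫⁻ y, f y := by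
  have h1 : ∫⁻ y, f (a + t • y) = ∫⁻ y, f (a + y) ∂(Measure.map (t • ·) volume) := by
    rw [(measurableEmbedding_const_smul₀ ht.ne').lintegral_map]
  rw [h1, Measure.map_addHaar_smul volume ht.ne', lintegral_smul_measure,
    lintegral_add_left_eq_self f a, abs_of_pos (by positivity), smul_eq_mul]

/-- The average of `G` over the segments from `x` to the points of `B`, at the parameter `t`. -/
noncomputable def segmentAverage (B : Set X) (G : X → ℝ≥0∞) (t : ℝ) (x : X) : ℝ≥0∞ :=
  ∫⁻ y in B, G (x + t • (y - x))

theorem measurable_segmentAverage (B : Set X) {G : X → ℝ≥0∞} (hG : Measurable G) :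
    Measurable fun p : X × ℝ => segmentAverage B G p.2 p.1 := by
  unfold segmentAverage
  refine Measurable.lintegral_prod_right' (f := fun q : (X × ℝ) × X =>
    G (q.1.1 + q.1.2 • (q.2 - q.1.1))) ?_
  exact hG.comp (by fun_prop)

theorem segmentAverage_sq_le_lintegral (B : Set X) {G : X → ℝ≥0∞} (hG : Measurable G) (t : ℝ)
    (x : X) : segmentAverage B G t x ^ 2
      ≤ volume B * ∫⁻ y in B, G (x + t • (y - x)) ^ 2 := by
  have h := sq_lintegral_le (volume.restrict B) (f := fun y => G (x + t • (y - x)))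
    (hG.comp (by fun_prop)).aemeasurable
  rwa [Measure.restrict_apply_univ] at h

theorem setLIntegral_segment_le (B : Set X) (f : X → ℝ≥0∞) {t : ℝ} (ht : 0 < t)
    (x : X) : ∫⁻ y in B, f (x + t • (y - x))
      ≤ ENNReal.ofReal ((t ^ Module.finrank ℝ X)⁻¹) * ∫⁻ y, f y := by
  refine (setLIntegral_le_lintegral _ _).trans ?_
  rw [← lintegral_comp_add_smul f (x - t • x) ht]
  refine lintegral_mono fun y => le_of_eq ?_
  congr 1
  rw [smul_sub]; abel

theorem setLIntegral_segment_le' (V : Set X) (f : X → ℝ≥0∞) {t : ℝ} (ht : t < 1)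
    (y : X) : ∫⁻ x in V, f (x + t • (y - x))
      ≤ ENNReal.ofReal (((1 - t) ^ Module.finrank ℝ X)⁻¹) * ∫⁻ y, f y := by
  refine (setLIntegral_le_lintegral _ _).trans ?_
  rw [← lintegral_comp_add_smul f (t • y) (sub_pos.2 ht)]
  refine lintegral_mono fun x => le_of_eq ?_
  congr 1
  rw [smul_sub, sub_smul, one_smul]; abel

/-- The bound is uniform in `t` because one of the two endpoints can always serve as integration
variable: the Jacobian is `t^(-d) ≤ 2^d` in `y` when `t ≥ 1/2`, and `(1 - t)^(-d) ≤ 2^d` in `x` when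
`t ≤ 1/2`. -/
theorem setLIntegral_segmentAverage_sq_le (V B : Set X) {G : X → ℝ≥0∞} (hG : Measurable G)
    {t : ℝ} (ht : t ∈ Ioc (0 : ℝ) 1) :
    ∫⁻ x in V, segmentAverage B G t x ^ 2
      ≤ volume B * ((volume V + volume B) * (ENNReal.ofReal (2 ^ Module.finrank ℝ X)
        * ∫⁻ y, G y ^ 2)) := by
  have hm : Measurable fun p : X × X => G (p.1 + t • (p.2 - p.1)) ^ 2 :=
    (hG.comp (by fun_prop)).pow_const 2
  have hbound : ∀ s : ℝ, 1 / 2 ≤ s → ((s ^ Module.finrank ℝ X)⁻¹) ≤ 2 ^ Module.finrank ℝ X := by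
    intro s hs
    rw [← inv_pow]
    refine pow_le_pow_left₀ (by positivity) ?_ _
    rw [inv_le_comm₀ (by linarith) (by norm_num)]
    linarith
  calc ∫⁻ x in V, segmentAverage B G t x ^ 2
      ≤ ∫⁻ x in V, volume B * ∫⁻ y in B, G (x + t • (y - x)) ^ 2 :=
        lintegral_mono fun x => segmentAverage_sq_le_lintegral B hG t x
    _ = volume B * ∫⁻ x in V, ∫⁻ y in B, G (x + t • (y - x)) ^ 2 :=
        lintegral_const_mul _ hm.lintegral_prod_right'
    _ ≤ _ := by
        gcongr
        rcases le_total t (1 / 2) with h | h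
        · rw [lintegral_lintegral_swap hm.aemeasurable]
          calc ∫⁻ y in B, ∫⁻ x in V, G (x + t • (y - x)) ^ 2
              ≤ ∫⁻ _y in B, ENNReal.ofReal (2 ^ Module.finrank ℝ X) * ∫⁻ y, G y ^ 2 := by
                refine lintegral_mono fun y => ?_
                refine (setLIntegral_segment_le' V (fun z => G z ^ 2) (by linarith) y).trans ?_
                gcongr
                exact hbound _ (by linarith)
            _ = volume B * (ENNReal.ofReal (2 ^ Module.finrank ℝ X) * ∫⁻ y, G y ^ 2) := by
                rw [setLIntegral_const, mul_comm]
            _ ≤ _ := by gcongr; exact le_add_self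
        · calc ∫⁻ x in V, ∫⁻ y in B, G (x + t • (y - x)) ^ 2
              ≤ ∫⁻ _x in V, ENNReal.ofReal (2 ^ Module.finrank ℝ X) * ∫⁻ y, G y ^ 2 := by
                refine lintegral_mono fun x => ?_
                refine (setLIntegral_segment_le B (fun z => G z ^ 2) ht.1 x).trans ?_
                gcongr
                exact hbound _ h
            _ = volume V * (ENNReal.ofReal (2 ^ Module.finrank ℝ X) * ∫⁻ y, G y ^ 2) := by
                rw [setLIntegral_const, mul_comm]
            _ ≤ _ := by gcongr; exact le_self_add

/-- Interpolation between a pointwise bound and the uniform `L²` bound: two of the four powers are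
estimated by Cauchy–Schwarz and a change of variables in `y`, at the cost `t^(-d)`. This is where
dimension at most three enters, through `t^(-d) ≤ t^(-3)`. -/
theorem setLIntegral_segmentAverage_pow_four_le (hd : Module.finrank ℝ X ≤ 3) (V B : Set X)
    {G : X → ℝ≥0∞} (hG : Measurable G) {t : ℝ} (ht : t ∈ Ioc (0 : ℝ) 1) :
    ∫⁻ x in V, segmentAverage B G t x ^ 4
      ≤ ENNReal.ofReal (t ^ (-3 : ℝ)) * (volume B ^ 2 * (volume V + volume B)
        * ENNReal.ofReal (2 ^ Module.finrank ℝ X) * (∫⁻ y, G y ^ 2) ^ 2) := by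
  have hm : Measurable fun x => segmentAverage B G t x :=
    (measurable_segmentAverage B hG).comp (measurable_id.prodMk measurable_const)
  have hpt : ∀ x, segmentAverage B G t x ^ 2
      ≤ volume B * (ENNReal.ofReal (t ^ (-3 : ℝ)) * ∫⁻ y, G y ^ 2) := by
    intro x
    refine (segmentAverage_sq_le_lintegral B hG t x).trans ?_
    gcongr
    refine (setLIntegral_segment_le B (fun z => G z ^ 2) ht.1 x).trans ?_
    gcongr
    rw [← Real.rpow_natCast, ← Real.rpow_neg ht.1.le]
    refine Real.rpow_le_rpow_of_exponent_ge ht.1 ht.2 ?_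
    have : (Module.finrank ℝ X : ℝ) ≤ 3 := by exact_mod_cast hd
    linarith
  calc ∫⁻ x in V, segmentAverage B G t x ^ 4
      ≤ ∫⁻ x in V, volume B * (ENNReal.ofReal (t ^ (-3 : ℝ)) * ∫⁻ y, G y ^ 2)
          * segmentAverage B G t x ^ 2 := by
        refine lintegral_mono fun x => ?_
        rw [show (4 : ℕ) = 2 + 2 from rfl, pow_add]
        gcongr
        exact hpt x
    _ = volume B * (ENNReal.ofReal (t ^ (-3 : ℝ)) * ∫⁻ y, G y ^ 2)
          * ∫⁻ x in V, segmentAverage B G t x ^ 2 := lintegral_const_mul _ (hm.pow_const 2)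
    _ ≤ volume B * (ENNReal.ofReal (t ^ (-3 : ℝ)) * ∫⁻ y, G y ^ 2)
          * (volume B * ((volume V + volume B) * (ENNReal.ofReal (2 ^ Module.finrank ℝ X)
        * ∫⁻ y, G y ^ 2))) := by
        gcongr
        exact setLIntegral_segmentAverage_sq_le V B hG ht
    _ = _ := by ring

/-- The weight `t^(5/2)` from Hölder's inequality turns the singularity `t^(-3)` into the integrable
`t^(-1/2)`. -/
theorem exists_setLIntegral_segment_pow_four_le (hd : Module.finrank ℝ X ≤ 3) {V B : Set X}
    (hV : volume V ≠ ⊤) (hB : volume B ≠ ⊤) :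
    ∃ C : ℝ≥0∞, C ≠ ⊤ ∧ ∀ G : X → ℝ≥0∞, Measurable G →
      ∫⁻ x in V, (∫⁻ t in Ioc (0 : ℝ) 1, segmentAverage B G t x) ^ 4
        ≤ C * (∫⁻ y, G y ^ 2) ^ 2 := by
  set I₁ := ∫⁻ t in Ioc (0 : ℝ) 1, ENNReal.ofReal (t ^ (-(5 / 6) : ℝ)) with hI₁
  set I₂ := ∫⁻ t in Ioc (0 : ℝ) 1, ENNReal.ofReal (t ^ (-(1 / 2) : ℝ)) with hI₂
  have h₁ : I₁ ≠ ⊤ := (lintegral_Ioc_rpow_lt_top (by norm_num)).ne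
  have h₂ : I₂ ≠ ⊤ := (lintegral_Ioc_rpow_lt_top (by norm_num)).ne
  refine ⟨I₁ ^ 3 * (I₂ * (volume B ^ 2 * (volume V + volume B)
        * ENNReal.ofReal (2 ^ Module.finrank ℝ X))), by finiteness, fun G hG => ?_⟩
  have hm := measurable_segmentAverage B hG
  set S := ∫⁻ y, G y ^ 2
  set K := volume B ^ 2 * (volume V + volume B) * ENNReal.ofReal (2 ^ Module.finrank ℝ X)
  have hm4 : Measurable fun p : X × ℝ =>
      ENNReal.ofReal (p.2 ^ (5 / 2 : ℝ)) * segmentAverage B G p.2 p.1 ^ 4 :=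
    (by fun_prop : Measurable fun p : X × ℝ => ENNReal.ofReal (p.2 ^ (5 / 2 : ℝ))).mul
      (hm.pow_const 4)
  calc ∫⁻ x in V, (∫⁻ t in Ioc (0 : ℝ) 1, segmentAverage B G t x) ^ 4
      ≤ ∫⁻ x in V, I₁ ^ 3 * ∫⁻ t in Ioc (0 : ℝ) 1,
          ENNReal.ofReal (t ^ (5 / 2 : ℝ)) * segmentAverage B G t x ^ 4 :=
        lintegral_mono fun x => pow_four_lintegral_Ioc_le
          (hm.comp (measurable_const.prodMk measurable_id))
    _ = I₁ ^ 3 * ∫⁻ x in V, ∫⁻ t in Ioc (0 : ℝ) 1,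
          ENNReal.ofReal (t ^ (5 / 2 : ℝ)) * segmentAverage B G t x ^ 4 :=
        lintegral_const_mul _ hm4.lintegral_prod_right'
    _ = I₁ ^ 3 * ∫⁻ t in Ioc (0 : ℝ) 1, ∫⁻ x in V,
          ENNReal.ofReal (t ^ (5 / 2 : ℝ)) * segmentAverage B G t x ^ 4 := by
        rw [lintegral_lintegral_swap hm4.aemeasurable]
    _ ≤ I₁ ^ 3 * ∫⁻ t in Ioc (0 : ℝ) 1,
          ENNReal.ofReal (t ^ (-(1 / 2) : ℝ)) * (K * S ^ 2) := by
        refine mul_le_mul_right ?_ _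
        refine setLIntegral_mono ?_ fun t ht => ?_
        · fun_prop
        have hmt : Measurable fun x => segmentAverage B G t x :=
          hm.comp (measurable_id.prodMk measurable_const)
        rw [lintegral_const_mul _ (hmt.pow_const 4)]
        refine (mul_le_mul_right
          (setLIntegral_segmentAverage_pow_four_le hd V B hG ht) _).trans ?_
        rw [← mul_assoc, ← ENNReal.ofReal_mul (Real.rpow_nonneg ht.1.le _), ← Real.rpow_add ht.1,
          show (5 / 2 : ℝ) + -3 = -(1 / 2) by norm_num]
    _ = I₁ ^ 3 * (I₂ * K) * S ^ 2 := by
        rw [lintegral_mul_const _ (by fun_prop)]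
        ring

theorem isOpen_setOf_forall_segment_subset {X : Type*} [NormedAddCommGroup X] [NormedSpace ℝ X]
    {Ω : Set X} (hΩ : IsOpen Ω) :
    IsOpen {p : X × X | ∀ t ∈ Icc (0 : ℝ) 1, p.1 + t • p.2 ∈ Ω} := by
  rw [isOpen_iff_mem_nhds]
  intro p hp
  refine isCompact_Icc.eventually_forall_of_forall_eventually fun t ht => ?_
  have hc : Continuous fun q : (X × X) × ℝ => q.1.1 + q.2 • q.1.2 := by fun_prop
  exact hc.continuousAt.eventually (hΩ.mem_nhds (hp t ht))

/-- The difference formula holds for every `h` and almost every `x`; Fubini reverses the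
quantifiers, and `h = y - x` is a translation for fixed `x`. Strongly measurable representatives
make the exceptional set measurable. -/
theorem IsDistribGrad.ae_ae_enorm_sub_le {Ω : Set X} (hΩ : IsOpen Ω) {u : X → ℝ} {g : X → X}
    (hu : Integrable u) (hum : StronglyMeasurable u) (hg : Integrable g)
    (hgm : StronglyMeasurable g) (H : IsDistribGrad Ω u g) :
    ∀ᵐ x : X, ∀ᵐ y : X, segment ℝ x y ⊆ Ω →
      ‖u y - u x‖ₑ ≤ ∫⁻ t in Ioc (0 : ℝ) 1, ‖g (x + t • (y - x))‖ₑ * ‖y - x‖ₑ := by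
  have h1 : ∀ᵐ h : X, ∀ᵐ x : X, (∀ t ∈ Icc (0 : ℝ) 1, x + t • h ∈ Ω) →
      ‖u (x + h) - u x‖ₑ ≤ ∫⁻ t in Ioc (0 : ℝ) 1, ‖g (x + t • h)‖ₑ * ‖h‖ₑ := by
    refine Filter.Eventually.of_forall fun h => ?_
    filter_upwards [H.ae_sub_eq_integral hΩ hu hg hgm h] with x hx hxΩ
    rw [hx hxΩ]
    refine (enorm_integral_le_lintegral_enorm _).trans (lintegral_mono fun t => ?_)
    rw [← ofReal_norm, ← ofReal_norm, ← ofReal_norm, ← ENNReal.ofReal_mul (norm_nonneg _)]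
    exact ENNReal.ofReal_le_ofReal (norm_inner_le_norm _ _)
  have hmeas : MeasurableSet {p : X × X | (∀ t ∈ Icc (0 : ℝ) 1, p.1 + t • p.2 ∈ Ω) →
      ‖u (p.1 + p.2) - u p.1‖ₑ ≤ ∫⁻ t in Ioc (0 : ℝ) 1, ‖g (p.1 + t • p.2)‖ₑ * ‖p.2‖ₑ} := by
    refine MeasurableSet.imp (isOpen_setOf_forall_segment_subset hΩ).measurableSet ?_
    refine measurableSet_le ?_ ?_
    · exact ((hum.measurable.comp (by fun_prop)).sub
        (hum.measurable.comp measurable_fst)).enorm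
    · refine Measurable.lintegral_prod_right' (f := fun q : (X × X) × ℝ =>
        ‖g (q.1.1 + q.2 • q.1.2)‖ₑ * ‖q.1.2‖ₑ) ?_
      exact ((hgm.measurable.comp (by fun_prop)).enorm).mul (by fun_prop)
  have h2 := (Measure.ae_ae_comm hmeas).2 h1
  filter_upwards [h2] with x hx
  have h3 := (measurePreserving_sub_right volume x).quasiMeasurePreserving.ae hx
  filter_upwards [h3] with y hy hs
  have h4 := hy fun t ht => hs (by
    rw [segment_eq_image']
    exact ⟨t, ht, rfl⟩)
  simpa using h4

/-- If all segments from points of `V` to points of `B` are contained in `Ω`, the oscillation in `V`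
of a weakly differentiable function is controlled by its gradient in `Ω`. -/
theorem exists_setLIntegral_sub_average_pow_four_le (hd : Module.finrank ℝ X ≤ 3) {Ω V B : Set X}
    (hΩ : IsOpen Ω) (hVm : MeasurableSet V) (hBm : MeasurableSet B)
    (hVb : Bornology.IsBounded V) (hBb : Bornology.IsBounded B) (hB0 : volume B ≠ 0)
    (hseg : ∀ x ∈ V, ∀ y ∈ B, segment ℝ x y ⊆ Ω) :
    ∃ C : ℝ≥0∞, C ≠ ⊤ ∧ ∀ (u : X → ℝ) (g : X → X), Integrable u → StronglyMeasurable u →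
      Integrable g → StronglyMeasurable g → IsDistribGrad Ω u g →
      ∫⁻ x in V, ‖u x - ⨍ y in B, u y‖ₑ ^ 4 ≤ C * (∫⁻ y, ‖g y‖ₑ ^ 2) ^ 2 := by
  have hV := hVb.measure_lt_top (μ := volume) |>.ne
  have hB := hBb.measure_lt_top (μ := volume) |>.ne
  obtain ⟨C, hC, hCG⟩ := exists_setLIntegral_segment_pow_four_le hd hV hB
  obtain ⟨D, hD⟩ := (hVb.union hBb).exists_norm_le
  refine ⟨((volume B)⁻¹ * ENNReal.ofReal (D + D)) ^ 4 * C, by finiteness, ?_⟩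
  intro u g hu hum hg hgm H
  have hm : Measurable fun p : X × X × ℝ => ‖g (p.1 + p.2.2 • (p.2.1 - p.1))‖ₑ :=
    (hgm.measurable.comp (by fun_prop)).enorm
  have key : ∀ᵐ x : X, x ∈ V → ‖u x - ⨍ y in B, u y‖ₑ ≤ (volume B)⁻¹ * ENNReal.ofReal (D + D)
      * ∫⁻ t in Ioc (0 : ℝ) 1, segmentAverage B (fun y => ‖g y‖ₑ) t x := by
    filter_upwards [H.ae_ae_enorm_sub_le hΩ hu hum hg hgm] with x hx hxV
    have h1 : ∫⁻ y in B, ‖u x - u y‖ₑ ≤ ENNReal.ofReal (D + D)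
        * ∫⁻ t in Ioc (0 : ℝ) 1, segmentAverage B (fun y => ‖g y‖ₑ) t x := by
      calc ∫⁻ y in B, ‖u x - u y‖ₑ
          ≤ ∫⁻ y in B, ∫⁻ t in Ioc (0 : ℝ) 1,
              ENNReal.ofReal (D + D) * ‖g (x + t • (y - x))‖ₑ := by
            refine lintegral_mono_ae ?_
            filter_upwards [ae_restrict_of_ae hx, ae_restrict_mem hBm] with y hy hyB
            rw [← enorm_neg, neg_sub]
            refine (hy (hseg x hxV y hyB)).trans (lintegral_mono fun t => ?_)
            rw [mul_comm]
            gcongr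
            rw [← ofReal_norm]
            refine ENNReal.ofReal_le_ofReal ((norm_sub_le _ _).trans ?_)
            exact add_le_add (hD y (Or.inr hyB)) (hD x (Or.inl hxV))
        _ = ∫⁻ t in Ioc (0 : ℝ) 1, ∫⁻ y in B,
              ENNReal.ofReal (D + D) * ‖g (x + t • (y - x))‖ₑ := by
            rw [lintegral_lintegral_swap]
            exact ((hm.comp (measurable_const.prodMk measurable_id)).const_mul _).aemeasurable
        _ = _ := by
            rw [← lintegral_const_mul]
            · refine lintegral_congr fun t => ?_
              rw [lintegral_const_mul]
              · rfl
              · exact hm.comp (by fun_prop : Measurable fun y : X => (x, y, t))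
            · exact (measurable_segmentAverage B hgm.measurable.enorm).comp
                (by fun_prop : Measurable fun t : ℝ => (x, t))
    have hprob : IsProbabilityMeasure
        (((volume.restrict B) univ)⁻¹ • volume.restrict B) := by
      have : IsFiniteMeasure (volume.restrict B) := ⟨by simpa using hB.lt_top⟩
      have : NeZero (volume.restrict B) := ⟨by simpa using hB0⟩
      infer_instance
    -- The deviation from the average is the average of the differences `u x - u y`, to which the
    -- segment bound `h1` applies.
    have h2 : u x - ⨍ y in B, u y
        = ∫ y, (u x - u y) ∂(((volume.restrict B) univ)⁻¹ • volume.restrict B) := by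
      rw [integral_sub (integrable_const _) (hu.restrict.smul_measure (by simpa using hB0))]
      rw [integral_const, probReal_univ, one_smul]
      rfl
    rw [h2, mul_assoc]
    refine (enorm_integral_le_lintegral_enorm _).trans ?_
    rw [lintegral_smul_measure, Measure.restrict_apply_univ, smul_eq_mul]
    gcongr
  calc ∫⁻ x in V, ‖u x - ⨍ y in B, u y‖ₑ ^ 4
      ≤ ∫⁻ x in V, ((volume B)⁻¹ * ENNReal.ofReal (D + D)) ^ 4
          * (∫⁻ t in Ioc (0 : ℝ) 1, segmentAverage B (fun y => ‖g y‖ₑ) t x) ^ 4 := by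
        refine lintegral_mono_ae ?_
        filter_upwards [ae_restrict_of_ae key, ae_restrict_mem hVm] with x hx hxV
        rw [← mul_pow]
        gcongr
        exact hx hxV
    _ = ((volume B)⁻¹ * ENNReal.ofReal (D + D)) ^ 4
          * ∫⁻ x in V, (∫⁻ t in Ioc (0 : ℝ) 1, segmentAverage B (fun y => ‖g y‖ₑ) t x) ^ 4 :=
        lintegral_const_mul _
          ((measurable_segmentAverage B hgm.measurable.enorm).lintegral_prod_right'.pow_const 4)
    _ ≤ _ := by
        rw [mul_assoc]
        gcongr
        exact hCG _ hgm.measurable.enorm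

end LocalEstimate
end VCH

namespace VCH

/-! ### From local to global: the Sobolev–Poincaré inequality. -/

section GlobalEstimate

open ENNReal Topology

variable {X : Type*} [NormedAddCommGroup X] [InnerProductSpace ℝ X] [FiniteDimensional ℝ X]
  [MeasurableSpace X] [BorelSpace X]

/-- An integrable function on the whole space that has the integrable function `g` as its
distributional gradient in `Ω`. -/
structure IsSobolevPair (Ω : Set X) (u : X → ℝ) (g : X → X) : Prop where
  integrable : Integrable u
  stronglyMeasurable : StronglyMeasurable u
  integrable_grad : Integrable g
  stronglyMeasurable_grad : StronglyMeasurable g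
  isDistribGrad : IsDistribGrad Ω u g

/-- Near each point of its closure, the set `Ω` is star-shaped with respect to a nonempty open set
of centres. -/
def IsLocallyStarShaped {X : Type*} [NormedAddCommGroup X] [NormedSpace ℝ X] (Ω : Set X) : Prop :=
  ∀ x₀ ∈ closure Ω, ∃ N : Set X, IsOpen N ∧ x₀ ∈ N ∧ ∃ B : Set X, IsOpen B ∧ B.Nonempty ∧
    Bornology.IsBounded B ∧ ∀ x ∈ N ∩ Ω, ∀ y ∈ B, segment ℝ x y ⊆ Ω

theorem add_pow_four_le (a b : ℝ≥0∞) : (a + b) ^ 4 ≤ 16 * (a ^ 4 + b ^ 4) := by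
  rcases le_total a b with h | h
  · calc (a + b) ^ 4 ≤ (b + b) ^ 4 := by gcongr
      _ = 16 * b ^ 4 := by ring
      _ ≤ _ := by gcongr; exact le_add_self
  · calc (a + b) ^ 4 ≤ (a + a) ^ 4 := by gcongr
      _ = 16 * a ^ 4 := by ring
      _ ≤ _ := by gcongr; exact le_self_add

/-- The deviation of Sobolev functions from the numbers `c u` is controlled, in the part of `Ω`
in `N`, by the gradient. -/
def ControlsDeviation (Ω : Set X) (c : (X → ℝ) → ℝ) (N : Set X) : Prop :=
  ∃ C : ℝ≥0∞, C ≠ ⊤ ∧ ∀ (u : X → ℝ) (g : X → X), IsSobolevPair Ω u g →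
    ∫⁻ x in N ∩ Ω, ‖u x - c u‖ₑ ^ 4 ≤ C * (∫⁻ y, ‖g y‖ₑ ^ 2) ^ 2

theorem ControlsDeviation.mono {Ω : Set X} {c : (X → ℝ) → ℝ} {M N : Set X} (hMN : M ⊆ N)
    (h : ControlsDeviation Ω c N) : ControlsDeviation Ω c M := by
  obtain ⟨C, hC, H⟩ := h
  exact ⟨C, hC, fun u g hug => (lintegral_mono_set (inter_subset_inter_left _ hMN)).trans
    (H u g hug)⟩

theorem ControlsDeviation.union {Ω : Set X} {c : (X → ℝ) → ℝ} {M N : Set X}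
    (hM : ControlsDeviation Ω c M) (hN : ControlsDeviation Ω c N) :
    ControlsDeviation Ω c (M ∪ N) := by
  obtain ⟨C, hC, H⟩ := hM
  obtain ⟨C', hC', H'⟩ := hN
  refine ⟨C + C', by finiteness, fun u g hug => ?_⟩
  rw [union_inter_distrib_right, add_mul]
  exact (lintegral_union_le _ _ _).trans (add_le_add (H u g hug) (H' u g hug))

/-- Deviations from two families of numbers that are controlled on sets overlapping in `Ω`. -/
theorem ControlsDeviation.transfer {Ω : Set X} (hΩ : IsOpen Ω) (hΩb : Bornology.IsBounded Ω)
    {c c' : (X → ℝ) → ℝ} {M N : Set X} (hN : IsOpen N)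
    (h : ControlsDeviation Ω c M) (h' : ControlsDeviation Ω c' N) {z : X} (hz : z ∈ N ∩ Ω)
    (hM : M ∈ 𝓝 z) : ControlsDeviation Ω c N := by
  obtain ⟨C, hC, H⟩ := h
  obtain ⟨C', hC', H'⟩ := h'
  set O := M ∩ N ∩ Ω with hO
  have hOz : O ∈ 𝓝 z := Filter.inter_mem (Filter.inter_mem hM (hN.mem_nhds hz.1)) (hΩ.mem_nhds hz.2)
  have hO0 : volume O ≠ 0 := (Measure.measure_pos_of_mem_nhds volume hOz).ne'
  have hOt : volume O ≠ ⊤ :=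
    ((measure_mono inter_subset_right).trans_lt hΩb.measure_lt_top).ne
  have hNt : volume (N ∩ Ω) ≠ ⊤ :=
    ((measure_mono inter_subset_right).trans_lt hΩb.measure_lt_top).ne
  refine ⟨16 * (C' + (volume O)⁻¹ * (16 * (C + C')) * volume (N ∩ Ω)), by finiteness,
    fun u g hug => ?_⟩
  set S := (∫⁻ y, ‖g y‖ₑ ^ 2) ^ 2
  have hum := hug.stronglyMeasurable.measurable
  -- On the overlap `O` both deviations are controlled, hence so is the constant `c' u - c u`;
  -- dividing by the positive measure of `O` isolates it.
  have h1 : ‖c' u - c u‖ₑ ^ 4 * volume O ≤ 16 * (C + C') * S := by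
    calc ‖c' u - c u‖ₑ ^ 4 * volume O = ∫⁻ _x in O, ‖c' u - c u‖ₑ ^ 4 := by
          rw [setLIntegral_const]
      _ ≤ ∫⁻ x in O, 16 * (‖u x - c u‖ₑ ^ 4 + ‖u x - c' u‖ₑ ^ 4) := by
          refine lintegral_mono fun x => ?_
          refine le_trans ?_ (add_pow_four_le _ _)
          gcongr
          rw [show c' u - c u = (u x - c u) - (u x - c' u) by ring]
          exact enorm_sub_le
      _ = 16 * ((∫⁻ x in O, ‖u x - c u‖ₑ ^ 4) + ∫⁻ x in O, ‖u x - c' u‖ₑ ^ 4) := by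
          rw [lintegral_const_mul _ (by fun_prop), lintegral_add_left (by fun_prop)]
      _ ≤ 16 * (C * S + C' * S) := by
          gcongr
          · exact (lintegral_mono_set (inter_subset_inter_left _ inter_subset_left)).trans
              (H u g hug)
          · exact (lintegral_mono_set (inter_subset_inter_left _ inter_subset_right)).trans
              (H' u g hug)
      _ = _ := by ring
  have h2 : ‖c' u - c u‖ₑ ^ 4 ≤ (volume O)⁻¹ * (16 * (C + C')) * S := by
    rw [mul_assoc, ← ENNReal.div_eq_inv_mul]
    exact ENNReal.le_div_iff_mul_le (Or.inl hO0) (Or.inl hOt) |>.2 h1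
  calc ∫⁻ x in N ∩ Ω, ‖u x - c u‖ₑ ^ 4
      ≤ ∫⁻ x in N ∩ Ω, 16 * (‖u x - c' u‖ₑ ^ 4 + ‖c' u - c u‖ₑ ^ 4) := by
        refine lintegral_mono fun x => ?_
        refine le_trans ?_ (add_pow_four_le _ _)
        gcongr
        rw [show u x - c u = (u x - c' u) + (c' u - c u) by ring]
        exact enorm_add_le _ _
    _ = 16 * ((∫⁻ x in N ∩ Ω, ‖u x - c' u‖ₑ ^ 4) + ‖c' u - c u‖ₑ ^ 4 * volume (N ∩ Ω)) := by
        rw [lintegral_const_mul _ (by fun_prop), lintegral_add_left (by fun_prop),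
          setLIntegral_const]
    _ ≤ 16 * (C' * S + (volume O)⁻¹ * (16 * (C + C')) * S * volume (N ∩ Ω)) := by
        gcongr
        exact H' u g hug
    _ = _ := by ring

/-- The Sobolev–Poincaré inequality, with exponent four. -/
theorem exists_lintegral_sub_pow_four_le (hd : Module.finrank ℝ X ≤ 3) {Ω : Set X}
    (hΩ : IsOpen Ω) (hΩb : Bornology.IsBounded Ω) (hΩc : IsConnected Ω)
    (hstar : IsLocallyStarShaped Ω) :
    ∃ C : ℝ≥0∞, C ≠ ⊤ ∧ ∀ (u : X → ℝ) (g : X → X), IsSobolevPair Ω u g →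
      ∃ c : ℝ, ∫⁻ x in Ω, ‖u x - c‖ₑ ^ 4 ≤ C * (∫⁻ y, ‖g y‖ₑ ^ 2) ^ 2 := by
  have hloc : ∀ x₀ ∈ closure Ω, ∃ N : Set X, IsOpen N ∧ x₀ ∈ N ∧
      ∃ c : (X → ℝ) → ℝ, ControlsDeviation Ω c N := by
    intro x₀ hx₀
    obtain ⟨N, hN, hxN, B, hB, hBne, hBb, hseg⟩ := hstar x₀ hx₀
    obtain ⟨C, hC, H⟩ := exists_setLIntegral_sub_average_pow_four_le hd hΩ
      (hN.inter hΩ).measurableSet hB.measurableSet (hΩb.subset inter_subset_right) hBb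
      (hB.measure_pos volume hBne).ne' hseg
    exact ⟨N, hN, hxN, fun u => ⨍ y in B, u y, C, hC, fun u g h => H u g h.1 h.2 h.3 h.4 h.5⟩
  obtain ⟨x₁, hx₁⟩ := hΩc.nonempty
  obtain ⟨N₁, hN₁, hxN₁, c, hc⟩ := hloc x₁ (subset_closure hx₁)
  -- The points near which the deviation from the one fixed family `c` is controlled. `W` is open by
  -- definition and relatively closed in `Ω` by `transfer`, so connectedness gives `Ω ⊆ W`.
  set W := {x : X | ∃ N ∈ 𝓝 x, ControlsDeviation Ω c N} with hW
  have hWo : IsOpen W := by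
    rw [isOpen_iff_mem_nhds]
    rintro x ⟨N, hN, hcN⟩
    filter_upwards [eventually_mem_nhds_iff.2 hN] with y hy using ⟨N, hy, hcN⟩
  have hΩW : Ω ⊆ W := by
    refine hΩc.isPreconnected.subset_of_closure_inter_subset hWo
      ⟨x₁, hx₁, N₁, hN₁.mem_nhds hxN₁, hc⟩ ?_
    rintro x ⟨hxW, hxΩ⟩
    obtain ⟨N, hN, hxN, c', hc'⟩ := hloc x (subset_closure hxΩ)
    obtain ⟨z, hz, M, hM, hcM⟩ := mem_closure_iff.1 hxW _ (hN.inter hΩ) ⟨hxN, hxΩ⟩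
    exact ⟨N, hN.mem_nhds hxN, hcM.transfer hΩ hΩb hN hc' hz hM⟩
  -- Boundary points need no chaining of their own: a neighbourhood of such a point contains some `z
  -- ∈ Ω`, where `c` already controls the deviation. Compactness leaves finitely many
  -- neighbourhoods.
  have hall : ControlsDeviation Ω c (closure Ω) := by
    refine hΩb.isCompact_closure.induction_on ⟨0, by simp, by simp⟩
      (fun _ _ h => ControlsDeviation.mono h) (fun _ _ => ControlsDeviation.union) fun x hx => ?_
    obtain ⟨N, hN, hxN, c', hc'⟩ := hloc x hx
    obtain ⟨z, hz⟩ := mem_closure_iff.1 hx N hN hxN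
    obtain ⟨M, hM, hcM⟩ := hΩW hz.2
    exact ⟨N, mem_nhdsWithin_of_mem_nhds (hN.mem_nhds hxN), hcM.transfer hΩ hΩb hN hc' hz hM⟩
  obtain ⟨C, hC, H⟩ := hall
  refine ⟨C, hC, fun u g hug => ⟨c u, ?_⟩⟩
  have h := H u g hug
  rwa [inter_eq_self_of_subset_right subset_closure] at h

end GlobalEstimate

/-! ### Convex and Lipschitz domains are locally star-shaped. -/

section Geometry

theorem isLocallyStarShaped_of_convex {X : Type*} [NormedAddCommGroup X] [NormedSpace ℝ X]
    {Ω : Set X} (hΩ : IsOpen Ω) (hb : Bornology.IsBounded Ω) (hne : Ω.Nonempty)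
    (hc : Convex ℝ Ω) : IsLocallyStarShaped Ω := fun _ _ =>
  ⟨univ, isOpen_univ, mem_univ _, Ω, hΩ, hne, hb, fun _ hx _ hy => hc.segment_subset hx.2 hy⟩

/-- Near a boundary point the centres are taken in a small ball displaced by `(r/2) e` into the
epigraph. Segments from nearby points of `Ω` to these centres are so close to vertical that they
rise at least as fast as a `K`-Lipschitz graph can. -/
theorem HasLipschitzBoundary.isLocallyStarShaped {d : ℕ} {Ω : Set (E d)} (hΩ : IsOpen Ω)
    (h : HasLipschitzBoundary Ω) : IsLocallyStarShaped Ω := by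
  intro x₀ hx₀
  by_cases hx : x₀ ∈ Ω
  · obtain ⟨r, hr, hball⟩ := Metric.isOpen_iff.1 hΩ x₀ hx
    refine ⟨Metric.ball x₀ r, Metric.isOpen_ball, Metric.mem_ball_self hr, Metric.ball x₀ r,
      Metric.isOpen_ball, ⟨x₀, Metric.mem_ball_self hr⟩, Metric.isBounded_ball, ?_⟩
    intro x hx y hy
    exact ((convex_ball x₀ r).segment_subset hx.1 hy).trans hball
  · obtain ⟨e, γ, K, r, he, hγ, hr, hepi⟩ := h x₀ ⟨hx₀, fun h => hx (interior_subset h)⟩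
    -- Write `y - x = w + (r/2) e` with `‖w‖ ≤ 2ρ`. The height gained is at least `t (r/2 - 2ρ)`,
    -- while the part orthogonal to `e` moves by at most `4ρt`. This radius gives `r/2 - 2ρ = 2ρ +
    -- 8Kρ ≥ 4Kρ`, and keeps both balls inside the chart.
    set ρ := r / (8 * (1 + 2 * K)) with hρ
    have hK : (0 : ℝ) ≤ K := K.2
    have hρ0 : 0 < ρ := by positivity
    have hρr : 8 * (1 + 2 * K) * ρ = r := by rw [hρ]; field_simp
    have hρr' : 8 * ρ ≤ r := by nlinarith [mul_nonneg hK hρ0.le]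
    refine ⟨Metric.ball x₀ ρ, Metric.isOpen_ball, Metric.mem_ball_self hρ0,
      Metric.ball (x₀ + (r / 2) • e) ρ, Metric.isOpen_ball, ⟨_, Metric.mem_ball_self hρ0⟩,
      Metric.isBounded_ball, ?_⟩
    rintro x ⟨hxN, hxΩ⟩ y hy
    rw [mem_ball_iff_norm] at hxN hy
    have hxr : x ∈ Metric.ball x₀ r := by
      rw [mem_ball_iff_norm]; linarith
    have hyr : y ∈ Metric.ball x₀ r := by
      rw [mem_ball_iff_norm]
      calc ‖y - x₀‖ = ‖(y - (x₀ + (r / 2) • e)) + (r / 2) • e‖ := by congr 1; abel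
        _ ≤ ‖y - (x₀ + (r / 2) • e)‖ + ‖(r / 2) • e‖ := norm_add_le _ _
        _ < ρ + r / 2 := by
          rw [norm_smul, he, Real.norm_of_nonneg (by positivity), mul_one]
          linarith
        _ ≤ r := by linarith
    set w := y - x - (r / 2) • e with hw
    have hwn : ‖w‖ ≤ 2 * ρ := by
      calc ‖w‖ = ‖(y - (x₀ + (r / 2) • e)) - (x - x₀)‖ := by congr 1; rw [hw]; abel
        _ ≤ ‖y - (x₀ + (r / 2) • e)‖ + ‖x - x₀‖ := norm_sub_le _ _
        _ ≤ 2 * ρ := by linarith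
    have hin : |inner ℝ e w| ≤ 2 * ρ := by
      calc |inner ℝ e w| ≤ ‖e‖ * ‖w‖ := abs_real_inner_le_norm _ _
        _ ≤ 2 * ρ := by rw [he, one_mul]; exact hwn
    have hee : inner ℝ e e = (1 : ℝ) := by rw [real_inner_self_eq_norm_sq, he]; norm_num
    rw [segment_eq_image']
    rintro z ⟨t, ht, rfl⟩
    have hz : x + t • (y - x) ∈ Metric.ball x₀ r := by
      refine (convex_ball x₀ r).segment_subset hxr hyr ?_
      rw [segment_eq_image']
      exact ⟨t, ht, rfl⟩
    refine (hepi _ hz).2 ?_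
    have hx' := (hepi x hxr).1 hxΩ
    have hyx : y - x = w + (r / 2) • e := by rw [hw]; abel
    have h1 : inner ℝ e (x + t • (y - x)) = inner ℝ e x + t * (inner ℝ e w + r / 2) := by
      rw [hyx, inner_add_right, inner_smul_right, inner_add_right, inner_smul_right, hee, mul_one]
    have h2 : (x + t • (y - x)) - inner ℝ e (x + t • (y - x)) • e - (x - inner ℝ e x • e)
        = t • (w - inner ℝ e w • e) := by
      rw [h1, hyx]
      module
    have h3 : ‖t • (w - inner ℝ e w • e)‖ ≤ t * (4 * ρ) := by
      rw [norm_smul, Real.norm_of_nonneg ht.1]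
      refine mul_le_mul_of_nonneg_left ((norm_sub_le _ _).trans ?_) ht.1
      rw [norm_smul, he, mul_one, Real.norm_eq_abs]
      linarith
    have h4 := hγ.dist_le_mul ((x + t • (y - x)) - inner ℝ e (x + t • (y - x)) • e)
      (x - inner ℝ e x • e)
    rw [dist_eq_norm, dist_eq_norm, h2, Real.norm_eq_abs] at h4
    have h5 := (le_abs_self _).trans (h4.trans (mul_le_mul_of_nonneg_left h3 hK))
    rw [h1] at h5 ⊢
    have h6 : (K : ℝ) * (t * (4 * ρ)) ≤ t * (inner ℝ e w + r / 2) := by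
      have : (K : ℝ) * (4 * ρ) ≤ inner ℝ e w + r / 2 := by
        have := (abs_le.1 hin).1
        nlinarith [mul_nonneg hK hρ0.le]
      nlinarith [mul_le_mul_of_nonneg_left this ht.1]
    linarith

end Geometry
end VCH

namespace VCH

/-! ### Periodic functions on a box. -/

section Box

open Topology

variable {d : ℕ}

theorem isOpen_openBox (L : Fin d → ℝ) : IsOpen (openBox L) := by
  simp only [openBox, ofPred_forall]
  exact isOpen_iInter_of_finite fun i => isOpen_Ioo.preimage (by fun_prop)

theorem convex_openBox (L : Fin d → ℝ) : Convex ℝ (openBox L) := by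
  intro x hx y hy a b ha hb hab i
  exact (convex_Ioo 0 (L i)) (hx i) (hy i) ha hb hab

theorem nonempty_openBox {L : Fin d → ℝ} (hL : ∀ i, 0 < L i) : (openBox L).Nonempty :=
  ⟨WithLp.toLp 2 fun i => L i / 2, fun i => ⟨half_pos (hL i), half_lt_self (hL i)⟩⟩

/-- The representative of a point modulo the lattice `∏ (L i) ℤ`. -/
noncomputable def boxRep {L : Fin d → ℝ} (hL : ∀ i, 0 < L i) (x : E d) : E d :=
  WithLp.toLp 2 fun i => toIcoMod (hL i) 0 (x i)

theorem boxRep_add_single {L : Fin d → ℝ} (hL : ∀ i, 0 < L i) (x : E d) (i : Fin d) :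
    boxRep hL (x + EuclideanSpace.single i (L i)) = boxRep hL x := by
  ext j
  simp only [boxRep, PiLp.add_apply, PiLp.single_apply]
  split_ifs with h
  · subst h; exact toIcoMod_add_right _ _ _
  · rw [add_zero]

theorem boxRep_of_mem {L : Fin d → ℝ} (hL : ∀ i, 0 < L i) {x : E d} (hx : x ∈ openBox L) :
    boxRep hL x = x := by
  ext j
  exact (toIcoMod_eq_self (hL j)).2 ⟨(hx j).1.le, by simpa using (hx j).2⟩

/-- The periodic extension of a smooth function with compact support in a box is smooth. -/
theorem contDiff_comp_boxRep {L : Fin d → ℝ} (hL : ∀ i, 0 < L i) {ψ : E d → ℝ}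
    (hψ : ContDiff ℝ ∞ ψ) (hc : HasCompactSupport ψ) (hs : tsupport ψ ⊆ openBox L) :
    ContDiff ℝ ∞ fun x => ψ (boxRep hL x) := by
  rw [contDiff_iff_contDiffAt]
  intro x₀
  -- Off the lattice translates of the faces, `boxRep` is locally a translation by a fixed lattice
  -- vector. On them it jumps, but there the extension vanishes identically nearby.
  by_cases h0 : ∀ i, 0 < boxRep hL x₀ i
  · have hev : ∀ᶠ x in 𝓝 x₀, ∀ i, x i - toIcoDiv (hL i) 0 (x₀ i) • L i ∈ Ioo 0 (L i) := by
      rw [Filter.eventually_all]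
      intro i
      have hcont : Continuous fun x : E d => x i - toIcoDiv (hL i) 0 (x₀ i) • L i := by fun_prop
      exact hcont.continuousAt.eventually (Ioo_mem_nhds (h0 i) (toIcoMod_mem_Ico' (hL i) (x₀ i)).2)
    have heq : (fun x => ψ (boxRep hL x)) =ᶠ[𝓝 x₀]
        fun x => ψ (x - WithLp.toLp 2 fun i => toIcoDiv (hL i) 0 (x₀ i) • L i) := by
      filter_upwards [hev] with x hx
      congr 1
      ext i
      simp only [boxRep, PiLp.sub_apply, toIcoMod]
      rw [toIcoDiv_eq_of_sub_zsmul_mem_Ico (hL i) (n := toIcoDiv (hL i) 0 (x₀ i))]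
      exact ⟨(hx i).1.le, by simpa using (hx i).2⟩
    exact ContDiffAt.congr_of_eventuallyEq
      (hψ.comp (contDiff_id.sub contDiff_const)).contDiffAt heq
  · push Not at h0
    obtain ⟨i, hi⟩ := h0
    have hi0 : toIcoMod (hL i) 0 (x₀ i) = 0 := le_antisymm hi (toIcoMod_mem_Ico' (hL i) (x₀ i)).1
    have hq : ∀ s : ℝ, ((toIcoMod (hL i) 0 s : ℝ) : AddCircle (L i)) = (s : AddCircle (L i)) := by
      intro s
      rw [toIcoMod, AddCircle.coe_sub, AddCircle.coe_zsmul, AddCircle.coe_period, smul_zero,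
        sub_zero]
    -- Passing to the circle makes the distance to the faces visible: the `i`-th coordinates of the
    -- support form a compact set avoiding the class of `0`, which is the class of `x₀ i`.
    set S : Set (AddCircle (L i)) := (fun x : E d => ((x i : ℝ) : AddCircle (L i))) '' tsupport ψ
    have hcont : Continuous fun x : E d => ((x i : ℝ) : AddCircle (L i)) :=
      (AddCircle.continuous_mk' (L i)).comp (by fun_prop)
    have hfact : Fact (0 < L i) := ⟨hL i⟩
    have hS : IsClosed S := (hc.isCompact.image hcont).isClosed
    have h0S : ((x₀ i : ℝ) : AddCircle (L i)) ∉ S := by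
      rintro ⟨y, hy, hyx⟩
      have hyi := hs hy i
      simp only at hyx
      rw [← hq (x₀ i), hi0, AddCircle.coe_zero,
        AddCircle.coe_eq_zero_iff_of_mem_Ico ⟨hyi.1.le, hyi.2⟩] at hyx
      exact hyi.1.ne' hyx
    have hev : ∀ᶠ x in 𝓝 x₀, ((x i : ℝ) : AddCircle (L i)) ∈ Sᶜ :=
      hcont.continuousAt.eventually (hS.isOpen_compl.mem_nhds h0S)
    have heq : (fun x => ψ (boxRep hL x)) =ᶠ[𝓝 x₀] fun _ => 0 := by
      filter_upwards [hev] with x hx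
      refine image_eq_zero_of_notMem_tsupport fun hmem => hx ⟨boxRep hL x, hmem, hq (x i)⟩
    exact contDiffAt_const.congr_of_eventuallyEq heq

/-- The directional derivative of `η` along `e` is the divergence of `η e`, and by periodicity the
fluxes through opposite faces cancel. -/
theorem setIntegral_openBox_fderiv_eq_zero {n : ℕ} {L : Fin (n + 1) → ℝ} (hL : ∀ i, 0 < L i)
    {η : E (n + 1) → ℝ} (hη : ContDiff ℝ ∞ η)
    (hper : ∀ x i, η (x + EuclideanSpace.single i (L i)) = η x) (e : E (n + 1)) :
    ∫ x in openBox L, fderiv ℝ η x e = 0 := by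
  set T : (Fin (n + 1) → ℝ) →L[ℝ] E (n + 1) :=
    ((EuclideanSpace.equiv (Fin (n + 1)) ℝ).symm : (Fin (n + 1) → ℝ) →L[ℝ] E (n + 1)) with hT
  have hTapp : ∀ y, T y = WithLp.toLp 2 y := fun _ => rfl
  have h1 : ∫ x in openBox L, fderiv ℝ η x e
      = ∫ y in Icc (0 : Fin (n + 1) → ℝ) L, fderiv ℝ η (T y) e := by
    have h2 : ∫ y in Icc (0 : Fin (n + 1) → ℝ) L, fderiv ℝ η (T y) e
        = ∫ y in Set.pi univ fun i => Ioo ((0 : Fin (n + 1) → ℝ) i) (L i),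
          fderiv ℝ η (T y) e := by
      rw [volume_pi]
      exact (setIntegral_congr_set Measure.univ_pi_Ioo_ae_eq_Icc).symm
    rw [h2, ← (PiLp.volume_preserving_toLp (Fin (n + 1))).setIntegral_preimage_emb
      (MeasurableEquiv.toLp 2 (Fin (n + 1) → ℝ)).measurableEmbedding]
    congr 2
    ext y
    simp [openBox]
  have hd : ∀ x, DifferentiableAt ℝ η x := hη.differentiable (by simp)
  have hdc : Continuous (fderiv ℝ η) := hη.continuous_fderiv (by simp)
  have hsum : ∀ y, ∑ i, (e i • (fderiv ℝ η (T y)).comp T) (Pi.single i 1)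
      = fderiv ℝ η (T y) e := by
    intro y
    have he : e = ∑ i, e i • T (Pi.single i 1) := by
      ext j
      simp [hTapp, Pi.single_apply]
    conv_rhs => rw [he, map_sum]
    simp
  rw [h1]
  have := integral_divergence_of_hasFDerivAt_off_countable' (0 : Fin (n + 1) → ℝ) L
    (fun i => (hL i).le) (fun i y => e i • η (T y))
    (fun i y => e i • (fderiv ℝ η (T y)).comp T) ∅ countable_empty
    (fun i => Continuous.continuousOn (by have := hη.continuous; fun_prop))
    (fun y _ i => (((hd (T y)).hasFDerivAt).comp y T.hasFDerivAt).const_smul (e i)) ?_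
  · simp_rw [hsum] at this
    rw [this]
    refine Finset.sum_eq_zero fun i _ => sub_eq_zero.2 ?_
    refine setIntegral_congr_fun measurableSet_Icc fun y _ => ?_
    congr 1
    -- Periodicity moves a point of the face `y i = 0` to the opposite face `y i = L i`.
    rw [← hper (T (i.insertNth ((0 : Fin (n + 1) → ℝ) i) y)) i]
    congr 1
    ext j
    simp only [hTapp, PiLp.add_apply, PiLp.single_apply]
    refine Fin.succAboveCases i ?_ (fun k => ?_) j
    · simp
    · simp [Fin.succAbove_ne]
  · simp_rw [hsum]
    exact Continuous.integrableOn_Icc (by fun_prop)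

end Box

/-! ### Common properties of the two settings. -/

namespace Setting

variable {d : ℕ}

theorem isOpen_dom (D : Setting d) : IsOpen D.dom := by
  cases D with
  | neumann Ω ho _ _ _ => exact ho
  | periodic L _ => exact isOpen_openBox L

theorem isConnected_dom (D : Setting d) : IsConnected D.dom := by
  cases D with
  | neumann Ω _ _ hc _ => exact hc
  | periodic L hL => exact ⟨nonempty_openBox hL, (convex_openBox L).isPreconnected⟩

theorem isLocallyStarShaped_dom (D : Setting d) : IsLocallyStarShaped D.dom := by
  cases D with
  | neumann Ω ho _ _ hl => exact hl.isLocallyStarShaped ho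
  | periodic L hL =>
    exact isLocallyStarShaped_of_convex (isOpen_openBox L) (periodic L hL).isBounded_dom
      (nonempty_openBox hL) (convex_openBox L)

/-- Every smooth function with compact support in the domain coincides there with an admissible test
function. -/
theorem exists_isTest_eqOn (D : Setting d) {ψ : E d → ℝ} (hψ : ContDiff ℝ ∞ ψ)
    (hc : HasCompactSupport ψ) (hs : tsupport ψ ⊆ D.dom) :
    ∃ η, D.IsTest η ∧ EqOn η ψ D.dom := by
  cases D with
  | neumann Ω _ _ _ _ => exact ⟨ψ, ⟨hψ, hc, hs⟩, fun _ _ => rfl⟩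
  | periodic L hL =>
    exact ⟨fun x => ψ (boxRep hL x), ⟨contDiff_comp_boxRep hL hψ hc hs,
      fun x i => congrArg ψ (boxRep_add_single hL x i)⟩,
      fun x hx => congrArg ψ (boxRep_of_mem hL hx)⟩

/-- This is what makes a constant function an element of `H¹` with zero gradient, in both settings.
-/
theorem integral_fderiv_isTest (hd : d ≠ 0) (D : Setting d) {η : E d → ℝ} (hη : D.IsTest η)
    (e : E d) : ∫ x in D.dom, fderiv ℝ η x e = 0 := by
  cases D with
  | neumann Ω _ _ _ _ =>
    obtain ⟨h1, h2, h3⟩ := hη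
    have hdc : Continuous fun x => fderiv ℝ η x e :=
      (h1.continuous_fderiv (by simp)).clm_apply continuous_const
    have hsub : Function.support (fun x => fderiv ℝ η x e) ⊆ Ω := fun x hx =>
      h3 (support_fderiv_subset ℝ fun h : fderiv ℝ η x = 0 => hx (by simp [h]))
    change ∫ x in Ω, fderiv ℝ η x e = 0
    rw [setIntegral_eq_integral_of_forall_compl_eq_zero fun x hx =>
      Function.notMem_support.1 fun h => hx (hsub h)]
    have h4 := integral_mul_fderiv_eq_neg_fderiv_mul_of_integrable (μ := volume) (f := fun _ => 1)
      (g := η) (v := e) (by simp)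
      (by simpa using hdc.integrable_of_hasCompactSupport (h2.fderiv_apply ℝ e))
      (by simpa using h1.continuous.integrable_of_hasCompactSupport h2)
      (fun x _ => differentiableAt_const _) (fun x _ => (h1.differentiable (by simp)) x)
    simpa using h4
  | periodic L hL =>
    obtain ⟨n, rfl⟩ := Nat.exists_eq_succ_of_ne_zero hd
    exact setIntegral_openBox_fderiv_eq_zero hL hη.1 hη.2 e

/-- Extension by zero to the whole space is harmless because only test functions supported in the
domain are used. In the periodic setting such a function is replaced by its periodic extension,
which agrees with it on the box. -/
theorem IsWeakGrad.isSobolevPair {D : Setting d} {u : D.L2} {g : D.L2v} (h : D.IsWeakGrad u g) :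
    IsSobolevPair D.dom (D.dom.indicator u) (D.dom.indicator g) := by
  have hm := D.isOpen_dom.measurableSet
  have hu : Integrable u D.vol := (Lp.memLp u).integrable (by norm_num)
  have hg : Integrable g D.vol := (Lp.memLp g).integrable (by norm_num)
  refine ⟨(integrable_indicator_iff hm).2 hu, (Lp.stronglyMeasurable u).indicator hm,
    (integrable_indicator_iff hm).2 hg, (Lp.stronglyMeasurable g).indicator hm, ?_⟩
  intro ψ hψ hc hs e
  obtain ⟨η, hη, heq⟩ := D.exists_isTest_eqOn hψ hc hs
  have h1 := h η hη e
  have e1 : ∫ x, D.dom.indicator u x * fderiv ℝ ψ x e = ∫ x in D.dom, u x * fderiv ℝ η x e := by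
    rw [← integral_indicator hm]
    refine integral_congr_ae (Filter.Eventually.of_forall fun x => ?_)
    by_cases hx : x ∈ D.dom
    · have : η =ᶠ[nhds x] ψ := heq.eventuallyEq_of_mem (D.isOpen_dom.mem_nhds hx)
      simp only [indicator_of_mem hx, this.fderiv_eq]
    · simp [indicator_of_notMem hx]
  have e2 : ∫ x, inner ℝ (D.dom.indicator g x) e * ψ x
      = ∫ x in D.dom, inner ℝ (g x) e * η x := by
    rw [← integral_indicator hm]
    refine integral_congr_ae (Filter.Eventually.of_forall fun x => ?_)
    by_cases hx : x ∈ D.dom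
    · simp only [indicator_of_mem hx, heq hx]
    · simp [indicator_of_notMem hx]
  rw [e1, e2, h1]

end Setting
end VCH

namespace VCH
-- Poincaré and Sobolev inequalities, and completeness of `H¹`.
namespace Setting

open ENNReal

variable {d : ℕ} {D : Setting d}

theorem coeFn_const (D : Setting d) (c : ℝ) :
    (Lp.const 2 D.vol c : D.L2) =ᵐ[D.vol] fun _ => c := by
  simpa using! Lp.coeFn_const (p := 2) (μ := D.vol) c

theorem measure_dom_ne_zero (D : Setting d) : volume D.dom ≠ 0 :=
  (D.isOpen_dom.measure_pos volume D.isConnected_dom.nonempty).ne'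

theorem measure_dom_ne_top (D : Setting d) : volume D.dom ≠ ⊤ :=
  D.isBounded_dom.measure_lt_top.ne

theorem inner_const_right (u : D.L2) (c : ℝ) :
    inner ℝ u (Lp.const 2 D.vol c) = c * ∫ x in D.dom, u x := by
  rw [L2.inner_def, ← integral_const_mul]
  refine integral_congr_ae ?_
  filter_upwards [D.coeFn_const c] with x hx
  rw [hx]
  simp

/-- A function whose deviation from a constant is controlled by its gradient. -/
theorem exists_memLp_sub_const (hd : d ≤ 3) (D : Setting d) :
    ∃ K : ℝ, 0 ≤ K ∧ ∀ v : D.H1, ∃ c : ℝ, MemLp (fun x => fn v x - c) 4 D.vol ∧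
      eLpNorm (fun x => fn v x - c) 4 D.vol ≤ ENNReal.ofReal (K * ‖grad v‖) := by
  obtain ⟨C, hC, H⟩ := exists_lintegral_sub_pow_four_le (X := E d) (by simpa using hd)
    D.isOpen_dom D.isBounded_dom D.isConnected_dom D.isLocallyStarShaped_dom
  refine ⟨(C ^ (1 / 4 : ℝ)).toReal, ENNReal.toReal_nonneg, fun v => ?_⟩
  obtain ⟨c, hc⟩ := H _ _ (IsWeakGrad.isSobolevPair v.2)
  have hm := D.isOpen_dom.measurableSet
  have e1 : ∫⁻ x in D.dom, ‖D.dom.indicator (v.1.fst) x - c‖ₑ ^ 4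
      = eLpNorm (fun x => fn v x - c) 4 D.vol ^ (4 : ℝ) := by
    rw [eLpNorm_eq_lintegral_rpow_enorm_toReal (by norm_num) (by norm_num), ← ENNReal.rpow_mul]
    simp only [ENNReal.toReal_ofNat]
    norm_num
    refine setLIntegral_congr_fun hm fun x hx => ?_
    simp only [indicator_of_mem hx]
    rfl
  have e2 : ∫⁻ y, ‖D.dom.indicator (v.1.snd) y‖ₑ ^ 2 = ‖grad v‖ₑ ^ (2 : ℝ) := by
    have : ∀ y, ‖D.dom.indicator (v.1.snd) y‖ₑ ^ 2
        = D.dom.indicator (fun y => ‖v.1.snd y‖ₑ ^ 2) y := by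
      intro y
      by_cases hy : y ∈ D.dom
      · simp only [indicator_of_mem hy]
      · simp [indicator_of_notMem hy]
    simp_rw [this]
    rw [lintegral_indicator hm, Lp.enorm_def,
      eLpNorm_eq_lintegral_rpow_enorm_toReal (by norm_num) (by norm_num), ← ENNReal.rpow_mul]
    simp only [ENNReal.toReal_ofNat]
    norm_num
    rfl
  have hle : eLpNorm (fun x => fn v x - c) 4 D.vol
      ≤ ENNReal.ofReal ((C ^ (1 / 4 : ℝ)).toReal * ‖grad v‖) := by
    rw [e1, e2] at hc
    have h4 := ENNReal.rpow_le_rpow hc (z := 1 / 4) (by norm_num)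
    rw [← ENNReal.rpow_mul, ENNReal.mul_rpow_of_nonneg _ _ (by norm_num), ← ENNReal.rpow_natCast,
      ← ENNReal.rpow_mul, ← ENNReal.rpow_mul] at h4
    norm_num at h4
    rw [ENNReal.ofReal_mul ENNReal.toReal_nonneg, ENNReal.ofReal_toReal (by finiteness),
      ofReal_norm]
    exact h4
  exact ⟨c, ⟨(Lp.aestronglyMeasurable _).sub aestronglyMeasurable_const,
    hle.trans_lt ENNReal.ofReal_lt_top⟩, hle⟩

/-- A weak form of the Poincaré inequality, on `L²`. -/
theorem exists_norm_sub_const_le (hd : d ≤ 3) (D : Setting d) :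
    ∃ K : ℝ, 0 ≤ K ∧ ∀ v : D.H1, ∃ c : ℝ, MemLp (fun x => fn v x - c) 4 D.vol ∧
      eLpNorm (fun x => fn v x - c) 4 D.vol ≤ ENNReal.ofReal (K * ‖grad v‖) ∧
      ‖fn v - Lp.const 2 D.vol c‖ ≤ K * ‖grad v‖ := by
  obtain ⟨K, hK, H⟩ := exists_memLp_sub_const hd D
  set m := (volume D.dom ^ (1 / 4 : ℝ)).toReal with hmdef
  have hm0 : 0 ≤ m := ENNReal.toReal_nonneg
  refine ⟨K * (1 + m), by positivity, fun v => ?_⟩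
  obtain ⟨c, hc, hle⟩ := H v
  refine ⟨c, hc, hle.trans (ENNReal.ofReal_le_ofReal ?_), ?_⟩
  · nlinarith [mul_nonneg (mul_nonneg hK hm0) (norm_nonneg (grad v))]
  · have h1 : ‖fn v - Lp.const 2 D.vol c‖ₑ = eLpNorm (fun x => fn v x - c) 2 D.vol := by
      rw [Lp.enorm_def]
      refine eLpNorm_congr_ae ?_
      filter_upwards [Lp.coeFn_sub (fn v) (Lp.const 2 D.vol c), D.coeFn_const c] with x hx hx'
      rw [hx, Pi.sub_apply, hx']
    have h2 := eLpNorm_le_eLpNorm_mul_rpow_measure_univ (μ := D.vol) (p := 2) (q := 4)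
      (by norm_num) hc.1
    rw [Measure.restrict_apply_univ, ← h1] at h2
    norm_num at h2
    have h3 : ‖fn v - Lp.const 2 D.vol c‖ₑ ≤ ENNReal.ofReal (K * ‖grad v‖ * m) := by
      refine h2.trans ?_
      rw [ENNReal.ofReal_mul (by positivity), hmdef,
        ENNReal.ofReal_toReal (ENNReal.rpow_ne_top_of_nonneg (by norm_num) D.measure_dom_ne_top)]
      gcongr
    rw [← ofReal_norm, ENNReal.ofReal_le_ofReal_iff (by positivity)] at h3
    nlinarith [mul_nonneg hK (norm_nonneg (grad v))]

/-- The Poincaré inequality for functions with mean zero. -/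
theorem exists_norm_fn_le (hd : d ≤ 3) (D : Setting d) :
    ∃ K : ℝ, 0 ≤ K ∧ ∀ v : D.H1, ∫ x in D.dom, fn v x = 0 → ‖fn v‖ ≤ K * ‖grad v‖ := by
  obtain ⟨K, hK, H⟩ := exists_norm_sub_const_le hd D
  refine ⟨K, hK, fun v hv => ?_⟩
  obtain ⟨c, -, -, hc⟩ := H v
  refine le_trans ?_ hc
  -- A function with mean zero is orthogonal to constants, so `‖v‖² = (v, v - c)`. Thus the
  -- inexplicit constant `c` need not be the mean.
  have h1 : ‖fn v‖ * ‖fn v‖ ≤ ‖fn v‖ * ‖fn v - Lp.const 2 D.vol c‖ := by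
    refine le_trans (le_of_eq ?_) (real_inner_le_norm _ _)
    rw [inner_sub_right, inner_const_right, hv, mul_zero, sub_zero, real_inner_self_eq_norm_mul_norm]
  rcases (norm_nonneg (fn v)).eq_or_lt with h | h
  · rw [← h]; exact norm_nonneg _
  · exact le_of_mul_le_mul_left h1 h

theorem norm_fn_le (v : D.H1) : ‖fn v‖ ≤ ‖v‖ := by
  have h : ‖v‖ = ‖v.1‖ := rfl
  rw [h, WithLp.prod_norm_eq_of_L2]
  exact Real.le_sqrt_of_sq_le (by simp [fn])

theorem norm_grad_le (v : D.H1) : ‖grad v‖ ≤ ‖v‖ := by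
  have h : ‖v‖ = ‖v.1‖ := rfl
  rw [h, WithLp.prod_norm_eq_of_L2]
  exact Real.le_sqrt_of_sq_le (by simp [grad])

theorem norm_sq_eq (v : D.H1) : ‖v‖ ^ 2 = ‖fn v‖ ^ 2 + ‖grad v‖ ^ 2 := by
  have h : ‖v‖ = ‖v.1‖ := rfl
  rw [h, WithLp.prod_norm_sq_eq_of_L2]
  rfl

/-- The Sobolev embedding `H¹ ⊆ L⁴`. -/
theorem exists_eLpNorm_four_le (hd : d ≤ 3) (D : Setting d) :
    ∃ K : ℝ, 0 ≤ K ∧ ∀ v : D.H1, MemLp (fn v) 4 D.vol ∧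
      eLpNorm (fn v) 4 D.vol ≤ ENNReal.ofReal (K * ‖v‖) := by
  obtain ⟨K, hK, H⟩ := exists_norm_sub_const_le hd D
  set a := (volume D.dom ^ (1 / 4 : ℝ)).toReal with ha
  set b := (volume D.dom ^ (1 / 2 : ℝ)).toReal with hb
  have ha0 : 0 ≤ a := ENNReal.toReal_nonneg
  have hb0 : 0 < b := ENNReal.toReal_pos
    (by simpa [ENNReal.rpow_eq_zero_iff, D.measure_dom_ne_top] using D.measure_dom_ne_zero)
    (ENNReal.rpow_ne_top_of_nonneg (by norm_num) D.measure_dom_ne_top)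
  refine ⟨K + (1 + K) / b * a, by positivity, fun v => ?_⟩
  obtain ⟨c, hc, hle, hle2⟩ := H v
  have hsum : (fn v : E d → ℝ) = (fun x => fn v x - c) + fun _ => c := by
    funext x; simp
  have hmem : MemLp (fn v) 4 D.vol := by
    rw [hsum]; exact hc.add (memLp_const c)
  refine ⟨hmem, ?_⟩
  have hcn : ‖Lp.const 2 D.vol c‖ = |c| * b := by
    have h0 : NeZero D.vol := ⟨by simpa using D.measure_dom_ne_zero⟩
    rw [Lp.norm_const (p := 2) (μ := D.vol) (c := c) two_ne_zero, Real.norm_eq_abs, hb,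
      ← ENNReal.toReal_rpow, measureReal_def, Measure.restrict_apply_univ]
    norm_num
  -- The size of `c` is recovered from `c = v - (v - c)` in `L²`, where both terms are bounded by
  -- the `H¹` norm.
  have hcb : |c| ≤ (1 + K) / b * ‖v‖ := by
    rw [div_mul_eq_mul_div, le_div_iff₀ hb0, ← hcn]
    calc ‖Lp.const 2 D.vol c‖ = ‖fn v - (fn v - Lp.const 2 D.vol c)‖ := by abel_nf
      _ ≤ ‖fn v‖ + ‖fn v - Lp.const 2 D.vol c‖ := norm_sub_le _ _
      _ ≤ ‖v‖ + K * ‖v‖ := add_le_add (norm_fn_le v)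
          (hle2.trans (mul_le_mul_of_nonneg_left (norm_grad_le v) hK))
      _ = (1 + K) * ‖v‖ := by ring
  have hconst : eLpNorm (fun _ : E d => c) 4 D.vol = ENNReal.ofReal (|c| * a) := by
    rw [eLpNorm_const' _ (by norm_num) (by norm_num), Measure.restrict_apply_univ,
      ENNReal.ofReal_mul (abs_nonneg c), ← Real.norm_eq_abs, ofReal_norm, ha,
      ENNReal.ofReal_toReal (ENNReal.rpow_ne_top_of_nonneg (by norm_num) D.measure_dom_ne_top)]
    norm_num
  calc eLpNorm (fn v) 4 D.vol
      ≤ eLpNorm (fun x => fn v x - c) 4 D.vol + eLpNorm (fun _ : E d => c) 4 D.vol := by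
        conv_lhs => rw [hsum]
        exact eLpNorm_add_le hc.1 aestronglyMeasurable_const (by norm_num)
    _ ≤ ENNReal.ofReal (K * ‖grad v‖) + ENNReal.ofReal (|c| * a) := by
        rw [hconst]; gcongr
    _ = ENNReal.ofReal (K * ‖grad v‖ + |c| * a) :=
        (ENNReal.ofReal_add (by positivity) (by positivity)).symm
    _ ≤ _ := by
        refine ENNReal.ofReal_le_ofReal ?_
        have h1 := mul_le_mul_of_nonneg_left (norm_grad_le v) hK
        have h2 := mul_le_mul_of_nonneg_right hcb ha0
        nlinarith

/-- The function underlying an element of `H¹`, as a continuous linear map. -/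
noncomputable def fnL (D : Setting d) : D.H1 →L[ℝ] D.L2 :=
  LinearMap.mkContinuous ⟨⟨fn, fun _ _ => rfl⟩, fun _ _ => rfl⟩ 1 fun v => by
    rw [one_mul]; exact norm_fn_le v

/-- The weak gradient, as a continuous linear map. -/
noncomputable def gradL (D : Setting d) : D.H1 →L[ℝ] D.L2v :=
  LinearMap.mkContinuous ⟨⟨grad, fun _ _ => rfl⟩, fun _ _ => rfl⟩ 1 fun v => by
    rw [one_mul]; exact norm_grad_le v

@[simp] theorem fnL_apply (v : D.H1) : D.fnL v = fn v := rfl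

theorem memLp_of_continuous (D : Setting d) {F : Type*} [NormedAddCommGroup F] {η : E d → F}
    (hη : Continuous η) : MemLp η 2 D.vol := by
  obtain ⟨C, hC⟩ :=
    (D.isBounded_dom.isCompact_closure).exists_bound_of_continuousOn hη.continuousOn
  refine MemLp.of_bound (C := C) ?_ ?_
  · exact hη.aestronglyMeasurable
  · filter_upwards [ae_restrict_mem D.isOpen_dom.measurableSet] with x hx
      using hC x (subset_closure hx)

theorem inner_toLp_right (u : D.L2) {η : E d → ℝ} (hη : MemLp η 2 D.vol) :
    inner ℝ u (hη.toLp η) = ∫ x in D.dom, u x * η x := by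
  rw [L2.inner_def]
  refine integral_congr_ae ?_
  filter_upwards [hη.coeFn_toLp] with x hx
  rw [hx]
  simp [mul_comm]

/-- Each test function imposes an equality of two inner products with fixed square integrable
functions, which is a closed condition. The resulting completeness is needed for Lax–Milgram. -/
theorem isClosed_H1 (D : Setting d) : IsClosed (D.H1 : Set (WithLp 2 (D.L2 × D.L2v))) := by
  have hset : (D.H1 : Set (WithLp 2 (D.L2 × D.L2v)))
      = ⋂ (η : E d → ℝ) (_ : D.IsTest η) (e : E d),
        {p | ∫ x in D.dom, p.fst x * fderiv ℝ η x e
          = -∫ x in D.dom, inner ℝ (p.snd x) e * η x} := by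
    ext p
    simp only [mem_iInter]
    rfl
  rw [hset]
  refine isClosed_iInter fun η => isClosed_iInter fun hη => isClosed_iInter fun e => ?_
  have hd : Continuous fun x => fderiv ℝ η x e :=
    (hη.contDiff.continuous_fderiv (by simp)).clm_apply continuous_const
  have hv : Continuous fun x => η x • e := hη.contDiff.continuous.smul continuous_const
  have e1 : ∀ u : D.L2, ∫ x in D.dom, u x * fderiv ℝ η x e
      = inner ℝ u ((D.memLp_of_continuous hd).toLp _) := fun u => (inner_toLp_right u _).symm
  have e2 : ∀ g : D.L2v, ∫ x in D.dom, inner ℝ (g x) e * η x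
      = inner ℝ g ((D.memLp_of_continuous hv).toLp _) := by
    intro g
    rw [L2.inner_def]
    refine integral_congr_ae ?_
    filter_upwards [(D.memLp_of_continuous hv).coeFn_toLp] with x hx
    rw [hx, inner_smul_right, mul_comm]
  simp_rw [e1, e2]
  have c1 : Continuous fun p : WithLp 2 (D.L2 × D.L2v) => p.fst :=
    continuous_fst.comp (WithLp.prod_continuous_ofLp 2 _ _)
  have c2 : Continuous fun p : WithLp 2 (D.L2 × D.L2v) => p.snd :=
    continuous_snd.comp (WithLp.prod_continuous_ofLp 2 _ _)
  exact isClosed_eq (c1.inner continuous_const) (c2.inner continuous_const).neg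

instance (D : Setting d) : CompleteSpace D.H1 := D.isClosed_H1.completeSpace_coe

/-- Constant functions as elements of `H¹`. -/
noncomputable def constH1 (hd : d ≠ 0) (D : Setting d) (c : ℝ) : D.H1 :=
  ⟨WithLp.toLp 2 (Lp.const 2 D.vol c, 0), by
    intro η hη e
    have h1 : ∫ x in D.dom, (Lp.const 2 D.vol c : D.L2) x * fderiv ℝ η x e
        = ∫ x in D.dom, c * fderiv ℝ η x e := by
      refine integral_congr_ae ?_
      filter_upwards [D.coeFn_const c] with x hx
      rw [hx]
    have h2 : ∫ x in D.dom, inner ℝ ((0 : D.L2v) x) e * η x = 0 := by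
      refine integral_eq_zero_of_ae ?_
      filter_upwards [Lp.coeFn_zero (E d) 2 D.vol] with x hx
      rw [hx]
      simp
    change ∫ x in D.dom, (Lp.const 2 D.vol c : D.L2) x * fderiv ℝ η x e
      = -∫ x in D.dom, inner ℝ ((0 : D.L2v) x) e * η x
    rw [h1, h2, integral_const_mul, D.integral_fderiv_isTest hd hη, mul_zero, neg_zero]⟩

@[simp] theorem fn_constH1 (hd : d ≠ 0) (D : Setting d) (c : ℝ) :
    fn (D.constH1 hd c) = Lp.const 2 D.vol c := rfl

@[simp] theorem grad_constH1 (hd : d ≠ 0) (D : Setting d) (c : ℝ) :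
    grad (D.constH1 hd c) = 0 := rfl

@[simp] theorem fn_add (u v : D.H1) : fn (u + v) = fn u + fn v := rfl
@[simp] theorem fn_sub (u v : D.H1) : fn (u - v) = fn u - fn v := rfl
@[simp] theorem fn_smul (c : ℝ) (v : D.H1) : fn (c • v) = c • fn v := rfl
@[simp] theorem grad_add (u v : D.H1) : grad (u + v) = grad u + grad v := rfl
@[simp] theorem grad_sub (u v : D.H1) : grad (u - v) = grad u - grad v := rfl
@[simp] theorem grad_smul (c : ℝ) (v : D.H1) : grad (c • v) = c • grad v := rfl

theorem H1_ext {u v : D.H1} (h : fn u = fn v) (h' : grad u = grad v) : u = v := by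
  refine Subtype.ext ?_
  exact WithLp.ofLp_injective 2 (Prod.ext h h')

theorem mem_H1zero {v : D.H1} : v ∈ D.H1zero ↔ ∫ x in D.dom, fn v x = 0 := Iff.rfl

theorem isClosed_H1zero (D : Setting d) : IsClosed (D.H1zero : Set D.H1) := by
  have h : (D.H1zero : Set D.H1) = {v | inner ℝ (D.fnL v) (Lp.const 2 D.vol (1 : ℝ)) = 0} := by
    ext v
    simp only [SetLike.mem_coe, mem_H1zero, mem_ofPred_eq, inner_const_right, one_mul, fnL_apply]
  rw [h]
  exact isClosed_eq (D.fnL.continuous.inner continuous_const) continuous_const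

instance (D : Setting d) : CompleteSpace D.H1zero := D.isClosed_H1zero.completeSpace_coe

theorem integral_fn_constH1 (hd : d ≠ 0) (D : Setting d) (c : ℝ) :
    ∫ x in D.dom, fn (D.constH1 hd c) x = c * volume.real D.dom := by
  rw [fn_constH1, integral_congr_ae (D.coeFn_const c), setIntegral_const, smul_eq_mul, mul_comm]

theorem real_volume_dom_pos (D : Setting d) : 0 < volume.real D.dom :=
  ENNReal.toReal_pos D.measure_dom_ne_zero D.measure_dom_ne_top

theorem mul_average (D : Setting d) (f : E d → ℝ) :
    (⨍ x in D.dom, f x) * volume.real D.dom = ∫ x in D.dom, f x := by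
  rw [setAverage_eq, smul_eq_mul, mul_comm, ← mul_assoc,
    mul_inv_cancel₀ D.real_volume_dom_pos.ne', one_mul]

theorem integral_add_L2 (u v : D.L2) :
    ∫ x in D.dom, (u + v) x = (∫ x in D.dom, u x) + ∫ x in D.dom, v x := by
  simpa using integral_smul_add 1 u v

theorem integral_smul_L2 (c : ℝ) (u : D.L2) :
    ∫ x in D.dom, (c • u) x = c * ∫ x in D.dom, u x := by
  have h := integral_smul_add c u 0
  rwa [add_zero, integral_eq_zero_of_ae (Lp.coeFn_zero ℝ 2 D.vol), add_zero] at h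

theorem integral_sub_L2 (u v : D.L2) :
    ∫ x in D.dom, (u - v) x = (∫ x in D.dom, u x) - ∫ x in D.dom, v x := by
  have h := integral_smul_add (-1) v u
  rw [show (-1 : ℝ) • v + u = u - v by module] at h
  rw [h]; ring

/-- Splitting off the mean extends identities from test functions with mean zero to all of `H¹`. -/
theorem sub_average_mem_H1zero (hd : d ≠ 0) (v : D.H1) :
    v - D.constH1 hd (⨍ x in D.dom, fn v x) ∈ D.H1zero := by
  rw [mem_H1zero, fn_sub, integral_sub_L2, integral_fn_constH1, mul_average, sub_self]

end Setting
end VCH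

namespace VCH

open Topology Filter

/-! ### Bounds for the bulk potentials. -/

namespace Potential

theorem measurable_F (p : Potential) : Measurable p.F := by
  cases p with
  | doubleWell => unfold F; fun_prop
  | floryHuggins θ σ hθ hσ hσ' =>
    unfold F
    exact Measurable.ite measurableSet_Ici (by fun_prop)
      (Measurable.ite measurableSet_Ici (by fun_prop) (by fun_prop))

section FloryHuggins

variable {θ σ : ℝ}

theorem floryHuggins_of_le {hθ : 0 < θ} {hσ : 0 < σ} {hσ' : σ < 1 / 2} {s : ℝ} (hs : 1 - σ ≤ s) :
    (floryHuggins θ σ hθ hσ hσ').F s = s * Real.log s + (1 - s) ^ 2 / (2 * σ)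
      + (1 - s) * Real.log σ - σ / 2 + θ * s * (1 - s) := if_pos hs

theorem floryHuggins_of_mem {hθ : 0 < θ} {hσ : 0 < σ} {hσ' : σ < 1 / 2} {s : ℝ}
    (hs : s ∈ Icc σ (1 - σ)) :
    (floryHuggins θ σ hθ hσ hσ').F s
      = s * Real.log s + (1 - s) * Real.log (1 - s) + θ * s * (1 - s) := by
  rcases hs.2.eq_or_lt with h | h
  · rw [floryHuggins_of_le h.ge, h, sub_sub_cancel]
    field_simp
    ring
  · simp [F, h.not_ge, hs.1]

/-- Reflection interchanges the two outer branches and fixes the middle one, so the estimates below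
need only be proved for `s ≥ 1/2`. -/
theorem floryHuggins_one_sub {hθ : 0 < θ} {hσ : 0 < σ} {hσ' : σ < 1 / 2} (s : ℝ) :
    (floryHuggins θ σ hθ hσ hσ').F (1 - s) = (floryHuggins θ σ hθ hσ hσ').F s := by
  have key : ∀ s < σ, (floryHuggins θ σ hθ hσ hσ').F (1 - s)
      = (floryHuggins θ σ hθ hσ hσ').F s := by
    intro s hs
    rw [floryHuggins_of_le (by linarith), F, if_neg (by linarith), if_neg hs.not_ge]
    ring_nf
  rcases lt_or_ge s σ with h | h
  · exact key s h
  · rcases le_or_gt s (1 - σ) with h' | h'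
    · rw [floryHuggins_of_mem (s := s) ⟨h, h'⟩,
        floryHuggins_of_mem (s := 1 - s) ⟨by linarith, by linarith⟩, sub_sub_cancel]
      ring
    · have := key (1 - s) (by linarith)
      rw [sub_sub_cancel] at this
      exact this.symm

/-- A property invariant under `s ↦ 1 - s` need only be checked on `[1/2, ∞)`. -/
theorem forall_of_one_sub {p : ℝ → Prop} (hp : ∀ s, p (1 - s) → p s) (h : ∀ s, 1 / 2 ≤ s → p s)
    (s : ℝ) : p s := by
  rcases le_total (1 / 2) s with hs | hs
  · exact h s hs
  · exact hp s (h _ (by linarith))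

theorem abs_log_le {s : ℝ} (hs : 1 / 2 ≤ s) : |Real.log s| ≤ 1 + s := by
  have h0 : 0 < s := by linarith
  have h1 := Real.log_le_sub_one_of_pos h0
  have h2 := Real.one_sub_inv_le_log_of_pos h0
  have h3 : s⁻¹ ≤ 2 := by rw [inv_le_comm₀ h0 (by norm_num)]; linarith
  rw [abs_le]
  constructor <;> linarith

theorem exists_pos_le_of_forall_pos {f : ℝ → ℝ} {a b : ℝ} (hf : ContinuousOn f (Icc a b))
    (hpos : ∀ s ∈ Icc a b, 0 < f s) : ∃ m, 0 < m ∧ ∀ s ∈ Icc a b, m ≤ f s := by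
  rcases (Icc a b).eq_empty_or_nonempty with h | h
  · exact ⟨1, one_pos, by simp [h]⟩
  · obtain ⟨x, hx, hmin⟩ := isCompact_Icc.exists_isMinOn h hf
    exact ⟨f x, hpos x hx, fun s hs => hmin hs⟩

/-- A function `s log s + κ s² + a s + b` that is positive for large `s` is bounded below by a
positive constant for large `s`. -/
theorem eventually_one_le_of_eventually_pos {κ a b : ℝ}
    (h : ∀ᶠ s in atTop, 0 < s * Real.log s + κ * s ^ 2 + a * s + b) :
    ∀ᶠ s in atTop, 1 ≤ s * Real.log s + κ * s ^ 2 + a * s + b := by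
  have hlog : Tendsto (fun s : ℝ => Real.log s / s) atTop (𝓝 0) := by
    simpa using Real.tendsto_pow_log_div_mul_add_atTop 1 0 1 one_ne_zero
  have hinv : Tendsto (fun s : ℝ => s⁻¹) atTop (𝓝 0) := tendsto_inv_atTop_zero
  -- The sign of `κ` is not given; dividing the positive expression by `s²` and letting `s → ∞`
  -- leaves `κ`. Once `κ ≥ 0`, the term `s log s` dominates the affine part.
  have hκ : 0 ≤ κ := by
    have hlim : Tendsto (fun s : ℝ => Real.log s / s + κ + a * s⁻¹ + b * (s⁻¹ * s⁻¹)) atTop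
        (𝓝 (0 + κ + a * 0 + b * (0 * 0))) :=
      ((hlog.add_const κ).add (hinv.const_mul a)).add ((hinv.mul hinv).const_mul b)
    have hnn : ∀ᶠ s : ℝ in atTop, 0 ≤ Real.log s / s + κ + a * s⁻¹ + b * (s⁻¹ * s⁻¹) := by
      filter_upwards [h, eventually_gt_atTop 0] with s hs hs0
      have : Real.log s / s + κ + a * s⁻¹ + b * (s⁻¹ * s⁻¹)
          = (s * Real.log s + κ * s ^ 2 + a * s + b) / s ^ 2 := by field_simp
      rw [this]
      positivity
    simpa using ge_of_tendsto hlim hnn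
  have hlim : Tendsto (fun s : ℝ => s * (Real.log s + (a - |b|))) atTop atTop :=
    tendsto_id.atTop_mul_atTop₀ (tendsto_atTop_add_const_right _ _ Real.tendsto_log_atTop)
  filter_upwards [hlim.eventually_ge_atTop 1, eventually_ge_atTop 1] with s hs hs1
  have h1 : 0 ≤ κ * s ^ 2 := by positivity
  have h2 : -b ≤ |b| * s := (neg_le_abs b).trans (le_mul_of_one_le_right (abs_nonneg b) hs1)
  linarith

/-- Bounding `H` by `F'` requires a uniform lower bound on `F + B`, not just positivity. It comes
from compactness on bounded intervals and, near infinity, from the dichotomy that an expression `s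
log s + κ s² + a s + b` which stays positive must eventually exceed `1`. -/
theorem exists_pos_le_floryHuggins {hθ : 0 < θ} {hσ : 0 < σ} {hσ' : σ < 1 / 2} {B : ℝ}
    (hB : ∀ s, 0 < (floryHuggins θ σ hθ hσ hσ').F s + B) :
    ∃ m, 0 < m ∧ ∀ s, m ≤ (floryHuggins θ σ hθ hσ hσ').F s + B := by
  set f : ℝ → ℝ := fun s => s * Real.log s + (1 - s) ^ 2 / (2 * σ)
      + (1 - s) * Real.log σ - σ / 2 + θ * s * (1 - s) + B with hf
  have hfF : ∀ s, 1 - σ ≤ s → (floryHuggins θ σ hθ hσ hσ').F s + B = f s := fun s hs => by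
    rw [floryHuggins_of_le hs]
  have hform : ∀ s, f s = s * Real.log s + (1 / (2 * σ) - θ) * s ^ 2
      + (-(1 / σ) - Real.log σ + θ) * s + (1 / (2 * σ) + Real.log σ - σ / 2 + B) := by
    intro s
    simp only [hf]
    field_simp
    ring
  have hev : ∀ᶠ s in atTop, 1 ≤ f s := by
    simp_rw [hform]
    refine eventually_one_le_of_eventually_pos ?_
    filter_upwards [eventually_ge_atTop (1 - σ)] with s hs
    rw [← hform, ← hfF s hs]
    exact hB s
  obtain ⟨M, hM⟩ := eventually_atTop.1 hev
  obtain ⟨m₁, hm₁, h₁⟩ := exists_pos_le_of_forall_pos (f := f) (a := 1 - σ) (b := M)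
    (by
      have : Continuous f := by
        have := Real.continuous_mul_log
        simp only [hf]
        fun_prop
      exact this.continuousOn) fun s hs => hfF s hs.1 ▸ hB s
  obtain ⟨m₂, hm₂, h₂⟩ := exists_pos_le_of_forall_pos (a := σ) (b := 1 - σ)
    (f := fun s => s * Real.log s + (1 - s) * Real.log (1 - s) + θ * s * (1 - s) + B)
    (by
      have h1 := Real.continuous_mul_log
      have h2 : Continuous fun s : ℝ => (1 - s) * Real.log (1 - s) :=
        h1.comp (continuous_const.sub continuous_id)
      exact Continuous.continuousOn (by fun_prop)) fun s hs => by
        have := hB s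
        rwa [floryHuggins_of_mem hs] at this
  refine ⟨min 1 (min m₁ m₂), by positivity, forall_of_one_sub (fun s => ?_) fun s hs => ?_⟩
  · rw [floryHuggins_one_sub]; exact id
  · rcases le_total (1 - σ) s with h | h
    · rw [hfF s h]
      rcases le_total M s with h' | h'
      · exact (min_le_left _ _).trans (hM s h')
      · exact ((min_le_right _ _).trans (min_le_left _ _)).trans (h₁ s ⟨h, h'⟩)
    · rw [floryHuggins_of_mem ⟨by linarith, h⟩]
      exact ((min_le_right _ _).trans (min_le_right _ _)).trans (h₂ s ⟨by linarith, h⟩)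

theorem exists_abs_deriv_floryHuggins_le {hθ : 0 < θ} {hσ : 0 < σ} {hσ' : σ < 1 / 2} :
    ∃ C, 0 ≤ C ∧ ∀ s, |deriv (floryHuggins θ σ hθ hσ hσ').F s| ≤ C * (1 + |s|) := by
  set F₀ := (floryHuggins θ σ hθ hσ hσ').F with hF₀
  -- The derivative at the junction `1 - σ` is simply absorbed into the constant, so
  -- differentiability across the branches never has to be checked.
  set C := |deriv F₀ (1 - σ)| + (3 + 1 / σ + |Real.log σ| + |Real.log σ| + 2 * θ) with hC
  have hC0 : 0 ≤ C := by positivity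
  have hhalf : ∀ s, 1 / 2 ≤ s → |deriv F₀ s| ≤ C * (1 + |s|) := by
    intro s hs
    have hs0 : 0 < s := by linarith
    rw [abs_of_pos hs0]
    rcases lt_trichotomy s (1 - σ) with h | h | h
    · have heq : F₀ =ᶠ[𝓝 s] fun s => s * Real.log s + (1 - s) * Real.log (1 - s)
          + θ * s * (1 - s) := by
        filter_upwards [Ioo_mem_nhds (show σ < s by linarith) h] with t ht
        exact floryHuggins_of_mem ⟨ht.1.le, ht.2.le⟩
      have hs1 : 1 - s ≠ 0 := by linarith
      have hd : HasDerivAt (fun s => s * Real.log s + (1 - s) * Real.log (1 - s)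
          + θ * s * (1 - s)) (Real.log s - Real.log (1 - s) + θ * (1 - 2 * s)) s := by
        have h1 := Real.hasDerivAt_mul_log hs0.ne'
        have h2 := (Real.hasDerivAt_mul_log hs1).comp s ((hasDerivAt_id s).const_sub 1)
        have h3 := ((hasDerivAt_id s).const_mul θ).mul ((hasDerivAt_id s).const_sub 1)
        refine ((h1.add h2).add h3).congr_deriv ?_
        simp only [id]
        ring
      rw [heq.deriv_eq, hd.deriv]
      have l1 := abs_log_le hs
      have l2 : |Real.log (1 - s)| ≤ |Real.log σ| := by
        rw [abs_of_neg (Real.log_neg (by linarith) (by linarith)),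
          abs_of_neg (Real.log_neg hσ (by linarith))]
        exact neg_le_neg (Real.log_le_log hσ (by linarith))
      have l3 : |θ * (1 - 2 * s)| ≤ 2 * θ * (1 + s) := by
        rw [abs_mul, abs_of_pos hθ]
        have : |1 - 2 * s| ≤ 2 * (1 + s) := by rw [abs_le]; constructor <;> linarith
        nlinarith
      have l4 := abs_add_le (Real.log s - Real.log (1 - s)) (θ * (1 - 2 * s))
      have l5 := abs_sub (Real.log s) (Real.log (1 - s))
      have l6 : C * (1 + s) = |deriv F₀ (1 - σ)| * (1 + s) + 3 * (1 + s) + 1 / σ * (1 + s)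
        + |Real.log σ| * (1 + s) + |Real.log σ| * (1 + s) + 2 * θ * (1 + s) := by rw [hC]; ring
      have l7 : 0 ≤ |deriv F₀ (1 - σ)| * (1 + s) := by positivity
      have l8 : 0 ≤ 1 / σ * (1 + s) := by positivity
      have l9 : 0 ≤ |Real.log σ| * s := by positivity
      linarith [abs_nonneg (Real.log σ)]
    · rw [h]
      have l1 : |deriv F₀ (1 - σ)| ≤ C := by
        rw [hC]; exact le_add_of_nonneg_right (by positivity)
      nlinarith
    · have heq : F₀ =ᶠ[𝓝 s] fun s => s * Real.log s + (1 - s) ^ 2 / (2 * σ)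
          + (1 - s) * Real.log σ - σ / 2 + θ * s * (1 - s) := by
        filter_upwards [Ioi_mem_nhds h] with t ht
        exact floryHuggins_of_le (le_of_lt ht)
      have hd : HasDerivAt (fun s => s * Real.log s + (1 - s) ^ 2 / (2 * σ)
          + (1 - s) * Real.log σ - σ / 2 + θ * s * (1 - s))
          (Real.log s + 1 - (1 - s) / σ - Real.log σ + θ * (1 - 2 * s)) s := by
        have h1 := Real.hasDerivAt_mul_log hs0.ne'
        have h0 := (hasDerivAt_id s).const_sub 1
        have h3 := ((hasDerivAt_id s).const_mul θ).mul h0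
        refine ((((h1.add ((h0.pow 2).div_const (2 * σ))).add
          (h0.mul_const (Real.log σ))).sub_const (σ / 2)).add h3).congr_deriv ?_
        simp only [id]
        field_simp
        ring
      rw [heq.deriv_eq, hd.deriv]
      have l1 := abs_log_le hs
      have l2 : |(1 - s) / σ| ≤ 1 / σ * (1 + s) := by
        rw [abs_div, abs_of_pos hσ, div_mul_eq_mul_div, one_mul]
        gcongr
        rw [abs_le]; constructor <;> linarith
      have l3 : |θ * (1 - 2 * s)| ≤ 2 * θ * (1 + s) := by
        rw [abs_mul, abs_of_pos hθ]
        have : |1 - 2 * s| ≤ 2 * (1 + s) := by rw [abs_le]; constructor <;> linarith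
        nlinarith
      have l4 := abs_add_le (Real.log s + 1 - (1 - s) / σ - Real.log σ) (θ * (1 - 2 * s))
      have l5 := abs_sub (Real.log s + 1 - (1 - s) / σ) (Real.log σ)
      have l5' := abs_sub (Real.log s + 1) ((1 - s) / σ)
      have l5'' := abs_add_le (Real.log s) 1
      rw [abs_one] at l5''
      have l6 : C * (1 + s) = |deriv F₀ (1 - σ)| * (1 + s) + 3 * (1 + s) + 1 / σ * (1 + s)
        + |Real.log σ| * (1 + s) + |Real.log σ| * (1 + s) + 2 * θ * (1 + s) := by rw [hC]; ring
      have l7 : 0 ≤ |deriv F₀ (1 - σ)| * (1 + s) := by positivity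
      have l8 : 0 ≤ |Real.log σ| * (1 + s) := by positivity
      have l9 : 0 ≤ |Real.log σ| * s := by positivity
      linarith
  refine ⟨2 * C, by positivity, fun s => ?_⟩
  rcases le_total (1 / 2) s with hs | hs
  · have := hhalf s hs
    nlinarith [abs_nonneg s]
  · have h1 := hhalf (1 - s) (by linarith)
    have h2 : deriv F₀ (1 - s) = -deriv F₀ s := by
      have h3 : (fun t => F₀ (1 - t)) = F₀ := funext fun t => floryHuggins_one_sub t
      have h4 := deriv_comp_const_sub (f := F₀) (1 : ℝ) s
      rw [h3] at h4
      linarith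
    rw [h2, abs_neg] at h1
    have h3 : |1 - s| ≤ 1 + |s| := by simpa using abs_sub (1 : ℝ) s
    nlinarith [abs_nonneg s]

theorem exists_floryHuggins_le {hθ : 0 < θ} {hσ : 0 < σ} {hσ' : σ < 1 / 2} :
    ∃ C, 0 ≤ C ∧ ∀ s, (floryHuggins θ σ hθ hσ hσ').F s ≤ C * (1 + s ^ 2) := by
  set F₀ := (floryHuggins θ σ hθ hσ hσ').F with hF₀
  set C := 1 + 1 / σ + |Real.log σ| * 2 + θ * 2 with hC
  have hC0 : 0 ≤ C := by positivity
  have hhalf : ∀ s, 1 / 2 ≤ s → F₀ s ≤ C * (1 + s ^ 2) := by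
    intro s hs
    have hs0 : 0 < s := by linarith
    have l6 : C * (1 + s ^ 2) = (1 + s ^ 2) + 1 / σ * (1 + s ^ 2)
        + |Real.log σ| * (2 * (1 + s ^ 2)) + θ * (2 * (1 + s ^ 2)) := by rw [hC]; ring
    have l1 : s * Real.log s ≤ s * (s - 1) :=
      mul_le_mul_of_nonneg_left (Real.log_le_sub_one_of_pos hs0) hs0.le
    have l2 : θ * s * (1 - s) ≤ θ * (2 * (1 + s ^ 2)) := by
      rw [mul_assoc]
      exact mul_le_mul_of_nonneg_left (by nlinarith) hθ.le
    rcases le_total s (1 - σ) with h | h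
    · rw [hF₀, floryHuggins_of_mem ⟨by linarith, h⟩]
      have l3 : (1 - s) * Real.log (1 - s) ≤ 0 :=
        mul_nonpos_of_nonneg_of_nonpos (by linarith)
          (Real.log_nonpos (by linarith) (by linarith))
      have l4 : 0 ≤ 1 / σ * (1 + s ^ 2) := by positivity
      have l5 : 0 ≤ |Real.log σ| * (2 * (1 + s ^ 2)) := by positivity
      nlinarith
    · rw [hF₀, floryHuggins_of_le h]
      have l3 : (1 - s) ^ 2 / (2 * σ) ≤ 1 / σ * (1 + s ^ 2) := by
        rw [div_mul_eq_mul_div, one_mul, div_le_div_iff₀ (by positivity) hσ]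
        nlinarith [sq_nonneg (1 + s)]
      have l4 : (1 - s) * Real.log σ ≤ |Real.log σ| * (2 * (1 + s ^ 2)) := by
        calc (1 - s) * Real.log σ ≤ |(1 - s) * Real.log σ| := le_abs_self _
          _ = |Real.log σ| * |1 - s| := by rw [abs_mul, mul_comm]
          _ ≤ _ := by
            refine mul_le_mul_of_nonneg_left ?_ (abs_nonneg _)
            rw [abs_le]; constructor <;> nlinarith [sq_nonneg (s - 1)]
      nlinarith
  refine ⟨3 * C, by positivity, fun s => ?_⟩
  rcases le_total (1 / 2) s with hs | hs
  · have := hhalf s hs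
    nlinarith [sq_nonneg s]
  · have h1 := hhalf (1 - s) (by linarith)
    rw [hF₀, floryHuggins_one_sub] at h1
    nlinarith [mul_nonneg hC0 (sq_nonneg (1 + s)), mul_nonneg hC0 (sq_nonneg s)]

end FloryHuggins

theorem deriv_doubleWell (s : ℝ) :
    deriv doubleWell.F s = 2 * (s * (s - 1)) * (2 * s - 1) := by
  have h1 : HasDerivAt (fun s : ℝ => s ^ 2 * (s - 1) ^ 2) (2 * (s * (s - 1)) * (2 * s - 1)) s := by
    have h2 := ((hasDerivAt_id s).pow 2).mul (((hasDerivAt_id s).sub_const 1).pow 2)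
    refine h2.congr_deriv ?_
    simp only [id, Pi.pow_apply]
    push_cast
    ring
  exact h1.deriv

end Potential

/-! ### Growth of `H` and of `√(F + B)`. -/

namespace Params

theorem measurable_H (P : Params) : Measurable P.H :=
  (measurable_deriv _).div ((P.pot.measurable_F.add_const _).sqrt)

/-- The nonlinearity `H` grows at most linearly. -/
theorem Admissible.exists_abs_H_le {P : Params} (hP : P.Admissible) :
    ∃ C, 0 ≤ C ∧ ∀ s, |P.H s| ≤ C * (1 + |s|) := by
  obtain ⟨α, β, ε, δt, pot, B⟩ := P
  have hB := hP.F_add_B_pos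
  simp only at hB
  cases pot with
  | doubleWell =>
    refine ⟨4, by norm_num, fun s => ?_⟩
    have hpos := Real.sqrt_pos.2 (hB s)
    have hB0 : 0 < B := by simpa [Potential.F] using hB 0
    simp only [H]
    rw [abs_div, abs_of_pos hpos, div_le_iff₀ hpos, Potential.deriv_doubleWell]
    -- For the double well, `F' = 2 s (s - 1) (2 s - 1)` contains the factor `s (s - 1)` with square
    -- `F`. Since `F 0 = 0` forces `B > 0`, the denominator cancels this factor and a linear one
    -- remains.
    have h1 : |s * (s - 1)| ≤ Real.sqrt (Potential.doubleWell.F s + B) := by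
      refine Real.le_sqrt_of_sq_le ?_
      rw [sq_abs, Potential.F]
      nlinarith
    have h2 : |2 * s - 1| ≤ 2 * (1 + |s|) := by
      have := abs_sub (2 * s) 1
      rw [abs_mul, abs_two, abs_one] at this
      linarith
    rw [abs_mul, abs_mul, abs_two]
    calc 2 * |s * (s - 1)| * |2 * s - 1|
        ≤ 2 * Real.sqrt (Potential.doubleWell.F s + B) * (2 * (1 + |s|)) := by gcongr
      _ = _ := by ring
  | floryHuggins θ σ hθ hσ hσ' =>
    obtain ⟨m, hm, hmF⟩ := Potential.exists_pos_le_floryHuggins hB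
    obtain ⟨C, hC, hCF⟩ := Potential.exists_abs_deriv_floryHuggins_le (hθ := hθ) (hσ := hσ)
      (hσ' := hσ')
    refine ⟨C / Real.sqrt m, by positivity, fun s => ?_⟩
    have hm' := Real.sqrt_pos.2 hm
    simp only [H]
    rw [abs_div, abs_of_pos (Real.sqrt_pos.2 (hB s)), div_mul_eq_mul_div]
    exact div_le_div₀ (by positivity) (hCF s) hm' (Real.sqrt_le_sqrt (hmF s))

/-- Quadratic growth is what puts `U⁰ = √(F(φ⁰) + B)` into `L²`, as `φ⁰` is in `L⁴`. -/
theorem Admissible.exists_sqrt_le {P : Params} (hP : P.Admissible) :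
    ∃ C, 0 ≤ C ∧ ∀ s, Real.sqrt (P.pot.F s + P.B) ≤ C * (1 + s ^ 2) := by
  have key : ∃ C, 0 ≤ C ∧ ∀ s, P.pot.F s ≤ C * (1 + s ^ 2) ^ 2 := by
    obtain ⟨α, β, ε, δt, pot, B⟩ := P
    cases pot with
    | doubleWell =>
      refine ⟨2, by norm_num, fun s => ?_⟩
      simp only [Potential.F]
      nlinarith [sq_nonneg (s * (s + 1)), sq_nonneg (s ^ 2), sq_nonneg s]
    | floryHuggins θ σ hθ hσ hσ' =>
      obtain ⟨C, hC, hCF⟩ := Potential.exists_floryHuggins_le (hθ := hθ) (hσ := hσ) (hσ' := hσ')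
      refine ⟨C, hC, fun s => (hCF s).trans ?_⟩
      exact mul_le_mul_of_nonneg_left (by nlinarith [sq_nonneg s, sq_nonneg (s ^ 2)]) hC
  obtain ⟨C, hC, hCF⟩ := key
  refine ⟨Real.sqrt (C + |P.B|), Real.sqrt_nonneg _, fun s => ?_⟩
  rw [Real.sqrt_le_left (by positivity), mul_pow, Real.sq_sqrt (by positivity)]
  have h1 := hCF s
  have h2 := le_abs_self P.B
  have h3 : |P.B| ≤ |P.B| * (1 + s ^ 2) ^ 2 :=
    le_mul_of_one_le_right (abs_nonneg _) (one_le_pow₀ (by nlinarith [sq_nonneg s]))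
  linarith

end Params
end VCH

namespace VCH

/-! ### Bilinear forms and the Lax–Milgram theorem. -/

section Hilbert

variable {X Y : Type*} [NormedAddCommGroup X] [InnerProductSpace ℝ X]
  [NormedAddCommGroup Y] [InnerProductSpace ℝ Y]

/-- The bounded bilinear form `(x, y) ↦ ⟪S x, S y⟫`. -/
noncomputable def gramForm (S : X →L[ℝ] Y) : X →L[ℝ] X →L[ℝ] ℝ :=
  (LinearMap.mkContinuous₂ (innerₗ Y) 1 fun x y => by
    simpa using norm_inner_le_norm (𝕜 := ℝ) x y).bilinearComp S S

@[simp] theorem gramForm_apply (S : X →L[ℝ] Y) (x y : X) :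
    gramForm S x y = inner ℝ (S x) (S y) := rfl

/-- The Lax–Milgram theorem. -/
theorem exists_apply_eq_of_isCoercive [CompleteSpace X] {B : X →L[ℝ] X →L[ℝ] ℝ}
    (hB : IsCoercive B) (l : X →L[ℝ] ℝ) : ∃ v, ∀ w, B v w = l w := by
  refine ⟨hB.continuousLinearEquivOfBilin.symm ((InnerProductSpace.toDual ℝ X).symm l), fun w => ?_⟩
  rw [← hB.continuousLinearEquivOfBilin_apply, ContinuousLinearEquiv.apply_symm_apply]
  exact InnerProductSpace.toDual_symm_apply

end Hilbert

/-! ### The inverse Laplacian. -/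

namespace Setting

variable {d : ℕ} {D : Setting d}

/-- The gradient on functions with mean zero. -/
noncomputable def gradZeroL (D : Setting d) : D.H1zero →L[ℝ] D.L2v :=
  D.gradL.comp D.H1zero.subtypeL

@[simp] theorem gradZeroL_apply (v : D.H1zero) : D.gradZeroL v = grad (v : D.H1) := rfl

theorem exists_norm_sq_le_grad (hd : d ≤ 3) (D : Setting d) :
    ∃ C, 0 < C ∧ ∀ v : D.H1zero, C * ‖v‖ ^ 2 ≤ ‖grad (v : D.H1)‖ ^ 2 := by
  obtain ⟨K, hK, H⟩ := exists_norm_fn_le hd D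
  refine ⟨(1 + K ^ 2)⁻¹, by positivity, fun v => ?_⟩
  rw [inv_mul_le_iff₀ (by positivity), Submodule.coe_norm, norm_sq_eq]
  have h := pow_le_pow_left₀ (norm_nonneg _) (H v v.2) 2
  linarith [mul_pow K ‖grad (v : D.H1)‖ 2]

theorem isCoercive_gramForm_grad (hd : d ≤ 3) (D : Setting d) :
    IsCoercive (gramForm D.gradZeroL) := by
  obtain ⟨C, hC, H⟩ := exists_norm_sq_le_grad hd D
  refine ⟨C, hC, fun v => ?_⟩
  rw [gramForm_apply, real_inner_self_eq_norm_sq, mul_assoc, ← sq]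
  exact H v

theorem eq_zero_of_grad_eq_zero (hd : d ≤ 3) {v : D.H1} (hv : ∫ x in D.dom, fn v x = 0)
    (h : grad v = 0) : v = 0 := by
  obtain ⟨K, -, H⟩ := exists_norm_fn_le hd D
  have h1 := H v hv
  rw [h, norm_zero, mul_zero] at h1
  exact H1_ext (norm_le_zero_iff.1 h1) h

/-- Lax–Milgram gives the equation for mean-zero test functions. A general one is reduced to this
case by subtracting its mean, which changes neither side: constants have zero gradient and `u` has
mean zero. -/
theorem exists_isInvLaplacian (hd0 : d ≠ 0) (hd : d ≤ 3) {u : D.L2}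
    (hu : ∫ x in D.dom, u x = 0) : ∃ v, IsInvLaplacian u v := by
  obtain ⟨v, hv⟩ := exists_apply_eq_of_isCoercive (isCoercive_gramForm_grad hd D)
    (-((innerSL ℝ u).comp (D.fnL.comp D.H1zero.subtypeL)))
  refine ⟨v, hu, v.2, fun w => ?_⟩
  have h1 := hv ⟨_, sub_average_mem_H1zero hd0 w⟩
  simp only [gramForm_apply, gradZeroL_apply, grad_sub, grad_constH1, sub_zero] at h1
  rw [h1]
  change -inner ℝ u (fn w - fn (D.constH1 hd0 _)) = _
  rw [inner_sub_right, fn_constH1, inner_const_right, hu, mul_zero, sub_zero]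

theorem IsInvLaplacian.unique (hd : d ≤ 3) {u : D.L2} {v w : D.H1} (hv : IsInvLaplacian u v)
    (hw : IsInvLaplacian u w) : v = w := by
  refine sub_eq_zero.1 (eq_zero_of_grad_eq_zero hd ?_ ?_)
  · rw [fn_sub, integral_sub_L2, hv.2.1, hw.2.1, sub_zero]
  · rw [← inner_self_eq_zero (𝕜 := ℝ)]
    conv_lhs => rw [grad_sub v w, inner_sub_left, ← grad_sub, hv.2.2, hw.2.2, sub_self]

theorem isInvLaplacian_invLaplacian (hd0 : d ≠ 0) (hd : d ≤ 3) {u : D.L2}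
    (hu : ∫ x in D.dom, u x = 0) : IsInvLaplacian u (invLaplacian u) :=
  Classical.epsilon_spec (exists_isInvLaplacian hd0 hd hu)

theorem norm_grad_le_of_isInvLaplacian {K : ℝ} (hK : 0 ≤ K)
    (H : ∀ v : D.H1, ∫ x in D.dom, fn v x = 0 → ‖fn v‖ ≤ K * ‖grad v‖) {u : D.L2} {v : D.H1}
    (h : IsInvLaplacian u v) : ‖grad v‖ ≤ K * ‖u‖ := by
  have h1 : ‖grad v‖ * ‖grad v‖ ≤ K * ‖u‖ * ‖grad v‖ := by
    rw [← real_inner_self_eq_norm_mul_norm, h.2.2, ← inner_neg_left]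
    refine (real_inner_le_norm _ _).trans ?_
    rw [norm_neg, mul_right_comm, mul_comm]
    exact mul_le_mul_of_nonneg_right (H v h.2.1) (norm_nonneg u)
  rcases (norm_nonneg (grad v)).eq_or_lt with h0 | h0
  · rw [← h0]; exact mul_nonneg hK (norm_nonneg u)
  · exact le_of_mul_le_mul_right h1 h0

/-- The gradient of the inverse Laplacian, as a bounded operator. -/
noncomputable def gradInvLaplacianL (hd0 : d ≠ 0) (hd : d ≤ 3) (D : Setting d) :
    D.H1zero →L[ℝ] D.L2v :=
  LinearMap.mkContinuousOfExistsBound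
    { toFun := fun φ => grad (invLaplacian (fn (φ : D.H1)))
      -- `invLaplacian` is an arbitrary choice for each argument separately; its linearity is a
      -- consequence of uniqueness.
      map_add' := fun φ χ => by
        have hφ := isInvLaplacian_invLaplacian hd0 hd φ.2
        have hχ := isInvLaplacian_invLaplacian hd0 hd χ.2
        have hs := isInvLaplacian_invLaplacian hd0 hd (φ + χ).2
        rw [← grad_add, hs.unique hd ⟨(φ + χ).2, (D.H1zero.add_mem hφ.2.1 hχ.2.1 : _), fun w => ?_⟩]
        rw [grad_add, inner_add_left, hφ.2.2, hχ.2.2, Submodule.coe_add, fn_add, inner_add_left,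
          neg_add]
      map_smul' := fun c φ => by
        have hφ := isInvLaplacian_invLaplacian hd0 hd φ.2
        have hs := isInvLaplacian_invLaplacian hd0 hd (c • φ).2
        rw [RingHom.id_apply, ← grad_smul,
          hs.unique hd ⟨(c • φ).2, (D.H1zero.smul_mem c hφ.2.1 : _), fun w => ?_⟩]
        rw [grad_smul, inner_smul_left, hφ.2.2, Submodule.coe_smul, fn_smul, inner_smul_left]
        simp }
    (by
      obtain ⟨K, hK, H⟩ := exists_norm_fn_le hd D
      refine ⟨K, fun φ => ?_⟩
      refine (norm_grad_le_of_isInvLaplacian hK H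
        (isInvLaplacian_invLaplacian hd0 hd φ.2)).trans ?_
      exact mul_le_mul_of_nonneg_left (norm_fn_le _) hK)

end Setting

/-! ### The forms `P₁` and `𝔸`. -/

open Setting

variable {d : ℕ} {D : Setting d} {P : Params}

instance : ENNReal.HolderTriple 4 4 2 :=
  ⟨by
    rw [← two_mul, show (4 : ENNReal) = 2 * 2 by norm_num,
      ENNReal.mul_inv (Or.inl (by norm_num)) (Or.inl (by norm_num)), ← mul_assoc,
      ENNReal.mul_inv_cancel (by norm_num) (by norm_num), one_mul]⟩

/-- Linear growth of `H` transfers the integrability of `φ*`, given by the embedding of `H¹` into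
`L⁴`, to `H*`. -/
theorem memLp_Hstar (hd : d ≤ 3) (hP : P.Admissible) (s : Data D) :
    MemLp (Hstar P s) 4 D.vol := by
  obtain ⟨K, -, H⟩ := exists_eLpNorm_four_le hd D
  obtain ⟨C, hC, hH⟩ := hP.exists_abs_H_le
  have h1 : MemLp (fun x => 3 / 2 * fn s.φ x - 1 / 2 * fn s.φprev x) 4 D.vol :=
    ((H s.φ).1.const_mul _).sub ((H s.φprev).1.const_mul _)
  have h2 : MemLp (fun x => C * (1 + |3 / 2 * fn s.φ x - 1 / 2 * fn s.φprev x|)) 4 D.vol :=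
    ((memLp_const (1 : ℝ)).add h1.abs).const_mul C
  refine h2.mono' ?_ (Filter.Eventually.of_forall fun x => hH _)
  exact (P.measurable_H.comp_aemeasurable h1.1.aemeasurable).aestronglyMeasurable

theorem memLp_Hstar_mul (hd : d ≤ 3) (hP : P.Admissible) (s : Data D) (v : D.H1) :
    MemLp (fun x => Hstar P s x * fn v x) 2 D.vol := by
  obtain ⟨K, -, H⟩ := exists_eLpNorm_four_le hd D
  exact (H v).1.mul' (memLp_Hstar hd hP s)

/-- Multiplication by `H*`, as a bounded operator from `H¹` to `L²`. -/
noncomputable def mulHstarL (hd : d ≤ 3) (hP : P.Admissible) (s : Data D) : D.H1 →L[ℝ] D.L2 :=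
  LinearMap.mkContinuousOfExistsBound
    { toFun := fun v => (memLp_Hstar_mul hd hP s v).toLp _
      map_add' := fun u v => by
        refine Lp.ext ?_
        filter_upwards [(memLp_Hstar_mul hd hP s (u + v)).coeFn_toLp,
          (memLp_Hstar_mul hd hP s u).coeFn_toLp, (memLp_Hstar_mul hd hP s v).coeFn_toLp,
          Lp.coeFn_add ((memLp_Hstar_mul hd hP s u).toLp _) ((memLp_Hstar_mul hd hP s v).toLp _),
          Lp.coeFn_add (fn u) (fn v)] with x h1 h2 h3 h4 h5
        rw [h1, h4, Pi.add_apply, h2, h3, fn_add, h5, Pi.add_apply, mul_add]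
      map_smul' := fun c v => by
        refine Lp.ext ?_
        filter_upwards [(memLp_Hstar_mul hd hP s (c • v)).coeFn_toLp,
          (memLp_Hstar_mul hd hP s v).coeFn_toLp,
          Lp.coeFn_smul c ((memLp_Hstar_mul hd hP s v).toLp _),
          Lp.coeFn_smul c (fn v)] with x h1 h2 h3 h4
        rw [h1, RingHom.id_apply, h3, Pi.smul_apply, h2, fn_smul, h4, Pi.smul_apply, smul_eq_mul,
          smul_eq_mul, mul_left_comm] }
    (by
      obtain ⟨K, hK, H⟩ := exists_eLpNorm_four_le hd D
      refine ⟨(eLpNorm (Hstar P s) 4 D.vol).toReal * K, fun v => ?_⟩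
      have h4 := (memLp_Hstar hd hP s).2.ne
      change ‖(memLp_Hstar_mul hd hP s v).toLp _‖ ≤ _
      rw [Lp.norm_toLp]
      refine ENNReal.toReal_le_of_le_ofReal (by positivity) ?_
      refine (eLpNorm_smul_le_mul_eLpNorm (p := 4) (q := 4) (H v).1.1 (memLp_Hstar hd hP s).1).trans ?_
      rw [mul_assoc, ENNReal.ofReal_mul ENNReal.toReal_nonneg, ENNReal.ofReal_toReal h4]
      gcongr
      exact (H v).2)

theorem coeFn_mulHstarL (hd : d ≤ 3) (hP : P.Admissible) (s : Data D) (v : D.H1) :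
    mulHstarL hd hP s v =ᵐ[D.vol] fun x => Hstar P s x * fn v x :=
  (memLp_Hstar_mul hd hP s v).coeFn_toLp

theorem inner_mulHstarL (hd : d ≤ 3) (hP : P.Admissible) (s : Data D) (u : D.L2) (v : D.H1) :
    inner ℝ u (mulHstarL hd hP s v) = ∫ x in D.dom, u x * (Hstar P s x * fn v x) :=
  inner_toLp_right u (memLp_Hstar_mul hd hP s v)

/-- The form `(P₁(φ), v)` as a bounded bilinear form on `H¹`. -/
noncomputable def P1L (hd : d ≤ 3) (hP : P.Admissible) (s : Data D) :
    D.H1 →L[ℝ] D.H1 →L[ℝ] ℝ :=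
  (P.ε ^ 2 / 2) • gramForm D.gradL + (1 / 4 : ℝ) • gramForm (mulHstarL hd hP s)
    + (P.β / P.δt) • gramForm D.fnL

theorem P1_eq_inner (hd : d ≤ 3) (hP : P.Admissible) (s : Data D) (φ v : D.H1) :
    P1 P s φ v = P.ε ^ 2 / 2 * inner ℝ (grad φ) (grad v)
      + 1 / 4 * inner ℝ (mulHstarL hd hP s φ) (mulHstarL hd hP s v)
      + P.β / P.δt * inner ℝ (fn φ) (fn v) := by
  rw [P1, inner_mulHstarL]
  congr 3
  refine integral_congr_ae ?_
  filter_upwards [coeFn_mulHstarL hd hP s φ] with x hx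
  rw [hx]

theorem P1L_apply (hd : d ≤ 3) (hP : P.Admissible) (s : Data D) (φ v : D.H1) :
    P1L hd hP s φ v = P1 P s φ v := by
  rw [P1_eq_inner hd hP]
  rfl

theorem Params.Admissible.αhat_pos (hP : P.Admissible) : 0 < P.αhat := by
  have h1 := hP.α_nonneg
  have h2 := hP.δt_pos
  unfold Params.αhat
  positivity

theorem P1_self_ge (hd : d ≤ 3) (hP : P.Admissible) (s : Data D) (φ : D.H1) :
    P.ε ^ 2 / 2 * ‖grad φ‖ ^ 2 ≤ P1 P s φ φ := by
  rw [P1_eq_inner hd hP]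
  simp only [real_inner_self_eq_norm_sq]
  have h1 : 0 ≤ P.β / P.δt * ‖fn φ‖ ^ 2 :=
    mul_nonneg (div_nonneg hP.β_nonneg hP.δt_pos.le) (sq_nonneg _)
  have h2 := sq_nonneg ‖mulHstarL hd hP s φ‖
  linarith

/-- The operator `𝔸` as a bounded bilinear form on the functions with mean zero. -/
noncomputable def opAL (hd0 : d ≠ 0) (hd : d ≤ 3) (hP : P.Admissible) (s : Data D) :
    D.H1zero →L[ℝ] D.H1zero →L[ℝ] ℝ :=
  P.αhat • gramForm (D.gradInvLaplacianL hd0 hd)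
    + (P1L hd hP s).bilinearComp D.H1zero.subtypeL D.H1zero.subtypeL

theorem opAL_apply' (hd0 : d ≠ 0) (hd : d ≤ 3) (hP : P.Admissible) (s : Data D)
    (φ v : D.H1zero) : opAL hd0 hd hP s φ v
      = P.αhat * inner ℝ (grad (invLaplacian (fn (φ : D.H1))))
        (grad (invLaplacian (fn (v : D.H1)))) + P1 P s φ v := by
  rw [← P1L_apply hd hP]
  rfl

/-- Testing the equation for `Δ⁻¹v` with `Δ⁻¹φ` gives `-(Δ⁻¹φ, v) = (∇Δ⁻¹φ, ∇Δ⁻¹v)`. In this shape,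
boundedness, symmetry and nonnegativity of the nonlocal term are immediate. -/
theorem opAL_apply (hd0 : d ≠ 0) (hd : d ≤ 3) (hP : P.Admissible) (s : Data D)
    (φ v : D.H1zero) : opAL hd0 hd hP s φ v = opA P s φ v := by
  rw [opAL_apply', opA, real_inner_comm, (isInvLaplacian_invLaplacian hd0 hd v.2).2.2,
    real_inner_comm]
  ring

theorem opAL_symm (hd0 : d ≠ 0) (hd : d ≤ 3) (hP : P.Admissible) (s : Data D)
    (φ v : D.H1zero) : opAL hd0 hd hP s φ v = opAL hd0 hd hP s v φ := by
  rw [opAL_apply', opAL_apply', real_inner_comm, P1_eq_inner hd hP, P1_eq_inner hd hP,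
    real_inner_comm (grad (φ : D.H1)), real_inner_comm (mulHstarL hd hP s (φ : D.H1)),
    real_inner_comm (fn (φ : D.H1))]

/-- The nonlocal term is nonnegative and can be dropped; the gradient term of `P₁` alone suffices,
by the Poincaré inequality. -/
theorem isCoercive_opAL (hd0 : d ≠ 0) (hd : d ≤ 3) (hP : P.Admissible) (s : Data D) :
    IsCoercive (opAL hd0 hd hP s) := by
  obtain ⟨C, hC, H⟩ := exists_norm_sq_le_grad hd D
  have hε := hP.ε_pos
  refine ⟨P.ε ^ 2 / 2 * C, by positivity, fun v => ?_⟩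
  rw [opAL_apply', real_inner_self_eq_norm_sq]
  have h1 := P1_self_ge hd hP s (v : D.H1)
  have h2 := mul_nonneg hP.αhat_pos.le (sq_nonneg ‖grad (invLaplacian (fn (v : D.H1)))‖)
  have h3 := mul_le_mul_of_nonneg_left (H v) (show 0 ≤ P.ε ^ 2 / 2 by positivity)
  calc P.ε ^ 2 / 2 * C * ‖v‖ * ‖v‖ = P.ε ^ 2 / 2 * (C * ‖v‖ ^ 2) := by ring
    _ ≤ _ := by linarith

theorem opAL_self_nonneg (hd0 : d ≠ 0) (hd : d ≤ 3) (hP : P.Admissible) (s : Data D)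
    (φ : D.H1zero) : 0 ≤ opAL hd0 hd hP s φ φ := by
  obtain ⟨C, hC, H⟩ := isCoercive_opAL hd0 hd hP s
  exact le_trans (by positivity) (H φ)

theorem opAL_self_eq_zero_iff (hd0 : d ≠ 0) (hd : d ≤ 3) (hP : P.Admissible) (s : Data D)
    (φ : D.H1zero) : opAL hd0 hd hP s φ φ = 0 ↔ φ = 0 := by
  refine ⟨fun h => ?_, fun h => by simp [h]⟩
  obtain ⟨C, hC, H⟩ := isCoercive_opAL hd0 hd hP s
  have h1 := H φ
  rw [h, mul_assoc] at h1
  have h2 : ‖φ‖ * ‖φ‖ ≤ 0 := by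
    by_contra hneg
    push Not at hneg
    nlinarith [mul_pos hC hneg]
  exact norm_eq_zero.1 (mul_self_eq_zero.1 (le_antisymm h2 (mul_self_nonneg _)))

/-- The form `(𝔸φ, ·)` on all of `H¹`. -/
noncomputable def opARight (hd : d ≤ 3) (hP : P.Admissible) (s : Data D) (φ : D.H1) :
    D.H1 →L[ℝ] ℝ :=
  (-P.αhat) • (innerSL ℝ (fn (invLaplacian (fn φ)))).comp D.fnL + P1L hd hP s φ

theorem opARight_apply (hd : d ≤ 3) (hP : P.Admissible) (s : Data D) (φ v : D.H1) :
    opARight hd hP s φ v = opA P s φ v := by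
  rw [opA, ← P1L_apply hd hP]
  rfl

theorem inner_fn_constH1 (hd0 : d ≠ 0) (u : D.L2) (c : ℝ) :
    inner ℝ u (fn (D.constH1 hd0 c)) = c * ∫ x in D.dom, u x := inner_const_right u c

/-! ### The reduced problem and the linear system. -/

/-- The reduced problem, with an arbitrary right-hand side. -/
theorem existsUnique_reduced (hd0 : d ≠ 0) (hd : d ≤ 3) (hP : P.Admissible) (s : Data D)
    (l : D.H1 →L[ℝ] ℝ) : ∃! q : D.H1zero × ℝ, ∀ v : D.H1,
      opA P s q.1 v - q.2 * (∫ x in D.dom, fn v x) = l v := by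
  have hvol := D.real_volume_dom_pos
  obtain ⟨φ, hφ⟩ := exists_apply_eq_of_isCoercive (isCoercive_opAL hd0 hd hP s)
    (l.comp D.H1zero.subtypeL)
  -- The residual of the Lax–Milgram solution on all of `H¹`. It vanishes on functions with mean
  -- zero, hence is a multiple of the integral, and the factor is the required real number.
  set w : D.H1 →L[ℝ] ℝ := opARight hd hP s φ - l with hw
  have hw0 : ∀ v ∈ D.H1zero, w v = 0 := fun v hv => by
    have h1 := hφ ⟨v, hv⟩
    rw [opAL_apply, ← opARight_apply hd hP] at h1
    exact sub_eq_zero.2 h1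
  have hsplit : ∀ v : D.H1, w v = w (D.constH1 hd0 1) / volume.real D.dom
      * ∫ x in D.dom, fn v x := by
    intro v
    have h1 := hw0 _ (sub_average_mem_H1zero hd0 v)
    have h2 : D.constH1 hd0 (⨍ x in D.dom, fn v x)
        = (⨍ x in D.dom, fn v x) • D.constH1 hd0 1 := by
      refine H1_ext ?_ (by simp)
      rw [fn_smul, fn_constH1, fn_constH1]
      have := (Lp.constₗ 2 D.vol ℝ : ℝ →ₗ[ℝ] D.L2).map_smul (⨍ x in D.dom, fn v x) 1
      simpa using this
    rw [map_sub, sub_eq_zero, h2, map_smul, smul_eq_mul] at h1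
    rw [h1, ← D.mul_average (fn v)]
    field_simp
  refine ⟨(φ, w (D.constH1 hd0 1) / volume.real D.dom), fun v => ?_, ?_⟩
  · have hv : w v = opA P s φ v - l v := by rw [← opARight_apply hd hP]; rfl
    rw [← hsplit v, hv, sub_sub_cancel]
  · rintro ⟨χ, V⟩ hq
    simp only at hq
    have hχφ : χ = φ := by
      refine sub_eq_zero.1 ((opAL_self_eq_zero_iff hd0 hd hP s _).1 ?_)
      rw [map_sub (opAL hd0 hd hP s) χ φ, sub_apply, hφ, opAL_apply]
      have h1 := hq ((χ - φ : D.H1zero) : D.H1)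
      rw [mem_H1zero.1 (χ - φ).2, mul_zero, sub_zero] at h1
      rw [h1]
      exact sub_self _
    subst hχφ
    have h1 := hq (D.constH1 hd0 1)
    rw [integral_fn_constH1, one_mul, ← opARight_apply hd hP] at h1
    rw [Prod.mk.injEq]
    refine ⟨rfl, ?_⟩
    rw [eq_div_iff hvol.ne', hw, sub_apply]
    linarith

/-- The functional `(g₄, ·)`. -/
noncomputable def g4L (hd : d ≤ 3) (hP : P.Admissible) (s : Data D) : D.H1 →L[ℝ] ℝ :=
  (P.ε ^ 2 / 2) • gramForm D.gradL s.φ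
    + (innerSL ℝ (s.U - (1 / 4 : ℝ) • mulHstarL hd hP s s.φ)).comp (mulHstarL hd hP s)
    - (P.β / P.δt) • gramForm D.fnL s.φ

/-- As `g₁ + Uⁿ = 2Uⁿ - (1/2)H*φⁿ`, the nonlinear part is `H* (Uⁿ - (1/4)H*φⁿ)`. Moving the factor
`H*` onto the test function leaves a pairing of two `L²` functions. -/
theorem g4_eq_inner (hd : d ≤ 3) (hP : P.Admissible) (s : Data D) (v : D.H1) :
    g4 P s v = P.ε ^ 2 / 2 * inner ℝ (grad s.φ) (grad v)
      + inner ℝ (s.U - (1 / 4 : ℝ) • mulHstarL hd hP s s.φ) (mulHstarL hd hP s v)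
      - P.β / P.δt * inner ℝ (fn s.φ) (fn v) := by
  rw [g4, inner_mulHstarL, ← integral_const_mul]
  congr 2
  refine integral_congr_ae ?_
  filter_upwards [coeFn_mulHstarL hd hP s s.φ,
    Lp.coeFn_sub s.U ((1 / 4 : ℝ) • mulHstarL hd hP s s.φ),
    Lp.coeFn_smul (1 / 4 : ℝ) (mulHstarL hd hP s s.φ)] with x h1 h2 h3
  rw [h2, Pi.sub_apply, h3, Pi.smul_apply, h1, g1, smul_eq_mul]
  ring

theorem g4L_apply (hd : d ≤ 3) (hP : P.Admissible) (s : Data D) (v : D.H1) :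
    g4L hd hP s v = g4 P s v := by
  rw [g4_eq_inner hd hP]
  rfl

/-- The right-hand side of the reduced problem for the mean value `m`. -/
noncomputable def reducedRhs (hd0 : d ≠ 0) (hd : d ≤ 3) (hP : P.Admissible) (s : Data D) (m : ℝ) :
    D.H1 →L[ℝ] ℝ :=
  -(innerSL ℝ (fn (invLaplacian (g3 P s - Lp.const 2 D.vol (P.αhat * m))))).comp D.fnL
    - g4L hd hP s - P1L hd hP s (D.constH1 hd0 m)

theorem reducedRhs_apply (hd0 : d ≠ 0) (hd : d ≤ 3) (hP : P.Admissible) (s : Data D) (m : ℝ)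
    (v : D.H1) : reducedRhs hd0 hd hP s m v
      = -inner ℝ (fn (invLaplacian (g3 P s - Lp.const 2 D.vol (P.αhat * m)))) (fn v)
        - g4 P s v - P1 P s (D.constH1 hd0 m) v := by
  rw [← g4L_apply hd hP, ← P1L_apply hd hP]
  rfl

theorem integral_sub_const (u : D.L2) (c : ℝ) :
    ∫ x in D.dom, (u - Lp.const 2 D.vol c : D.L2) x
      = (∫ x in D.dom, u x) - c * volume.real D.dom := by
  rw [integral_sub_L2, integral_congr_ae (D.coeFn_const c), setIntegral_const, smul_eq_mul,
    mul_comm c]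

/-- Solutions of the reduced problem give solutions of the linear system. -/
theorem exists_linearSystem_of_reduced (hd0 : d ≠ 0) (hd : d ≤ 3) (hP : P.Admissible) (s : Data D)
    {m : ℝ} (hm : ∫ x in D.dom, (g3 P s - Lp.const 2 D.vol (P.αhat * m) : D.L2) x = 0)
    {φ : D.H1zero} {V : ℝ}
    (h : ∀ v : D.H1, opA P s φ v - V * (∫ x in D.dom, fn v x) = reducedRhs hd0 hd hP s m v) :
    ∃ μ : D.H1, LinearSystem P s ((φ : D.H1) + D.constH1 hd0 m) μ ∧
      ⨍ x in D.dom, fn μ x = V := by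
  have hφ := isInvLaplacian_invLaplacian hd0 hd φ.2
  have hf := isInvLaplacian_invLaplacian hd0 hd hm
  set a := invLaplacian (fn (φ : D.H1)) with ha
  set b := invLaplacian (g3 P s - Lp.const 2 D.vol (P.αhat * m)) with hb
  -- The first equation dictates `Δμ = α̂φ - f` for the mean-zero part, which fixes `μ` up to a
  -- constant; that constant is its mean `V`. The second equation is then the reduced one.
  refine ⟨P.αhat • a - b + D.constH1 hd0 V, ⟨fun v => ?_, fun v => ?_⟩, ?_⟩
  · have h1 := hφ.2.2 v
    have h2 := hf.2.2 v
    have h3 : inner ℝ (Lp.const 2 D.vol (P.αhat * m)) (fn v)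
        = P.αhat * inner ℝ (Lp.const 2 D.vol m) (fn v) := by
      rw [real_inner_comm, inner_const_right, real_inner_comm, inner_const_right, mul_assoc]
    rw [inner_sub_left, h3] at h2
    simp only [grad_add, grad_sub, grad_smul, grad_constH1, add_zero, fn_add, fn_constH1]
    rw [inner_sub_left, real_inner_smul_left, inner_add_left, h1, h2]
    ring
  · have h1 := h v
    rw [reducedRhs_apply, opA] at h1
    have h2 : P1 P s ((φ : D.H1) + D.constH1 hd0 m) v
        = P1 P s φ v + P1 P s (D.constH1 hd0 m) v := by
      simp only [← P1L_apply hd hP, map_add, add_apply]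
    rw [h2]
    simp only [fn_add, fn_sub, fn_smul, fn_constH1]
    rw [inner_add_left, inner_sub_left, real_inner_smul_left,
      real_inner_comm _ (Lp.const 2 D.vol V), inner_const_right]
    linarith
  · have hint : ∫ x in D.dom, fn (P.αhat • a - b + D.constH1 hd0 V) x = V * volume.real D.dom := by
      rw [fn_add, integral_add_L2, fn_sub, integral_sub_L2, fn_smul, integral_smul_L2, hφ.2.1,
        hf.2.1, integral_fn_constH1]
      ring
    rw [← D.mul_average] at hint
    exact mul_right_cancel₀ D.real_volume_dom_pos.ne' hint

/-- Test the difference of the first equations with `δμ` and that of the second with `δφ`: then `α̂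
(P₁ δφ, δφ) = -‖∇δμ‖²`, so both sides vanish and `∇δφ = 0`. The first equation tested with `δφ` now
gives `δφ = 0`; after that the two equations, tested with `δμ`, give `δμ = 0` and `∇δμ = 0`. -/
theorem LinearSystem.unique (hd : d ≤ 3) (hP : P.Admissible) {s : Data D} {φ μ φ' μ' : D.H1}
    (h : LinearSystem P s φ μ) (h' : LinearSystem P s φ' μ') : φ = φ' ∧ μ = μ' := by
  have hα := hP.αhat_pos
  have e1 : ∀ v : D.H1, P.αhat * inner ℝ (fn (φ - φ')) (fn v)
      = -inner ℝ (grad (μ - μ')) (grad v) := by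
    intro v
    have h1 := h.1 v
    have h2 := h'.1 v
    rw [fn_sub, grad_sub, inner_sub_left, inner_sub_left]
    linarith
  have e2 : ∀ v : D.H1, inner ℝ (fn (μ - μ')) (fn v) = P1 P s (φ - φ') v := by
    intro v
    have h1 := h.2 v
    have h2 := h'.2 v
    rw [← P1L_apply hd hP] at h1 h2 ⊢
    rw [fn_sub, inner_sub_left, map_sub, sub_apply]
    linarith
  have e3 := e1 (μ - μ')
  have e4 := e2 (φ - φ')
  have h5 := P1_self_ge hd hP s (φ - φ')
  rw [real_inner_comm, e4, real_inner_self_eq_norm_sq] at e3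
  have hε := hP.ε_pos
  have hφ0 : ‖grad (φ - φ')‖ ^ 2 = 0 := by
    have h6 : 0 ≤ P1 P s (φ - φ') (φ - φ') := le_trans (by positivity) h5
    have h7 := mul_nonneg hα.le h6
    have h8 : P1 P s (φ - φ') (φ - φ') = 0 := by
      have : P.αhat * P1 P s (φ - φ') (φ - φ') = 0 :=
        le_antisymm (by rw [e3]; exact neg_nonpos.2 (sq_nonneg _)) h7
      exact (mul_eq_zero.1 this).resolve_left hα.ne'
    have h9 : P.ε ^ 2 / 2 * ‖grad (φ - φ')‖ ^ 2 ≤ 0 := h5.trans h8.le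
    by_contra hne
    have : 0 < ‖grad (φ - φ')‖ ^ 2 := lt_of_le_of_ne (sq_nonneg _) (Ne.symm hne)
    have : 0 < P.ε ^ 2 / 2 * ‖grad (φ - φ')‖ ^ 2 := by positivity
    linarith
  have hgφ : grad (φ - φ') = 0 := norm_eq_zero.1 (pow_eq_zero_iff two_ne_zero |>.1 hφ0)
  have e5 := e1 (φ - φ')
  rw [hgφ, inner_zero_right, neg_zero] at e5
  have hfφ : fn (φ - φ') = 0 := inner_self_eq_zero.1 ((mul_eq_zero.1 e5).resolve_left hα.ne')
  have hφ : φ - φ' = 0 := H1_ext hfφ hgφ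
  have e6 := e2 (μ - μ')
  have e7 := e1 (μ - μ')
  rw [← P1L_apply hd hP, hφ, map_zero, zero_apply] at e6
  rw [hfφ, inner_zero_left, mul_zero, zero_eq_neg] at e7
  exact ⟨sub_eq_zero.1 hφ, sub_eq_zero.1
    (H1_ext (inner_self_eq_zero.1 e6) (inner_self_eq_zero.1 e7))⟩

theorem existsUnique_linearSystem (hd0 : d ≠ 0) (hd : d ≤ 3) (hP : P.Admissible) (s : Data D) :
    ∃! p : D.H1 × D.H1, LinearSystem P s p.1 p.2 := by
  -- Testing the first equation with constants forces `α̂` times the mean of `φ` to be the mean of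
  -- `g₃`. This determines the mean to split off, without any condition on `ψⁿ`.
  have hm : ∫ x in D.dom, (g3 P s - Lp.const 2 D.vol
      (P.αhat * ((⨍ x in D.dom, g3 P s x) / P.αhat)) : D.L2) x = 0 := by
    rw [mul_div_cancel₀ _ hP.αhat_pos.ne', integral_sub_const, mul_average, sub_self]
  obtain ⟨⟨φ, V⟩, h, -⟩ := existsUnique_reduced hd0 hd hP s (reducedRhs hd0 hd hP s _)
  obtain ⟨μ, hμ, -⟩ := exists_linearSystem_of_reduced hd0 hd hP s hm h
  refine ⟨(_, μ), hμ, fun q hq => ?_⟩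
  have := hq.unique hd hP hμ
  exact Prod.ext this.1 this.2

/-- The terms added to `g₄` in `g` are `P₁` applied to the constant `V_φ`, whose gradient part
vanishes. -/
theorem reducedEquation_iff (hd0 : d ≠ 0) (hd : d ≤ 3) (hP : P.Admissible) (s : Data D)
    (φ : D.H1zero) (V : ℝ) : ReducedEquation P s φ V ↔ ∀ v : D.H1,
      opA P s φ v - V * (∫ x in D.dom, fn v x) = reducedRhs hd0 hd hP s (Vφ s) v := by
  refine forall_congr' fun v => ?_
  rw [reducedRhs_apply, redG, P1_eq_inner hd hP, grad_constH1, inner_zero_left, fn_constH1,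
    real_inner_comm _ (Lp.const 2 D.vol (Vφ s)), inner_const_right, redF, inner_mulHstarL]
  have h1 : ∫ x in D.dom, mulHstarL hd hP s (D.constH1 hd0 (Vφ s)) x * (Hstar P s x * fn v x)
      = ∫ x in D.dom, (Hstar P s x * Vφ s) * (Hstar P s x * fn v x) := by
    refine integral_congr_ae ?_
    filter_upwards [coeFn_mulHstarL hd hP s (D.constH1 hd0 (Vφ s)), D.coeFn_const (Vφ s)]
      with x h1 h2
    rw [h1, fn_constH1, h2]
  rw [h1]
  constructor <;> intro h <;> linarith

/-- Expanding gives `g₃ = α̂ φⁿ + 2(α/δt) ψⁿ`, so subtracting `α̂ V_φ` removes exactly the mean. -/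
theorem integral_redF (s : Data D) (hψ : ∫ x in D.dom, s.ψ x = 0) :
    ∫ x in D.dom, redF P s x = 0 := by
  have h1 : g3 P s = P.αhat • fn s.φ + (2 * (P.α / P.δt)) • s.ψ := by
    rw [g3, g2, Params.αhat]
    module
  rw [redF, integral_sub_const, h1, integral_add_L2, integral_smul_L2, integral_smul_L2, hψ, Vφ,
    ← D.mul_average (fn s.φ)]
  ring

theorem existsUnique_reducedEquation (hd0 : d ≠ 0) (hd : d ≤ 3) (hP : P.Admissible)
    (s : Data D) : ∃! q : D.H1zero × ℝ, ReducedEquation P s q.1 q.2 := by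
  simp_rw [reducedEquation_iff hd0 hd hP]
  exact existsUnique_reduced hd0 hd hP s _

/-- The given solution need not be manipulated: the solution of the reduced equation yields one of
the linear system, and by uniqueness it is the given one. -/
theorem LinearSystem.exists_reducedEquation (hd0 : d ≠ 0) (hd : d ≤ 3) (hP : P.Admissible)
    {s : Data D} (hψ : ∫ x in D.dom, s.ψ x = 0) {φ μ : D.H1} (h : LinearSystem P s φ μ) :
    ∃ φhat : D.H1zero, (∀ᵐ x ∂D.vol, fn φ x = fn (φhat : D.H1) x + Vφ s) ∧
      ReducedEquation P s φhat (⨍ x in D.dom, fn μ x) := by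
  obtain ⟨⟨χ, V⟩, hq, -⟩ := existsUnique_reducedEquation hd0 hd hP s
  obtain ⟨ν, hν, hV⟩ := exists_linearSystem_of_reduced hd0 hd hP s (integral_redF s hψ)
    ((reducedEquation_iff hd0 hd hP s χ V).1 hq)
  obtain ⟨rfl, rfl⟩ := h.unique hd hP hν
  refine ⟨χ, ?_, by rw [hV]; exact hq⟩
  filter_upwards [Lp.coeFn_add (fn (χ : D.H1)) (Lp.const 2 D.vol (Vφ s)), D.coeFn_const (Vφ s)]
    with x h1 h2
  rw [fn_add, fn_constH1, h1, Pi.add_apply, h2]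

end VCH

namespace VCH

/-! ### The scheme: one step, conservation of means, iteration. -/

open Setting

variable {d : ℕ} {D : Setting d} {P : Params}

theorem schemeStep_auxiliary_iff (hd : d ≤ 3) (hP : P.Admissible) (s : Data D) (φ : D.H1)
    (U : D.L2) :
    (∀ᵐ x ∂D.vol, U x - s.U x = 1 / 2 * Hstar P s x * (fn φ x - fn s.φ x)) ↔
      U = s.U + (1 / 2 : ℝ) • (mulHstarL hd hP s φ - mulHstarL hd hP s s.φ) := by
  have h : ∀ᵐ x ∂D.vol,
      (s.U + (1 / 2 : ℝ) • (mulHstarL hd hP s φ - mulHstarL hd hP s s.φ) : D.L2) x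
        = s.U x + 1 / 2 * Hstar P s x * (fn φ x - fn s.φ x) := by
    filter_upwards [
      Lp.coeFn_add s.U ((1 / 2 : ℝ) • (mulHstarL hd hP s φ - mulHstarL hd hP s s.φ)),
      Lp.coeFn_smul (1 / 2 : ℝ) (mulHstarL hd hP s φ - mulHstarL hd hP s s.φ),
      Lp.coeFn_sub (mulHstarL hd hP s φ) (mulHstarL hd hP s s.φ),
      coeFn_mulHstarL hd hP s φ, coeFn_mulHstarL hd hP s s.φ] with x h1 h2 h3 h4 h5
    rw [h1, Pi.add_apply, h2, Pi.smul_apply, h3, Pi.sub_apply, h4, h5, smul_eq_mul]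
    ring
  constructor
  · intro hU
    refine Lp.ext ?_
    filter_upwards [hU, h] with x h1 h2
    rw [h2, ← h1]
    ring
  · intro hU
    rw [hU]
    filter_upwards [h] with x h1
    rw [h1]
    ring

theorem schemeStep_velocity_iff (s : Data D) (φ : D.H1) (ψ : D.L2) :
    (1 / 2 : ℝ) • (ψ + s.ψ) = (1 / P.δt) • (fn φ - fn s.φ) ↔
      ψ = (2 / P.δt) • (fn φ - fn s.φ) - s.ψ := by
  constructor
  · intro h
    have h1 : ψ = (2 : ℝ) • ((1 / 2 : ℝ) • (ψ + s.ψ)) - s.ψ := by module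
    rw [h1, h]
    module
  · rintro rfl
    module

/-- One step of the scheme amounts to the linear system, complemented by explicit formulas. -/
theorem schemeStep_iff (hd : d ≤ 3) (hP : P.Admissible) (s : Data D) (φ μ : D.H1) (ψ U : D.L2) :
    SchemeStep P s φ μ ψ U ↔ LinearSystem P s φ μ ∧
      ψ = (2 / P.δt) • (fn φ - fn s.φ) - s.ψ ∧
      U = s.U + (1 / 2 : ℝ) • (mulHstarL hd hP s φ - mulHstarL hd hP s s.φ) := by
  have hbal : ∀ v : D.H1, ψ = (2 / P.δt) • (fn φ - fn s.φ) - s.ψ →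
      P.α / P.δt * inner ℝ (ψ - s.ψ) (fn v) + 1 / 2 * inner ℝ (ψ + s.ψ) (fn v)
        = P.αhat * inner ℝ (fn φ) (fn v) - inner ℝ (g3 P s) (fn v) := by
    rintro v rfl
    simp only [g3, g2, Params.αhat, inner_sub_left, inner_add_left, inner_neg_left,
      real_inner_smul_left]
    ring
  have hpot : ∀ v : D.H1,
      U = s.U + (1 / 2 : ℝ) • (mulHstarL hd hP s φ - mulHstarL hd hP s s.φ) →
      P.ε ^ 2 / 2 * inner ℝ (grad φ + grad s.φ) (grad v)
        + (∫ x in D.dom, (U x + s.U x) / 2 * Hstar P s x * fn v x)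
        + P.β / P.δt * inner ℝ (fn φ - fn s.φ) (fn v) = P1 P s φ v + g4 P s v := by
    intro v hU
    have h1 : ∫ x in D.dom, (U x + s.U x) / 2 * Hstar P s x * fn v x
        = inner ℝ ((1 / 2 : ℝ) • (U + s.U)) (mulHstarL hd hP s v) := by
      rw [inner_mulHstarL]
      refine integral_congr_ae ?_
      filter_upwards [Lp.coeFn_smul (1 / 2 : ℝ) (U + s.U), Lp.coeFn_add U s.U] with x h1 h2
      rw [h1, Pi.smul_apply, h2, Pi.add_apply, smul_eq_mul]
      ring
    rw [h1, hU, P1_eq_inner hd hP, g4_eq_inner hd hP]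
    simp only [inner_sub_left, inner_add_left, real_inner_smul_left]
    ring
  constructor
  · rintro ⟨h1, h2, h3, h4⟩
    have hψ := (schemeStep_velocity_iff s φ ψ).1 h4
    have hU := (schemeStep_auxiliary_iff hd hP s φ U).1 h3
    refine ⟨⟨fun v => ?_, fun v => ?_⟩, hψ, hU⟩
    · have := h1 v
      rw [hbal v hψ] at this
      linarith
    · rw [h2 v, hpot v hU]
  · rintro ⟨⟨h1, h2⟩, hψ, hU⟩
    refine ⟨fun v => ?_, fun v => ?_, (schemeStep_auxiliary_iff hd hP s φ U).2 hU,
      (schemeStep_velocity_iff s φ ψ).2 hψ⟩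
    · rw [hbal v hψ, h1 v]
      ring
    · rw [h2 v, hpot v hU]

/-- One step of the scheme preserves the mean values. -/
theorem SchemeStep.integral_eq (hd0 : d ≠ 0) (hP : P.Admissible) {s : Data D} {φ μ : D.H1}
    {ψ U : D.L2} (h : SchemeStep P s φ μ ψ U) (hψ : ∫ x in D.dom, s.ψ x = 0) :
    ∫ x in D.dom, ψ x = 0 ∧ ∫ x in D.dom, fn φ x = ∫ x in D.dom, fn s.φ x := by
  have hα := hP.α_nonneg
  have hδ := hP.δt_pos
  -- The test function `1` removes the flux and leaves `(α/δt + 1/2) ∫ψⁿ⁺¹ = (α/δt - 1/2) ∫ψⁿ`. The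
  -- velocity equation then carries this over to `φ`.
  have h1 := h.balance (D.constH1 hd0 1)
  rw [inner_fn_constH1, inner_fn_constH1, grad_constH1, inner_zero_right, integral_sub_L2,
    integral_add_L2, hψ] at h1
  have h2 : (P.α / P.δt + 1 / 2) * ∫ x in D.dom, ψ x = 0 := by linarith
  have h3 : ∫ x in D.dom, ψ x = 0 := (mul_eq_zero.1 h2).resolve_left (by positivity)
  refine ⟨h3, ?_⟩
  have h4 := congrArg (fun u : D.L2 => ∫ x in D.dom, u x) h.velocity
  simp only [integral_smul_L2, integral_add_L2, integral_sub_L2] at h4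
  rw [h3, hψ, add_zero, mul_zero] at h4
  have h5 := (mul_eq_zero.1 h4.symm).resolve_left (by positivity)
  linarith

theorem exists_schemeStep (hd0 : d ≠ 0) (hd : d ≤ 3) (hP : P.Admissible) (s : Data D) :
    ∃ q : (D.H1 × D.H1) × D.L2 × D.L2, SchemeStep P s q.1.1 q.1.2 q.2.1 q.2.2 := by
  obtain ⟨p, hp, -⟩ := existsUnique_linearSystem hd0 hd hP s
  exact ⟨(p, _, _), (schemeStep_iff hd hP s p.1 p.2 _ _).2 ⟨hp, rfl, rfl⟩⟩

theorem SchemeStep.unique (hd : d ≤ 3) (hP : P.Admissible) {s : Data D}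
    {φ μ φ' μ' : D.H1} {ψ U ψ' U' : D.L2} (h : SchemeStep P s φ μ ψ U)
    (h' : SchemeStep P s φ' μ' ψ' U') : φ = φ' ∧ μ = μ' ∧ ψ = ψ' ∧ U = U' := by
  obtain ⟨h1, h2, h3⟩ := (schemeStep_iff hd hP s φ μ ψ U).1 h
  obtain ⟨h1', h2', h3'⟩ := (schemeStep_iff hd hP s φ' μ' ψ' U').1 h'
  obtain ⟨rfl, rfl⟩ := h1.unique hd hP h1'
  exact ⟨rfl, rfl, h2.trans h2'.symm, h3.trans h3'.symm⟩

theorem memLp_sqrt (hd : d ≤ 3) (hP : P.Admissible) (φ : D.H1) :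
    MemLp (fun x => Real.sqrt (P.pot.F (fn φ x) + P.B)) 2 D.vol := by
  obtain ⟨K, -, H⟩ := exists_eLpNorm_four_le hd D
  obtain ⟨C, hC, hF⟩ := hP.exists_sqrt_le
  have h1 : MemLp (fun x => C * (1 + fn φ x * fn φ x)) 2 D.vol :=
    ((memLp_const (1 : ℝ)).add ((H φ).1.mul' (H φ).1)).const_mul C
  refine h1.mono' ?_ (Filter.Eventually.of_forall fun x => ?_)
  · exact (((P.pot.measurable_F.add_const P.B).sqrt).comp_aemeasurable
      (Lp.aestronglyMeasurable (fn φ)).aemeasurable).aestronglyMeasurable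
  · rw [Real.norm_of_nonneg (Real.sqrt_nonneg _), ← sq]
    exact hF _

/-- The scheme can be run, in a unique way, from every initial value. -/
theorem exists_isRun_unique (hd0 : d ≠ 0) (hd : d ≤ 3) (hP : P.Admissible) (φ₀ : D.H1) :
    ∃ R : Iterates D, R.IsRun P φ₀ ∧ ∀ R' : Iterates D, R'.IsRun P φ₀ → R' = R := by
  choose q hq using fun s : Data D => exists_schemeStep hd0 hd hP s
  -- Both entries are `φ₀`, in agreement with `0 - 1 = 0` in the definition of the data at time
  -- zero.
  let start : Data D := ⟨φ₀, φ₀, 0, (memLp_sqrt hd hP φ₀).toLp _⟩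
  let next : Data D → Data D := fun s => ⟨s.φ, (q s).1.1, (q s).2.1, (q s).2.2⟩
  let dat : ℕ → Data D := fun n => next^[n] start
  have hdat : ∀ n, dat (n + 1) = next (dat n) := fun n => Function.iterate_succ_apply' next n start
  let R : Iterates D := ⟨fun n => (dat n).φ, fun n => (q (dat n)).1.2, fun n => (dat n).ψ,
    fun n => (dat n).U⟩
  have hR : ∀ n, R.data n = dat n := by
    intro n
    cases n with
    | zero => rfl
    | succ n =>
      simp only [Iterates.data, R, hdat, Nat.add_sub_cancel, next]
  refine ⟨R, ⟨rfl, rfl, (memLp_sqrt hd hP φ₀).coeFn_toLp, fun n => ?_⟩, fun R' hR' => ?_⟩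
  · rw [hR]
    have := hq (dat n)
    simp only [R, hdat, next]
    exact this
  -- Uniqueness of one step, conditional on equal data. It drives the induction for the data and
  -- afterwards identifies `μ`, which is not part of the data.
  · have hstep : ∀ n, R'.data n = dat n → R'.φ (n + 1) = (dat (n + 1)).φ ∧
        R'.μ n = (q (dat n)).1.2 ∧ R'.ψ (n + 1) = (dat (n + 1)).ψ ∧
        R'.U (n + 1) = (dat (n + 1)).U := by
      intro n hn
      have h1 := hR'.step n
      rw [hn] at h1
      rw [hdat]
      exact h1.unique hd hP (hq (dat n))
    have hdata : ∀ n, R'.data n = dat n := by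
      intro n
      induction n with
      | zero =>
        have hU : R'.U 0 = (memLp_sqrt hd hP φ₀).toLp _ := by
          refine Lp.ext ?_
          filter_upwards [hR'.U_zero, (memLp_sqrt hd hP φ₀).coeFn_toLp] with x h1 h2
          rw [h1, h2]
        simp only [Iterates.data, hR'.φ_zero, hR'.ψ_zero, hU]
        rfl
      | succ n ih =>
        obtain ⟨h1, -, h3, h4⟩ := hstep n ih
        have h5 : R'.φ n = (dat n).φ := congrArg Data.φ ih
        simp only [Iterates.data, Nat.add_sub_cancel, h1, h3, h4, h5, hdat, next]
    have e1 : R'.φ = R.φ := funext fun n => congrArg Data.φ (hdata n)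
    have e2 : R'.μ = R.μ := funext fun n => (hstep n (hdata n)).2.1
    have e3 : R'.ψ = R.ψ := funext fun n => congrArg Data.ψ (hdata n)
    have e4 : R'.U = R.U := funext fun n => congrArg Data.U (hdata n)
    obtain ⟨a, b, c, e⟩ := R'
    simp only at e1 e2 e3 e4
    rw [e1, e2, e3, e4]

theorem Iterates.IsRun.integral_eq (hd0 : d ≠ 0) (hP : P.Admissible) {R : Iterates D} {φ₀ : D.H1}
    (h : R.IsRun P φ₀) (n : ℕ) : ∫ x in D.dom, R.ψ n x = 0 ∧
      ∫ x in D.dom, fn (R.φ n) x = ∫ x in D.dom, fn φ₀ x := by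
  induction n with
  | zero =>
    rw [h.ψ_zero, h.φ_zero]
    exact ⟨integral_eq_zero_of_ae (Lp.coeFn_zero ℝ 2 D.vol), rfl⟩
  | succ n ih =>
    obtain ⟨h1, h2⟩ := (h.step n).integral_eq hd0 hP ih.1
    exact ⟨h1, h2.trans ih.2⟩

end VCH

theorem theorem3p1 {d : ℕ} (hd : d = 2 ∨ d = 3) (D : VCH.Setting d) (P : VCH.Params)
    (hP : P.Admissible) :
    -- the operator `Δ⁻¹` is well defined on functions with mean zero
    (∀ u : D.L2, ∫ x in D.dom, u x = 0 →
      VCH.Setting.IsInvLaplacian u (VCH.Setting.invLaplacian u) ∧ ∀ v, VCH.Setting.IsInvLaplacian u v → v = VCH.Setting.invLaplacian u) ∧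
    -- one step of the scheme, from arbitrary data
    (∀ s : VCH.Data D,
      -- all integrals in the weak formulation converge
      (∀ v : D.H1, MemLp (fun x => VCH.Hstar P s x * VCH.Setting.fn v x) 2 D.vol) ∧
      -- the linear system has a unique solution
      (∃! p : D.H1 × D.H1, VCH.LinearSystem P s p.1 p.2) ∧
      -- the operator `𝔸` is linear, bounded, symmetric, positive definite and coercive
      (∃ A : D.H1zero →L[ℝ] D.H1zero →L[ℝ] ℝ,
        (∀ φ v : D.H1zero, A φ v = VCH.opA P s φ v) ∧
        (∀ φ v : D.H1zero, A φ v = A v φ) ∧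
        (∀ φ : D.H1zero, 0 ≤ A φ φ ∧ (A φ φ = 0 ↔ φ = 0)) ∧
        IsCoercive A) ∧
      -- reduction to variables with mean zero
      (∫ x in D.dom, s.ψ x = 0 →
        ∫ x in D.dom, VCH.redF P s x = 0 ∧
        (∃! q : D.H1zero × ℝ, VCH.ReducedEquation P s q.1 q.2) ∧
        ∀ φ μ : D.H1, VCH.LinearSystem P s φ μ →
          ∃ φhat : D.H1zero, (∀ᵐ x ∂D.vol, VCH.Setting.fn φ x = VCH.Setting.fn (φhat : D.H1) x + VCH.Vφ s) ∧
            VCH.ReducedEquation P s φhat (⨍ x in D.dom, VCH.Setting.fn μ x))) ∧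
    -- consequently the scheme can be run, in a unique way, from every initial value
    (∀ φ₀ : D.H1, ∃ R : VCH.Iterates D, R.IsRun P φ₀ ∧
      (∀ R' : VCH.Iterates D, R'.IsRun P φ₀ → R' = R) ∧
      ∀ n, VCH.LinearSystem P (R.data n) (R.φ (n + 1)) (R.μ n) ∧
        ∫ x in D.dom, R.ψ n x = 0 ∧
        ∫ x in D.dom, VCH.Setting.fn (R.φ n) x = ∫ x in D.dom, VCH.Setting.fn φ₀ x) := by
  have hd0 : d ≠ 0 := by omega
  have hd3 : d ≤ 3 := by omega
  refine ⟨fun u hu => ?_, fun s => ⟨fun v => VCH.memLp_Hstar_mul hd3 hP s v,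
    VCH.existsUnique_linearSystem hd0 hd3 hP s, ?_, fun hψ => ?_⟩, fun φ₀ => ?_⟩
  · have h := VCH.Setting.isInvLaplacian_invLaplacian hd0 hd3 hu
    exact ⟨h, fun v hv => hv.unique hd3 h⟩
  · exact ⟨VCH.opAL hd0 hd3 hP s, VCH.opAL_apply hd0 hd3 hP s, VCH.opAL_symm hd0 hd3 hP s,
      fun φ => ⟨VCH.opAL_self_nonneg hd0 hd3 hP s φ, VCH.opAL_self_eq_zero_iff hd0 hd3 hP s φ⟩,
      VCH.isCoercive_opAL hd0 hd3 hP s⟩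
  · exact ⟨VCH.integral_redF s hψ, VCH.existsUnique_reducedEquation hd0 hd3 hP s,
      fun φ μ h => h.exists_reducedEquation hd0 hd3 hP hψ⟩
  · obtain ⟨R, hR, huniq⟩ := VCH.exists_isRun_unique hd0 hd3 hP φ₀
    refine ⟨R, hR, huniq, fun n => ⟨?_, hR.integral_eq hd0 hP n⟩⟩
    exact ((VCH.schemeStep_iff hd3 hP _ _ _ _ _).1 (hR.step n)).1
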